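/- Let $P\subset\mathbb R^2$ be a Euclidean polygon, possibly with obstacles: $P$ is the closed region bounded by a simple closed polygonal curve, from which the open regions enclosed by $q\ge 0$ further simple closed polygonal curves (the obstacles) have been removed, where the obstacles lie strictly inside the outer curve and the closed regions they occupy are pairwise disjoint. Let $p$ be the total number of corners (vertices of all $q+1$ boundary curves; straight angles are allowed), and put $$\kappa(P)=p+2q-2 .$$ The phase space $X$ of the billiard map $T$ consists of the oriented segments with distinct endpoints in $\partial P$ whose relative interior lies in the interior of $P$. A segment $x\in X$ is singular if it ends in a corner of $P$; then $Tx$ is undefined. If $x$ ends at a non-corner point $b\in\partial P$, then $Tx\in X$ is the segment that starts at $b$ in the direction obtained by reflecting the direction of $x$ in the line of the side containing $b$. For $k\ge 1$, the orbit $x,Tx,\dots,T^{k-1}x$ is a singular orbit of length $k$ if $T^{k-1}x$ is the first singular element in this sequence. For a direction $\theta\in S^1$ and $n\in\mathbb N$ let $gd_\theta(n)$ be the number of phase points $x\in X$ with direction $\theta$ that yield a singular orbit of length $k\le n$. Then for every such $P$ and every $n\in\mathbb N=\{0,1,2,\dots\}$ the number $gd_\theta(n)$ is finite for every $\theta$,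 the function $\theta\mapsto gd_\theta(n)$ is integrable with respect to Lebesgue measure $d\theta$ on $S^1=\mathbb R/2\pi\mathbb Z$, and $$\int_{S^1} gd_\theta(n)\,d\theta=\pi\,\kappa(P)\,n .$$ -/

import Mathlib

open scoped Real

namespace PolygonalBilliard

/-- The Euclidean plane. -/
abbrev Plane : Type := EuclideanSpace ℝ (Fin 2)

/-- A simple closed polygonal curve in the plane: at least three vertices, pairwise distinct, and
two different edges meet at most in a vertex at which one of them ends and the other begins.
Straight angles are allowed at the vertices. -/
structure SimplePolygon where
  size : ℕ
  three_le_size : 3 ≤ size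
  toPolygon : Polygon Plane size
  injective_vertices : Function.Injective toPolygon.vertices
  edges_meet : ∀ i j : Fin size, i ≠ j →
    ∀ x ∈ toPolygon.edgeSet ℝ i ∩ toPolygon.edgeSet ℝ j,
      (j = finRotate size i ∧ x = toPolygon.vertices j) ∨
        (i = finRotate size j ∧ x = toPolygon.vertices i)

namespace SimplePolygon

/-- The curve itself, the union of its edges. -/
def curve (J : SimplePolygon) : Set Plane := J.toPolygon.boundary ℝ

/-- The open region enclosed by the curve: the union of the bounded connected components of the
complement of the curve. -/
def inside (J : SimplePolygon) : Set Plane :=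
  {x | x ∉ J.curve ∧ Bornology.IsBounded (connectedComponentIn J.curveᶜ x)}

end SimplePolygon

/-- A Euclidean polygon with finitely many polygonal obstacles: the obstacles lie strictly inside
the outer boundary curve, and the closed regions they occupy are pairwise disjoint. -/
structure EuclideanPolygon where
  outer : SimplePolygon
  numObstacles : ℕ
  obstacle : Fin numObstacles → SimplePolygon
  obstacle_subset : ∀ i, (obstacle i).curve ⊆ outer.inside
  obstacle_disjoint : ∀ i j, i ≠ j →
    Disjoint (obstacle i).curve ((obstacle j).curve ∪ (obstacle j).inside)

namespace EuclideanPolygon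

/-- The boundary curves: the outer one and those of the obstacles. -/
def component (P : EuclideanPolygon) : Option (Fin P.numObstacles) → SimplePolygon
  | none => P.outer
  | some i => P.obstacle i

/-- The closed planar domain: the closed region bounded by the outer curve, without the open
regions occupied by the obstacles. -/
def carrier (P : EuclideanPolygon) : Set Plane :=
  (P.outer.curve ∪ P.outer.inside) \ ⋃ i, (P.obstacle i).inside

/-- The boundary of the domain. -/
def bdry (P : EuclideanPolygon) : Set Plane := ⋃ c, (P.component c).curve

/-- The set of corners. -/
def corners (P : EuclideanPolygon) : Set Plane :=
  ⋃ c, Set.range (P.component c).toPolygon.vertices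

/-- `κ(P) = p + 2q - 2` for a polygon with `p` corners and `q` obstacles. -/
noncomputable def kappa (P : EuclideanPolygon) : ℤ :=
  (P.corners.ncard : ℤ) + 2 * (P.numObstacles : ℤ) - 2

/-- The phase space of the billiard map: oriented segments inside the polygon that join two
boundary points and have no other point on the boundary. -/
@[ext]
structure PhasePoint (P : EuclideanPolygon) where
  source : Plane
  target : Plane
  source_mem : source ∈ P.bdry
  target_mem : target ∈ P.bdry
  source_ne_target : source ≠ target
  interior_subset : openSegment ℝ source target ⊆ P.carrier \ P.bdry

namespace PhasePoint

variable {P : EuclideanPolygon}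

/-- The direction of an oriented segment, a unit vector. -/
noncomputable def direction (x : P.PhasePoint) : Plane :=
  ‖x.target - x.source‖⁻¹ • (x.target - x.source)

/-- A phase point is singular if it ends in a corner. -/
def IsSingular (x : P.PhasePoint) : Prop := x.target ∈ P.corners

/-- The graph of the billiard map `T`: `IsNext x y` means `y = T x`. The segment `x` ends at a
point of an open side, `y` starts there, and its direction is that of `x` reflected in the line
of that side. -/
def IsNext (x y : P.PhasePoint) : Prop :=
  y.source = x.target ∧
    ∃ (c : Option (Fin P.numObstacles)) (i : Fin (P.component c).size),
      x.target ∈ openSegment ℝ ((P.component c).toPolygon.vertices i)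
        ((P.component c).toPolygon.vertices (finRotate _ i)) ∧
      y.direction =
        (ℝ ∙ ((P.component c).toPolygon.vertices (finRotate _ i) -
          (P.component c).toPolygon.vertices i)).reflection x.direction

end PhasePoint

/-- A point lies in at most one open side. -/
theorem side_unique (P : EuclideanPolygon) (p : Plane)
   {c c' : Option (Fin P.numObstacles)} {i : Fin (P.component c).size} {j : Fin (P.component c').size}
   (h : p ∈ openSegment ℝ ((P.component c).toPolygon.vertices i) ((P.component c).toPolygon.vertices (finRotate _ i)))
   (h' : p ∈ openSegment ℝ ((P.component c').toPolygon.vertices j) ((P.component c').toPolygon.vertices (finRotate _ j))) :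
   (⟨c, i⟩ : Σ c, Fin (P.component c).size) = ⟨c', j⟩ := by
  have key : ∀ (J : SimplePolygon) (i : Fin J.size), p ∈ openSegment ℝ (J.toPolygon.vertices i) (J.toPolygon.vertices (finRotate _ i)) →
      p ∈ J.toPolygon.edgeSet ℝ i ∧ p ∈ J.curve ∧ p ≠ J.toPolygon.vertices i := by
    intro J i hp
    have h1 : p ∈ J.toPolygon.edgeSet ℝ i := by
      have := openSegment_subset_segment ℝ _ _ hp
      rwa [← affineSegment_eq_segment] at this
    refine ⟨h1, Set.mem_iUnion.2 ⟨i, h1⟩, ?_⟩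
    rintro rfl
    rw [left_mem_openSegment_iff] at hp
    have := J.injective_vertices hp
    have h3 := J.three_le_size
    rcases J with ⟨n, hn, _, _, _⟩
    obtain ⟨m, rfl⟩ : ∃ m, n = m + 2 := ⟨n - 2, by change 3 ≤ n at hn; omega⟩
    simp at this
  have k1 := key _ _ h
  have k2 := key _ _ h'
  have hc : c = c' := by
    rcases c with _ | c <;> rcases c' with _ | c'
    · rfl
    · exact absurd k1.2.1 (P.obstacle_subset c' k2.2.1).1
    · exact absurd k2.2.1 (P.obstacle_subset c k1.2.1).1
    · by_contra hne
      exact Set.disjoint_left.1 (P.obstacle_disjoint c c' (by simpa using hne)) k1.2.1 (Or.inl k2.2.1)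
  subst hc
  by_contra hne
  have hij : i ≠ j := by rintro rfl; exact hne rfl
  rcases (P.component c).edges_meet i j hij p ⟨k1.1, k2.1⟩ with h | h
  · exact k2.2.2 h.2
  · exact k1.2.2 h.2

/-- The billiard map is single-valued: `T x` is determined by `x`. -/
theorem PhasePoint.next_unique {P : EuclideanPolygon} {x y z : P.PhasePoint}
    (hy : x.IsNext y) (hz : x.IsNext z) : y = z := by
  obtain ⟨sy, c, i, hi, dy⟩ := hy
  obtain ⟨sz, c', j, hj, dz⟩ := hz
  have := side_unique P _ hi hj
  cases this
  have hd : y.direction = z.direction := dy.trans dz.symm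
  have hs : y.source = z.source := sy.trans sz.symm
  rcases y with ⟨a, b, ha, hb, hab, ho⟩
  rcases z with ⟨a', b', ha', hb', hab', ho'⟩
  simp only [PhasePoint.direction] at hs hd
  subst hs
  have hr : SameRay ℝ (b - a) (b' - a) :=
    (sameRay_iff_inv_norm_smul_eq_of_ne (sub_ne_zero.2 hab.symm) (sub_ne_zero.2 hab'.symm)).2 hd
  obtain ⟨r, hr0, hr⟩ := hr.exists_pos_left (sub_ne_zero.2 hab.symm) (sub_ne_zero.2 hab'.symm)
  have hb'' : b' = a + r • (b - a) := by rw [hr]; abel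
  have : r = 1 := by
    rcases lt_trichotomy r 1 with h | h | h
    · exact absurd hb' (ho (by
        rw [openSegment_eq_image']; exact ⟨r, ⟨hr0, h⟩, hb''.symm⟩)).2
    · exact h
    · exact absurd hb (ho' (by
        rw [openSegment_eq_image']; refine ⟨r⁻¹, ⟨by positivity, inv_lt_one_of_one_lt₀ h⟩, ?_⟩
        simp only [← hr, smul_smul, inv_mul_cancel₀ hr0.ne', one_smul]; abel)).2
  subst this
  have : b = b' := by rw [hb'', one_smul]; abel
  subst this
  rfl

namespace PhasePoint

variable {P : EuclideanPolygon}

/-- The orbit `x, T x, …, T ^ (k - 1) x` is a singular orbit of length `k`: its last element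
`T ^ (k - 1) x` is the first singular one. -/
def HasSingularOrbit (x : P.PhasePoint) (k : ℕ) : Prop :=
  1 ≤ k ∧ ∃ o : ℕ → P.PhasePoint, o 0 = x ∧
    (∀ i, i + 1 < k → ¬ (o i).IsSingular ∧ (o i).IsNext (o (i + 1))) ∧
    (o (k - 1)).IsSingular

end PhasePoint

/-- The unit vector in direction `θ`. -/
noncomputable def unitVector (θ : ℝ) : Plane := !₂[Real.cos θ, Real.sin θ]

/-- The fiber `R_θ` of the phase space: the phase points with direction `θ`. -/
def fiber (P : EuclideanPolygon) (θ : ℝ) : Set P.PhasePoint :=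
  {x | x.direction = unitVector θ}

/-- The phase points in direction `θ` that yield singular orbits of length at most `n`. -/
def singularSet (P : EuclideanPolygon) (θ : ℝ) (n : ℕ) : Set P.PhasePoint :=
  {x | x ∈ P.fiber θ ∧ ∃ k ≤ n, x.HasSingularOrbit k}

/-- The counting function `gd_θ(n)` for singular orbits in direction `θ`. -/
noncomputable def gd (P : EuclideanPolygon) (θ : ℝ) (n : ℕ) : ℕ := (P.singularSet θ n).ncard

end EuclideanPolygon

end PolygonalBilliard

/-! Let `f k θ` be the number of phase points in direction `θ` whose singular orbit has length
exactly `k`. The length of a singular orbit is unique, so `gd` is the sum of `f k` over `1 ≤ k ≤ n`.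
It therefore suffices that each `f k` is finite and integrable with integral `π κ`.

For `k = 1` the phase points are the segments that end in a corner. A corner `s` is reached in
direction `θ` by exactly one segment if the opposite direction leads from `s` into the domain, and
by none if it leads out. Hence `s` contributes its angle, as seen from the domain, to the integral.
These angles add up to `π (p₀ - 2)` along the outer curve and to `π (pᵢ + 2)` along an obstacle with
`pᵢ` corners, in total `π κ` (`integral_singularOrbits_one`).

For the step from `k` to `k + 1`, a phase point of direction `θ` is determined by its end point, and
`T` sends those that end on side `s` bijectively to the phase points that start there in direction
`2 ω - θ`, where `ω` is the angle of `s` (`exists_previous`). Thus `f (k + 1) θ` is the sum over the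
sides of the number of orbits of length `k` that start on the side in the reflected direction.
Reflections preserve `dθ`, and summing over the sides recovers `f k` except in directions in which
some orbit of length `k` starts in a corner. By unfolding, such a direction points from a corner to
one of finitely many reflected corners, so only countably many directions are lost
(`countable_sources_corner`).

Two ingredients need work. One is the angle sum together with the fact that the angles lie on the
inner side: the total turning of a simple polygon is `± 2π` by a discrete form of Hopf's argument
(`sum_turn`), and the winding number tells which side is enclosed (`sectorIn_enclosed`). The other
is finiteness and measurability: the starting points of singular orbits are listed by finitely many
measurable functions of `θ` (`isMeasurableFamily_sources`). -/

/-! ### Total turning of a simple closed polygon. -/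

namespace PolygonalBilliard

open Complex Finset

/-- The oriented angle in `(-π, π]` from `a` to `b`. -/
noncomputable def ang (a b : ℂ) : ℝ := arg (b / a)

theorem arg_eq_of_eq_mul_exp {z : ℂ} {r φ : ℝ} (hr : 0 < r) (hφ : φ ∈ Set.Ioc (-π) π)
    (hz : z = r * exp (φ * I)) : arg z = φ := by
  rw [hz, arg_real_mul _ hr, arg_exp_mul_I, toIocMod_eq_self]
  simpa [two_mul] using hφ

theorem ang_eq_sub {a b : ℂ} {r s α β : ℝ} (hr : 0 < r) (hs : 0 < s)
    (ha : a = r * exp (α * I)) (hb : b = s * exp (β * I)) (h : β - α ∈ Set.Ioc (-π) π) :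
    ang a b = β - α := by
  refine arg_eq_of_eq_mul_exp (r := s / r) (by positivity) h ?_
  rw [ha, hb]
  push_cast
  rw [sub_mul, Complex.exp_sub]
  have : (r : ℂ) ≠ 0 := by exact_mod_cast hr.ne'
  field_simp

theorem ang_eq_arg_sub_arg {a b : ℂ} (ha : a ≠ 0) (hb : b ≠ 0)
    (h : arg b - arg a ∈ Set.Ioc (-π) π) : ang a b = arg b - arg a :=
  ang_eq_sub (norm_pos_iff.2 ha) (norm_pos_iff.2 hb) (norm_mul_exp_arg_mul_I a).symm
    (norm_mul_exp_arg_mul_I b).symm h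

/-- On an open half plane the argument has a single-valued branch, so `ang` is a difference of its
values there. Every additivity of angles below is obtained by putting all vectors involved into one
half plane. -/
theorem ang_eq_of_re_pos {a b ω : ℂ} (ha : 0 < (a * ω).re) (hb : 0 < (b * ω).re) :
    ang a b = arg (b * ω) - arg (a * ω) := by
  have hω : ω ≠ 0 := by rintro rfl; simp at ha
  have h1 := abs_lt.1 (abs_arg_lt_pi_div_two_iff.2 (Or.inl ha))
  have h2 := abs_lt.1 (abs_arg_lt_pi_div_two_iff.2 (Or.inl hb))
  have : ang a b = ang (a * ω) (b * ω) := by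
    unfold ang
    rw [mul_div_mul_right _ _ hω]
  rw [this]
  refine ang_eq_arg_sub_arg ?_ ?_ ⟨by linarith, by linarith⟩ <;> rintro h <;> simp [h] at ha hb

theorem ang_neg_neg (a b : ℂ) : ang (-a) (-b) = ang a b := by simp [ang]

theorem clm_eq_re_mul (f : ℂ →L[ℝ] ℝ) (z : ℂ) : f z = (z * (f 1 - f I * I)).re := by
  have : z = z.re • (1 : ℂ) + z.im • I := by simp [re_add_im]
  conv_lhs => rw [this, map_add, map_smul, map_smul]
  simp

/-- Hahn–Banach separation: all secants between two disjoint edges lie in one open half plane. -/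
theorem exists_re_pos_of_disjoint_segment {a b c d : ℂ}
    (h : Disjoint (segment ℝ a b) (segment ℝ c d)) :
    ∃ ω : ℂ, ∀ x ∈ segment ℝ a b, ∀ y ∈ segment ℝ c d, 0 < ((y - x) * ω).re := by
  have hc : ∀ a b : ℂ, IsCompact (segment ℝ a b) := fun a b => by
    rw [segment_eq_image_lineMap]
    exact isCompact_Icc.image (by fun_prop)
  obtain ⟨f, u, v, h1, h2, h3⟩ := geometric_hahn_banach_compact_closed (convex_segment a b)
    (hc a b) (convex_segment c d) (hc c d).isClosed h
  refine ⟨f 1 - f I * I, fun x hx y hy => ?_⟩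
  rw [← clm_eq_re_mul, map_sub]
  linarith [h1 x hx, h3 y hy]

theorem exists_re_pos_of_zero_notMem_segment {a b : ℂ} (h : (0 : ℂ) ∉ segment ℝ a b) :
    ∃ ω : ℂ, 0 < (a * ω).re ∧ 0 < (b * ω).re := by
  obtain ⟨ω, hω⟩ := exists_re_pos_of_disjoint_segment (a := 0) (b := 0) (c := a) (d := b)
    (by simpa [segment_same] using h)
  exact ⟨ω, by simpa using hω 0 (by simp) a (left_mem_segment ℝ a b),
    by simpa using hω 0 (by simp) b (right_mem_segment ℝ a b)⟩

theorem ang_add_ang_add {a b : ℂ} (h : (0 : ℂ) ∉ segment ℝ a b) :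
    ang a (a + b) + ang (a + b) b = ang a b := by
  obtain ⟨ω, ha, hb⟩ := exists_re_pos_of_zero_notMem_segment h
  have hab : 0 < ((a + b) * ω).re := by rw [add_mul, add_re]; linarith
  rw [ang_eq_of_re_pos ha hab, ang_eq_of_re_pos hab hb, ang_eq_of_re_pos ha hb]
  ring

/-- The elementary homotopy of Hopf's argument: the two ways of moving both end points of a secant,
one after the other, along two disjoint edges turn its direction by the same amount. -/
theorem ang_plaquette {a b c d : ℂ} (h : Disjoint (segment ℝ a b) (segment ℝ c d)) :
    ang (c - a) (d - a) + ang (d - a) (d - b) = ang (c - a) (c - b) + ang (c - b) (d - b) := by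
  obtain ⟨ω, hω⟩ := exists_re_pos_of_disjoint_segment h
  have l := left_mem_segment ℝ a b
  have r := right_mem_segment ℝ a b
  have l' := left_mem_segment ℝ c d
  have r' := right_mem_segment ℝ c d
  rw [ang_eq_of_re_pos (hω a l c l') (hω a l d r'), ang_eq_of_re_pos (hω a l d r') (hω b r d r'),
    ang_eq_of_re_pos (hω a l c l') (hω b r c l'), ang_eq_of_re_pos (hω b r c l') (hω b r d r')]
  ring

/-- A closed simple polygonal curve in the complex plane, given by the `n`-periodic sequence of its
vertices. -/
structure IsSimpleLoop (v : ℕ → ℂ) (n : ℕ) : Prop where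
  three_le : 3 ≤ n
  periodic : ∀ j, v (j + n) = v j
  ne_succ : ∀ i, v i ≠ v (i + 1)
  adjacent : ∀ i, segment ℝ (v i) (v (i + 1)) ∩ segment ℝ (v (i + 1)) (v (i + 2)) ⊆ {v (i + 1)}
  disjoint : ∀ i j, i + 1 < j → j + 1 < i + n →
    Disjoint (segment ℝ (v i) (v (i + 1))) (segment ℝ (v j) (v (j + 1)))

namespace IsSimpleLoop

variable {v : ℕ → ℂ} {n : ℕ}

theorem shift (h : IsSimpleLoop v n) (m : ℕ) : IsSimpleLoop (fun j => v (j + m)) n where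
  three_le := h.three_le
  periodic j := by rw [add_right_comm, h.periodic]
  ne_succ i := by simpa only [add_right_comm] using h.ne_succ (i + m)
  adjacent i := by simpa only [add_right_comm] using h.adjacent (i + m)
  disjoint i j h1 h2 := by
    simpa only [add_right_comm] using h.disjoint (i + m) (j + m) (by omega) (by omega)

theorem ne (h : IsSimpleLoop v n) {i j : ℕ} (h1 : i < j) (h2 : j < i + n) : v i ≠ v j := by
  rcases Nat.lt_or_ge (i + 1) j with h3 | h3
  · rcases Nat.lt_or_ge (j + 1) (i + n) with h4 | h4
    · intro he
      exact Set.disjoint_left.1 (h.disjoint i j h3 h4) (left_mem_segment ℝ _ _)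
        (he ▸ left_mem_segment ℝ _ _)
    · have : j + 1 = i + n := by omega
      rw [← h.periodic i, ← this]
      exact (h.ne_succ j).symm
  · have : j = i + 1 := by omega
    exact this ▸ h.ne_succ i

/-- Consecutive edges do not fold back: if a convex combination of the two edge vectors vanished,
the edges would share a point other than their common vertex, or one of them would be degenerate. -/
theorem zero_notMem_segment (h : IsSimpleLoop v n) (i : ℕ) :
    (0 : ℂ) ∉ segment ℝ (v (i + 1) - v i) (v (i + 2) - v (i + 1)) := by
  rintro ⟨s, t, hs, ht, hst, h0⟩
  have h1 : v (i + 1) + t • (v (i + 2) - v (i + 1)) ∈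
      segment ℝ (v i) (v (i + 1)) ∩ segment ℝ (v (i + 1)) (v (i + 2)) := by
    constructor
    · refine ⟨s, t, hs, ht, hst, ?_⟩
      have : t = 1 - s := by linarith
      subst this
      simp only [real_smul] at h0 ⊢
      push_cast at h0 ⊢
      linear_combination -h0
    · exact ⟨s, t, hs, ht, hst, by
        have : s = 1 - t := by linarith
        subst this
        simp only [real_smul]; push_cast; ring⟩
  have h2 : t • (v (i + 2) - v (i + 1)) = 0 := by simpa using h.adjacent i h1
  rw [h2, add_zero] at h0
  have h3 := h.ne_succ i
  have h4 := h.ne_succ (i + 1)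
  rcases smul_eq_zero.1 h2 with h5 | h5
  · have : s = 1 := by linarith
    rw [this, one_smul, sub_eq_zero] at h0
    exact h3 h0.symm
  · exact h4 (sub_eq_zero.1 h5).symm

/-- The turning angle at the vertex `v (i + 1)`. -/
noncomputable def turn (v : ℕ → ℂ) (i : ℕ) : ℝ := ang (v (i + 1) - v i) (v (i + 2) - v (i + 1))

/-- The total turning of the direction from `v i` to `v k`, for `k` from `i + 1` to `j`. -/
noncomputable def rowSum (v : ℕ → ℂ) (i j : ℕ) : ℝ :=
  ∑ k ∈ Ico (i + 1) j, ang (v k - v i) (v (k + 1) - v i)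

/-- In the triangle of secants `v k - v i`, this compares row `i` with row `i + 1`. The strip
between them consists of a triangle on the diagonal, where the secant `v (i + 2) - v i` is the sum
of two edges, followed by plaquettes. -/
theorem rowSum_add (h : IsSimpleLoop v n) (i : ℕ) {j : ℕ} (hj : i + 2 ≤ j) (hj' : j + 1 ≤ i + n) :
    rowSum v i j + ang (v j - v i) (v j - v (i + 1)) = turn v i + rowSum v (i + 1) j := by
  induction j, hj using Nat.le_induction with
  | base =>
    have := ang_add_ang_add (h.zero_notMem_segment i)
    simp only [rowSum, turn]
    rw [show i + 1 + 1 = i + 2 from rfl, Ico_self, sum_empty, add_zero, ← this,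
      Nat.Ico_succ_singleton, sum_singleton]
    congr 2 <;> ring
  | succ j hj ih =>
    have hr : ∀ i', i' + 1 ≤ j → rowSum v i' (j + 1) =
        rowSum v i' j + ang (v j - v i') (v (j + 1) - v i') := fun i' hi' => by
      rw [rowSum, sum_Ico_succ_top (by omega), rowSum]
    have h1 := ang_plaquette (h.disjoint i j (by omega) (by omega))
    rw [hr i (by omega), hr (i + 1) (by omega)]
    linarith [ih (by omega)]

/-- Stacking the strips deforms the diagonal of the triangle, which carries the turning angles, into
its bottom row followed by its last column. The corner `(0, n)`, where the secant `v n - v 0`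
vanishes, has to be cut off, so row `0` stops at `n - 1`. -/
theorem sum_turn_eq (h : IsSimpleLoop v n) :
    ∑ i ∈ range (n - 1), turn v i = rowSum v 0 (n - 1) + ang (v (n - 1) - v 0) (v 0 - v 1) +
      ∑ i ∈ Ico 1 (n - 1), ang (v 0 - v i) (v 0 - v (i + 1)) := by
  have hn := h.three_le
  have hv : v n = v 0 := by simpa using h.periodic 0
  have h1 : ∀ m, 1 ≤ m → m ≤ n - 1 → ∑ i ∈ Ico 1 m, turn v i + rowSum v m n =
      rowSum v 1 n + ∑ i ∈ Ico 1 m, ang (v 0 - v i) (v 0 - v (i + 1)) := by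
    intro m hm
    induction m, hm using Nat.le_induction with
    | base => simp
    | succ m hm ih =>
      intro hm'
      rw [sum_Ico_succ_top hm, sum_Ico_succ_top hm]
      have := h.rowSum_add m (j := n) (by omega) (by omega)
      rw [hv] at this
      linarith [ih (by omega)]
  have h2 := h1 (n - 1) (by omega) le_rfl
  have h3 : rowSum v (n - 1) n = 0 := by
    rw [rowSum, Nat.sub_add_cancel (by omega), Ico_self, sum_empty]
  have h4 := h.rowSum_add 0 (j := n - 1) (by omega) (by omega)
  have h5 : rowSum v 1 n = rowSum v 1 (n - 1) + ang (v (n - 1) - v 1) (v 0 - v 1) := by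
    obtain ⟨m, rfl⟩ : ∃ m, n = m + 1 := ⟨n - 1, by omega⟩
    rw [rowSum, sum_Ico_succ_top (by omega), rowSum, hv]
    rfl
  -- The cut-off corner: `v (n - 1) - v 1` is the sum of `v (n - 1) - v 0` and `v 0 - v 1`, and the
  -- last and first edge do not fold back.
  have h6 : ang (v (n - 1) - v 0) (v (n - 1) - v 1) + ang (v (n - 1) - v 1) (v 0 - v 1) =
      ang (v (n - 1) - v 0) (v 0 - v 1) := by
    have h7 := h.zero_notMem_segment (n - 1)
    have e1 : n - 1 + 1 = n := by omega
    have e2 : n - 1 + 2 = 1 + n := by omega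
    rw [e1, e2, hv, h.periodic, ] at h7
    have h8 : (0 : ℂ) ∉ segment ℝ (v (n - 1) - v 0) (v 0 - v 1) := by
      rintro ⟨s, t, hs, ht, hst, h0⟩
      refine h7 ⟨s, t, hs, ht, hst, ?_⟩
      simp only [real_smul] at h0 ⊢
      linear_combination -h0
    rw [← ang_add_ang_add h8]
    congr 2 <;> ring
  rw [← Nat.Ico_zero_eq_range, sum_eq_sum_Ico_succ_bot (by omega)]
  simp only [zero_add] at h4 ⊢
  linarith

/-- The vertex `v 0` is lowest, and leftmost among the lowest vertices. -/
def LowestAtZero (v : ℕ → ℂ) (n : ℕ) : Prop :=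
  ∀ j, 0 < j → j < n → arg (v j - v 0) ∈ Set.Ico 0 π

/-- Seen from the lowest vertex all other vertices have arguments in `[0, π)`. Hence no branch is
crossed along the row or the column, both sums telescope, and only the turn at `v 0` has to be
normalised. -/
theorem sum_turn (h : IsSimpleLoop v n) (hl : LowestAtZero v n) :
    (arg (v 1 - v 0) < arg (v (n - 1) - v 0) ∧ ∑ i ∈ range n, turn v i = 2 * π ∧
      turn v (n - 1) = arg (v 1 - v 0) + π - arg (v (n - 1) - v 0)) ∨
    (arg (v (n - 1) - v 0) < arg (v 1 - v 0) ∧ ∑ i ∈ range n, turn v i = -(2 * π) ∧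
      turn v (n - 1) = arg (v 1 - v 0) - π - arg (v (n - 1) - v 0)) := by
  have hn := h.three_le
  have hv : v n = v 0 := by simpa using h.periodic 0
  have hz : ∀ j, 0 < j → j < n → v j - v 0 ≠ 0 := fun j h1 h2 =>
    sub_ne_zero.2 (h.ne (i := 0) h1 (by omega)).symm
  have hang : ∀ j, 1 ≤ j → j < n - 1 → ang (v j - v 0) (v (j + 1) - v 0) =
      arg (v (j + 1) - v 0) - arg (v j - v 0) := fun j h1 h2 => by
    have k1 := hl j (by omega) (by omega)
    have k2 := hl (j + 1) (by omega) (by omega)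
    exact ang_eq_arg_sub_arg (hz _ (by omega) (by omega)) (hz _ (by omega) (by omega))
      ⟨by linarith [k1.2, k2.1], by linarith [k1.1, k2.2]⟩
  have htel : ∑ k ∈ Ico 1 (n - 1), (arg (v (k + 1) - v 0) - arg (v k - v 0)) =
      arg (v (n - 1) - v 0) - arg (v 1 - v 0) :=
    sum_Ico_sub (fun k => arg (v k - v 0)) (by omega)
  have h1 : rowSum v 0 (n - 1) = arg (v (n - 1) - v 0) - arg (v 1 - v 0) := by
    rw [← htel, rowSum]
    exact sum_congr rfl fun k hk => hang k (mem_Ico.1 hk).1 (mem_Ico.1 hk).2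
  have h2 : ∑ i ∈ Ico 1 (n - 1), ang (v 0 - v i) (v 0 - v (i + 1)) =
      arg (v (n - 1) - v 0) - arg (v 1 - v 0) := by
    rw [← htel]
    refine sum_congr rfl fun k hk => ?_
    rw [← hang k (mem_Ico.1 hk).1 (mem_Ico.1 hk).2, ← ang_neg_neg, neg_sub, neg_sub]
  have h3 := h.sum_turn_eq
  rw [h1, h2] at h3
  have e1 : n - 1 + 1 = n := by omega
  have e2 : n - 1 + 2 = 1 + n := by omega
  have h4 : turn v (n - 1) = ang (v (n - 1) - v 0) (v 0 - v 1) := by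
    rw [turn, e1, e2, hv, h.periodic, ← ang_neg_neg, neg_sub, neg_sub]
  have h5 : ∑ i ∈ range n, turn v i = 2 * (arg (v (n - 1) - v 0) - arg (v 1 - v 0)) +
      2 * ang (v (n - 1) - v 0) (v 0 - v 1) := by
    have : ∑ i ∈ range n, turn v i = ∑ i ∈ range (n - 1), turn v i + turn v (n - 1) := by
      conv_lhs => rw [← e1, sum_range_succ]
    rw [this, h3, h4]
    ring
  have k1 := hl 1 (by omega) (by omega)
  have k2 := hl (n - 1) (by omega) (by omega)
  have p1 : v 1 - v 0 = ‖v 1 - v 0‖ * exp (arg (v 1 - v 0) * I) :=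
    (norm_mul_exp_arg_mul_I _).symm
  have p2 := (norm_mul_exp_arg_mul_I (v (n - 1) - v 0)).symm
  have n1 : 0 < ‖v 1 - v 0‖ := norm_pos_iff.2 (hz 1 (by omega) (by omega))
  have n2 : 0 < ‖v (n - 1) - v 0‖ := norm_pos_iff.2 (hz (n - 1) (by omega) (by omega))
  rw [h5, h4]
  set A := arg (v (n - 1) - v 0)
  set B := arg (v 1 - v 0)
  -- The remaining angle runs from direction `A` to the direction `B + π`, taken modulo `2π` in
  -- `(-π, π]`; the order of `A` and `B` selects `B - π - A` or `B + π - A`. Equality would make the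
  -- last edge fold back onto the first.
  rcases lt_trichotomy A B with hAB | hAB | hAB
  · right
    refine ⟨hAB, ?_⟩
    have := ang_eq_sub (β := B - π) n2 n1 p2 (b := v 0 - v 1) (by
      push_cast
      rw [sub_mul, Complex.exp_sub, exp_pi_mul_I, ← neg_sub, p1]
      simp [div_neg]) ⟨by linarith, by linarith [k1.2, k2.1]⟩
    rw [this]; exact ⟨by ring, rfl⟩
  · exfalso
    have h7 := h.zero_notMem_segment (n - 1)
    rw [e1, e2, hv, h.periodic] at h7
    obtain ⟨ω, hω1, hω2⟩ := exists_re_pos_of_zero_notMem_segment h7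
    have : (v 0 - v (n - 1)) * ω = ((- (‖v (n - 1) - v 0‖ / ‖v 1 - v 0‖) : ℝ) : ℂ) *
        ((v 1 - v 0) * ω) := by
      have n1' : (‖v 1 - v 0‖ : ℂ) ≠ 0 := by exact_mod_cast n1.ne'
      have : v 0 - v (n - 1) = -(‖v (n - 1) - v 0‖ * exp (A * I)) := by rw [← p2]; ring
      rw [this]
      conv_rhs => rw [p1]
      rw [hAB]
      push_cast
      field_simp
      simp [mul_div_cancel_right₀ _ n1']
    rw [this, re_ofReal_mul] at hω1
    have : 0 < ‖v (n - 1) - v 0‖ / ‖v 1 - v 0‖ := by positivity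
    nlinarith
  · left
    refine ⟨hAB, ?_⟩
    have := ang_eq_sub (β := B + π) n2 n1 p2 (b := v 0 - v 1) (by
      push_cast
      rw [add_mul, Complex.exp_add, exp_pi_mul_I, ← neg_sub, p1]
      simp) ⟨by linarith [k1.1, k2.2], by linarith⟩
    rw [this]; exact ⟨by ring, rfl⟩

end IsSimpleLoop

end PolygonalBilliard

/-! ### Enclosed points, and the complement of the curve near vertices and edges. -/

namespace PolygonalBilliard

open Complex Finset

/-- The points enclosed by a set `K`: every connected set that contains such a point and avoids `K`
is bounded. -/
def enclosed {E : Type*} [TopologicalSpace E] [Bornology E] (K : Set E) : Set E :=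
  {x | x ∉ K ∧ ∀ S ⊆ Kᶜ, IsPreconnected S → x ∈ S → Bornology.IsBounded S}

theorem subset_enclosed {E : Type*} [TopologicalSpace E] [Bornology E] {K S : Set E}
    (hS : S ⊆ Kᶜ) (hc : IsPreconnected S) {x : E} (hx : x ∈ S) (h : x ∈ enclosed K) :
    S ⊆ enclosed K := by
  intro y hy
  refine ⟨hS hy, fun S' hS' hc' hy' => ?_⟩
  exact (h.2 (S ∪ S') (Set.union_subset hS hS') (hc.union y hy hy' hc') (Or.inl hx)).subset
    Set.subset_union_right

theorem mem_enclosed_iff_of_segment_subset {E : Type*} [NormedAddCommGroup E] [NormedSpace ℝ E]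
    {K : Set E} {x y : E} (h : segment ℝ x y ⊆ Kᶜ) : x ∈ enclosed K ↔ y ∈ enclosed K :=
  ⟨fun hx => subset_enclosed h (convex_segment x y).isPreconnected (left_mem_segment ℝ x y) hx
      (right_mem_segment ℝ x y),
    fun hy => subset_enclosed h (convex_segment x y).isPreconnected (right_mem_segment ℝ x y) hy
      (left_mem_segment ℝ x y)⟩

theorem isCompact_segment {E : Type*} [NormedAddCommGroup E] [NormedSpace ℝ E] (x y : E) :
    IsCompact (segment ℝ x y) := by
  rw [segment_eq_image_lineMap]
  exact isCompact_Icc.image (by fun_prop)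

theorem isPreconnected_image_circleMap (c : ℂ) (I : Set ℝ) (hI : Convex ℝ I) (J : Set ℝ)
    (hJ : Convex ℝ J) : IsPreconnected ((fun p : ℝ × ℝ => circleMap c p.1 p.2) '' I ×ˢ J) := by
  refine ((hI.prod hJ).isPreconnected).image _ (Continuous.continuousOn ?_)
  unfold circleMap
  fun_prop

theorem exp_arg_mul_I {z : ℂ} (hz : z ≠ 0) : exp (arg z * I) = z / ‖z‖ := by
  have : (‖z‖ : ℂ) ≠ 0 := by exact_mod_cast norm_ne_zero_iff.2 hz
  rw [eq_div_iff this, mul_comm, norm_mul_exp_arg_mul_I]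

theorem circleMap_eq_circleMap {c : ℂ} {r s α β : ℝ} (hr : 0 < r) (hs : 0 ≤ s)
    (h : circleMap c r α = circleMap c s β) : ∃ n : ℤ, α = β + n * (2 * π) := by
  have h' : (r : ℂ) * exp (α * I) = s * exp (β * I) := by simpa [circleMap] using h
  have hn : r = s := by
    have := congrArg norm h'
    simpa [norm_exp_ofReal_mul_I, abs_of_pos hr, abs_of_nonneg hs] using this
  subst hn
  obtain ⟨n, hn⟩ := exp_eq_exp_iff_exists_int.1
    (mul_left_cancel₀ (by exact_mod_cast hr.ne' : (r : ℂ) ≠ 0) h')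
  refine ⟨n, ?_⟩
  have : ((α : ℂ)) * I = (β + n * (2 * π) : ℝ) * I := by rw [hn]; push_cast; ring
  exact_mod_cast mul_right_cancel₀ I_ne_zero this

/-- The union of the edges. -/
def loopSet (v : ℕ → ℂ) : Set ℂ := ⋃ i, segment ℝ (v i) (v (i + 1))

/-- The direction angle of the edge that starts at `v i`. -/
noncomputable def edgeArg (v : ℕ → ℂ) (i : ℕ) : ℝ := arg (v (i + 1) - v i)

theorem circleMap_edgeArg (v : ℕ → ℂ) (i : ℕ) (t : ℝ) :
    circleMap (v i) (t * ‖v (i + 1) - v i‖) (edgeArg v i) = v i + t * (v (i + 1) - v i) := by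
  conv_rhs => rw [← norm_mul_exp_arg_mul_I (v (i + 1) - v i)]
  simp [circleMap, edgeArg, mul_assoc]

namespace IsSimpleLoop

variable {v : ℕ → ℂ} {n : ℕ}

theorem arg_turn (i : ℕ) : turn v i ∈ Set.Ioc (-π) π := arg_mem_Ioc _

/-- A turn by `π` would be a fold-back. Excluding it keeps the angle on the left side positive. -/
theorem turn_lt_pi (h : IsSimpleLoop v n) (i : ℕ) : turn v i < π := by
  obtain ⟨ω, h1, h2⟩ := exists_re_pos_of_zero_notMem_segment (h.zero_notMem_segment i)
  have k1 := abs_lt.1 (abs_arg_lt_pi_div_two_iff.2 (Or.inl h1))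
  have k2 := abs_lt.1 (abs_arg_lt_pi_div_two_iff.2 (Or.inl h2))
  rw [turn, ang_eq_of_re_pos h1 h2]
  linarith

/-- The angle on the left side of the curve at the vertex `v (i + 1)`. -/
noncomputable def leftAngle (v : ℕ → ℂ) (i : ℕ) : ℝ := π - turn v i

theorem leftAngle_mem (h : IsSimpleLoop v n) (i : ℕ) : leftAngle v i ∈ Set.Ioo 0 (2 * π) := by
  have := h.turn_lt_pi i
  have := (arg_turn (v := v) i).1
  constructor <;> unfold leftAngle <;> linarith

/-- The left sector starts at the outgoing edge; this identifies its other bounding ray as the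
incoming edge traversed backwards. -/
theorem exp_leftAngle (h : IsSimpleLoop v n) (i : ℕ) :
    exp ((edgeArg v (i + 1) + leftAngle v i : ℝ) * I) = -exp (edgeArg v i * I) := by
  have h1 : v (i + 1) - v i ≠ 0 := sub_ne_zero.2 (h.ne_succ i).symm
  have h2 : v (i + 2) - v (i + 1) ≠ 0 := sub_ne_zero.2 (h.ne_succ (i + 1)).symm
  have h3 : exp (edgeArg v (i + 1) * I) = exp (turn v i * I) * exp (edgeArg v i * I) := by
    have k4 : (‖v (i + 1) - v i‖ : ℂ) ≠ 0 := by exact_mod_cast norm_ne_zero_iff.2 h1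
    have k5 : (‖v (i + 2) - v (i + 1)‖ : ℂ) ≠ 0 := by exact_mod_cast norm_ne_zero_iff.2 h2
    unfold edgeArg turn ang
    rw [exp_arg_mul_I h1, exp_arg_mul_I h2, exp_arg_mul_I (div_ne_zero h2 h1), norm_div]
    push_cast
    field_simp
  rw [leftAngle]
  push_cast
  rw [add_mul, Complex.exp_add, h3, sub_mul, Complex.exp_sub, exp_pi_mul_I]
  have := Complex.exp_ne_zero (turn v i * I)
  field_simp

theorem circleMap_leftAngle_sub (h : IsSimpleLoop v n) (i : ℕ) (c : ℂ) (r φ : ℝ) :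
    circleMap c r (edgeArg v (i + 1) + leftAngle v i - φ) =
      c - r * exp ((edgeArg v i - φ : ℝ) * I) := by
  have := h.exp_leftAngle i
  rw [circleMap]
  push_cast at this ⊢
  rw [sub_mul, Complex.exp_sub, this, sub_mul, Complex.exp_sub]
  ring

theorem loopSet_eq (h : IsSimpleLoop v n) (i : ℕ) :
    loopSet v = segment ℝ (v i) (v (i + 1)) ∪
      ⋃ j ∈ Ico (i + 1) (i + n), segment ℝ (v j) (v (j + 1)) := by
  have hn := h.three_le
  have hp : ∀ j m : ℕ, v (j + m * n) = v j := fun j m => by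
    induction m with
    | zero => simp
    | succ m ih => rw [Nat.succ_mul, ← add_assoc, h.periodic, ih]
  apply Set.Subset.antisymm
  · refine Set.iUnion_subset fun j => ?_
    obtain ⟨k, hk1, hk2, hk3⟩ : ∃ k, i ≤ k ∧ k < i + n ∧ ∃ a b, j + a * n = k + b * n := by
      refine ⟨i + (j + i * n - i) % n, by omega, ?_, i, (j + i * n - i) / n, ?_⟩
      · have := Nat.mod_lt (j + i * n - i) (by omega : 0 < n)
        omega
      · have := Nat.mod_add_div (j + i * n - i) n
        have : i ≤ i * n := Nat.le_mul_of_pos_right _ (by omega)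
        rw [Nat.mul_comm n] at *
        omega
    obtain ⟨a, b, hab⟩ := hk3
    have e1 : v j = v k := by rw [← hp j a, hab, hp]
    have e2 : v (j + 1) = v (k + 1) := by
      rw [← hp (j + 1) a, ← hp (k + 1) b, add_right_comm, hab, add_right_comm]
    rw [e1, e2]
    rcases hk1.eq_or_lt with rfl | hk
    · exact Set.subset_union_left
    · exact Set.subset_union_of_subset_right
        (Set.subset_biUnion_of_mem (u := fun j => segment ℝ (v j) (v (j + 1)))
          (by simpa using ⟨hk, hk2⟩)) _
  · refine Set.union_subset (Set.subset_iUnion (fun j => segment ℝ (v j) (v (j + 1))) i) ?_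
    exact Set.iUnion₂_subset fun j _ => Set.subset_iUnion (fun j => segment ℝ (v j) (v (j + 1))) j

theorem isClosed_biUnion_segment (s : Finset ℕ) :
    IsClosed (⋃ j ∈ s, segment ℝ (v j) (v (j + 1))) :=
  s.finite_toSet.isClosed_biUnion fun _ _ => (isCompact_segment _ _).isClosed

/-- An edge meets the others only in its end points. -/
theorem eq_or_eq_of_mem (h : IsSimpleLoop v n) {i : ℕ} {z : ℂ}
    (hz : z ∈ segment ℝ (v i) (v (i + 1)))
    (hz' : z ∈ ⋃ j ∈ Ico (i + 1) (i + n), segment ℝ (v j) (v (j + 1))) :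
    z = v i ∨ z = v (i + 1) := by
  have hn := h.three_le
  simp only [Set.mem_iUnion, mem_Ico] at hz'
  obtain ⟨j, ⟨h1, h2⟩, hj⟩ := hz'
  rcases h1.eq_or_lt with rfl | h1
  · exact Or.inr (h.adjacent i ⟨hz, hj⟩)
  rcases Nat.lt_or_ge (j + 1) (i + n) with h3 | h3
  · exact absurd hj (Set.disjoint_left.1 (h.disjoint i j h1 h3) hz)
  · left
    have e : j + 1 = i + n := by omega
    have e2 : j + 2 = i + 1 + n := by omega
    have := h.adjacent j ⟨hj, by rwa [e, e2, h.periodic, h.periodic]⟩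
    rwa [e, h.periodic] at this

/-- All edges not ending at the vertex have positive distance from it. The two others lie on the two
rays that bound the sectors, and their points have an angle that differs from `φ` by no multiple of
`2π`. -/
theorem exists_sector_notMem (h : IsSimpleLoop v n) (i : ℕ) : ∃ ρ > 0, ∀ r, 0 < r → r < ρ →
    ∀ φ, φ ∈ Set.Ioo (edgeArg v (i + 1)) (edgeArg v (i + 1) + leftAngle v i) ∪
      Set.Ioo (edgeArg v (i + 1) + leftAngle v i) (edgeArg v (i + 1) + 2 * π) →
    circleMap (v (i + 1)) r φ ∉ loopSet v := by
  have hn := h.three_le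
  have hcl := isClosed_biUnion_segment (v := v) (Ico (i + 2) (i + n))
  have hnot : v (i + 1) ∈ (⋃ j ∈ Ico (i + 2) (i + n), segment ℝ (v j) (v (j + 1)))ᶜ := by
    intro hm
    simp only [Set.mem_iUnion, mem_Ico] at hm
    obtain ⟨j, ⟨h1, h2⟩, hj⟩ := hm
    rcases h1.eq_or_lt with rfl | h1
    · exact h.ne_succ (i + 1) (h.adjacent (i + 1) ⟨left_mem_segment ℝ _ _, hj⟩)
    · exact Set.disjoint_left.1 (h.disjoint (i + 1) j h1 (by omega)) (left_mem_segment ℝ _ _) hj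
  obtain ⟨ρ, hρ, hball⟩ := Metric.isOpen_iff.1 hcl.isOpen_compl _ hnot
  refine ⟨ρ, hρ, fun r hr hrρ φ hφ hmem => ?_⟩
  have hβ := h.leftAngle_mem i
  have hd : circleMap (v (i + 1)) r φ ∈ Metric.ball (v (i + 1)) ρ := by
    simpa [dist_eq_norm, circleMap, abs_of_pos hr] using hrρ
  have hmem' : circleMap (v (i + 1)) r φ ∈ segment ℝ (v i) (v (i + 1)) ∪
      segment ℝ (v (i + 1)) (v (i + 1 + 1)) := by
    rw [h.loopSet_eq i] at hmem
    rcases hmem with hm | hm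
    · exact Or.inl hm
    · simp only [Set.mem_iUnion, mem_Ico] at hm
      obtain ⟨j, ⟨h1, h2⟩, hj⟩ := hm
      rcases h1.eq_or_lt with rfl | h1
      · exact Or.inr hj
      · refine absurd ?_ (hball hd)
        simp only [Set.mem_iUnion, mem_Ico]
        exact ⟨j, ⟨h1, h2⟩, hj⟩
  rcases hmem' with hm | hm
  · rw [segment_symm, segment_eq_image'] at hm
    obtain ⟨t, ht, hte⟩ := hm
    have e : circleMap (v (i + 1)) r φ = circleMap (v (i + 1)) (t * ‖v (i + 1) - v i‖)
        (edgeArg v (i + 1) + leftAngle v i) := by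
      have k := h.circleMap_leftAngle_sub i (v (i + 1)) (t * ‖v (i + 1) - v i‖) 0
      rw [sub_zero, sub_zero] at k
      rw [k, ← hte]
      have := norm_mul_exp_arg_mul_I (v (i + 1) - v i)
      simp only [real_smul, edgeArg]
      push_cast
      linear_combination t * this
    obtain ⟨m, hm⟩ := circleMap_eq_circleMap hr (mul_nonneg ht.1 (norm_nonneg _)) e
    have hm1 : m < 1 := by
      have : (m : ℝ) * (2 * π) < 1 * (2 * π) := by rcases hφ with k | k <;> linarith [k.1, k.2, hβ.1, hβ.2]
      exact_mod_cast lt_of_mul_lt_mul_right this (by positivity)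
    have hm2 : -1 < m := by
      have : (-1 : ℝ) * (2 * π) < m * (2 * π) := by rcases hφ with k | k <;> linarith [k.1, k.2, hβ.1, hβ.2]
      exact_mod_cast lt_of_mul_lt_mul_right this (by positivity)
    obtain rfl : m = 0 := by omega
    rcases hφ with k | k <;> simp [hm] at k
  · rw [segment_eq_image'] at hm
    obtain ⟨t, ht, hte⟩ := hm
    have e : circleMap (v (i + 1)) r φ = circleMap (v (i + 1)) (t * ‖v (i + 1 + 1) - v (i + 1)‖)
        (edgeArg v (i + 1)) := by
      rw [circleMap_edgeArg, ← hte]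
      simp
    obtain ⟨m, hm⟩ := circleMap_eq_circleMap hr (mul_nonneg ht.1 (norm_nonneg _)) e
    have hm1 : m < 1 := by
      have : (m : ℝ) * (2 * π) < 1 * (2 * π) := by rcases hφ with k | k <;> linarith [k.1, k.2, hβ.1, hβ.2]
      exact_mod_cast lt_of_mul_lt_mul_right this (by positivity)
    have hm2 : 0 < m := by
      have : (0 : ℝ) * (2 * π) < m * (2 * π) := by rcases hφ with k | k <;> linarith [k.1, k.2, hβ.1, hβ.2]
      exact_mod_cast lt_of_mul_lt_mul_right this (by positivity)
    omega

/-- The rotated coordinate `(z - v i) / e ^ (i a)` is real on the edge that starts at `v i`. -/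
theorem im_eq_zero_of_mem_edge {i : ℕ} {z : ℂ} (hz : z ∈ segment ℝ (v i) (v (i + 1))) :
    ((z - v i) * exp (-(edgeArg v i * I))).im = 0 := by
  rw [segment_eq_image'] at hz
  obtain ⟨t, ht, rfl⟩ := hz
  have h1 := circleMap_edgeArg v i t
  have : (v i + t • (v (i + 1) - v i) - v i) * exp (-(edgeArg v i * I)) =
      ((t * ‖v (i + 1) - v i‖ : ℝ) : ℂ) := by
    rw [real_smul, ← h1, circleMap, add_sub_cancel_left, mul_assoc, ← Complex.exp_add]
    simp
  rw [this, ofReal_im]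

theorem notMem_other_edges (h : IsSimpleLoop v n) (i : ℕ) {s : ℝ} (hs : 0 < s)
    (hs' : s < ‖v (i + 1) - v i‖) : v i + s * exp (edgeArg v i * I) ∉
      ⋃ j ∈ Ico (i + 1) (i + n), segment ℝ (v j) (v (j + 1)) := by
  set a := edgeArg v i with ha
  set ℓ := ‖v (i + 1) - v i‖ with hℓ
  have hv : v (i + 1) = v i + ℓ * exp (a * I) := by
    have := circleMap_edgeArg v i 1
    simp only [circleMap, one_mul, ofReal_one] at this
    linear_combination -this
  intro hm
  have h1 : v i + s * exp (a * I) ∈ segment ℝ (v i) (v (i + 1)) := by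
    rw [segment_eq_image']
    refine ⟨s / ℓ, ⟨by positivity, (div_le_one (by linarith)).2 hs'.le⟩, ?_⟩
    have : (ℓ : ℂ) ≠ 0 := by exact_mod_cast (by linarith : ℓ ≠ 0)
    simp only [hv, real_smul]
    push_cast
    field_simp
    ring
  have h2 : exp (a * I) ≠ 0 := Complex.exp_ne_zero _
  rcases h.eq_or_eq_of_mem h1 hm with h3 | h3
  · have : (s : ℂ) * exp (a * I) = 0 := by linear_combination h3
    exact hs.ne' (by exact_mod_cast (mul_eq_zero.1 this).resolve_right h2)
  · have : ((s - ℓ : ℝ) : ℂ) * exp (a * I) = 0 := by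
      push_cast; linear_combination h3 + hv
    have : s - ℓ = 0 := by exact_mod_cast (mul_eq_zero.1 this).resolve_right h2
    linarith

/-- A slightly rotated copy of a part of an edge avoids the curve. -/
theorem exists_segment_subset_compl (h : IsSimpleLoop v n) (i : ℕ) {r : ℝ} (hr : 0 < r)
    (hr' : r < ‖v (i + 1) - v i‖) : ∃ η > 0, ∀ φ : ℝ, φ ≠ 0 → |φ| < η →
    segment ℝ (circleMap (v i) r (edgeArg v i + φ))
      (v (i + 1) - r * exp ((edgeArg v i - φ : ℝ) * I)) ⊆ (loopSet v)ᶜ := by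
  have hn := h.three_le
  set a := edgeArg v i with ha
  set ℓ := ‖v (i + 1) - v i‖ with hℓ
  have hv : v (i + 1) = v i + ℓ * exp (a * I) := by
    have := circleMap_edgeArg v i 1
    simp only [circleMap, one_mul, ofReal_one] at this
    linear_combination -this
  have hmem : ∀ s : ℝ, 0 < s → s < ℓ → v i + s * exp (a * I) ∈
      (⋃ j ∈ Ico (i + 1) (i + n), segment ℝ (v j) (v (j + 1)))ᶜ :=
    fun s hs hs' => h.notMem_other_edges i hs hs'
  have hsub : segment ℝ (v i + r * exp (a * I)) (v (i + 1) - r * exp (a * I)) ⊆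
      (⋃ j ∈ Ico (i + 1) (i + n), segment ℝ (v j) (v (j + 1)))ᶜ := by
    rintro _ ⟨s, t, hs, ht, hst, rfl⟩
    have e : s • (v i + r * exp (a * I)) + t • (v (i + 1) - r * exp (a * I)) =
        v i + ((s * r + t * (ℓ - r) : ℝ) : ℂ) * exp (a * I) := by
      obtain rfl : s = 1 - t := by linarith
      rw [hv]
      simp only [real_smul]
      push_cast
      ring
    rw [e]
    refine hmem _ ?_ ?_
    · rcases hs.eq_or_lt with rfl | hs
      · obtain rfl : t = 1 := by linarith
        linarith
      · have := mul_pos hs hr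
        nlinarith
    · rcases hs.eq_or_lt with rfl | hs
      · obtain rfl : t = 1 := by linarith
        linarith
      · have := mul_lt_mul_of_pos_left hr' hs
        nlinarith [mul_nonneg ht hr.le]
  -- By compactness the trimmed edge has a whole neighbourhood free of the other edges. Rotating by
  -- `φ` moves points by at most `r |φ|`, whence the bound `δ / r`; the bound `π` makes `sin φ`
  -- nonzero.
  obtain ⟨δ, hδ, hth⟩ := (isCompact_segment _ _).exists_thickening_subset_open
    (isClosed_biUnion_segment (v := v) (Ico (i + 1) (i + n))).isOpen_compl hsub
  refine ⟨min (δ / r) π, by positivity, fun φ hφ0 hφ => ?_⟩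
  rintro _ ⟨s, t, hs, ht, hst, rfl⟩
  have hexp : ∀ x : ℝ, exp ((a + x : ℝ) * I) = exp (a * I) * exp (x * I) := fun x => by
    push_cast; rw [add_mul, Complex.exp_add]
  have hexp' : exp ((a - φ : ℝ) * I) = exp (a * I) * exp ((-φ : ℝ) * I) := by
    rw [← hexp, sub_eq_add_neg]
  have hnear : ∀ x : ℝ, |x| = |φ| → ‖exp (a * I) * exp (x * I) - exp (a * I)‖ ≤ |φ| := by
    intro x hx
    have e : exp (a * I) * exp (x * I) - exp (a * I) = exp (a * I) * (exp (I * x) - 1) := by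
      rw [mul_comm I]; ring
    rw [e, norm_mul, norm_exp_ofReal_mul_I, one_mul, ← hx]
    simpa using Real.norm_exp_I_mul_ofReal_sub_one_le (x := x)
  rw [h.loopSet_eq i]
  rintro (hm | hm)
  -- Both end points have height `r sin φ` over the edge, so the segment is parallel to the edge and
  -- cannot meet it.
  · have h1 := im_eq_zero_of_mem_edge hm
    have h2 : (s • circleMap (v i) r (a + φ) + t • (v (i + 1) - r * exp ((a - φ : ℝ) * I)) - v i) *
        exp (-(a * I)) = ((s * r : ℝ) : ℂ) * exp (φ * I) + ((t * ℓ : ℝ) : ℂ) -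
          ((t * r : ℝ) : ℂ) * exp ((-φ : ℝ) * I) := by
      obtain rfl : s = 1 - t := by linarith
      rw [hv, circleMap, hexp, hexp', Complex.exp_neg]
      have := Complex.exp_ne_zero (a * I)
      simp only [real_smul]
      push_cast
      field_simp
      ring
    rw [h2] at h1
    simp only [sub_im, add_im, im_ofReal_mul, exp_ofReal_mul_I_im, ofReal_im, Real.sin_neg] at h1
    have h3 : Real.sin φ * r = 0 := by
      have : s * r + t * r = r := by rw [← add_mul, hst, one_mul]
      linear_combination h1 - Real.sin φ * this
    have hlt : |φ| < π := hφ.trans_le (min_le_right _ _)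
    have h4 := (Real.sin_eq_zero_iff_of_lt_of_lt (abs_lt.1 hlt).1 (abs_lt.1 hlt).2).1
      ((mul_eq_zero.1 h3).resolve_right hr.ne')
    exact hφ0 h4
  · refine hth ?_ hm
    rw [Metric.mem_thickening_iff]
    refine ⟨s • (v i + r * exp (a * I)) + t • (v (i + 1) - r * exp (a * I)),
      ⟨s, t, hs, ht, hst, rfl⟩, ?_⟩
    rw [dist_eq_norm]
    have e : s • circleMap (v i) r (a + φ) + t • (v (i + 1) - r * exp ((a - φ : ℝ) * I)) -
        (s • (v i + r * exp (a * I)) + t • (v (i + 1) - r * exp (a * I))) =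
        ((s * r : ℝ) : ℂ) * (exp (a * I) * exp (φ * I) - exp (a * I)) -
        ((t * r : ℝ) : ℂ) * (exp (a * I) * exp ((-φ : ℝ) * I) - exp (a * I)) := by
      rw [circleMap, hexp, hexp']
      simp only [real_smul]
      push_cast
      ring
    rw [e]
    refine (norm_sub_le _ _).trans_lt ?_
    rw [norm_mul, norm_mul, norm_real, norm_real, Real.norm_of_nonneg (by positivity),
      Real.norm_of_nonneg (by positivity)]
    have k1 := mul_le_mul_of_nonneg_left (hnear φ rfl) (by positivity : 0 ≤ s * r)
    have k2 := mul_le_mul_of_nonneg_left (hnear (-φ) (abs_neg φ)) (by positivity : 0 ≤ t * r)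
    have k3 : |φ| * r < δ := (lt_div_iff₀ hr).1 (hφ.trans_le (min_le_left _ _))
    have : s * r + t * r = r := by rw [← add_mul, hst, one_mul]
    nlinarith

end IsSimpleLoop

end PolygonalBilliard

/-! ### Winding numbers and the side of the curve that is enclosed. -/

namespace PolygonalBilliard

open Complex Finset

theorem zero_notMem_segment_sub {a b q : ℂ} (h : q ∉ segment ℝ a b) :
    (0 : ℂ) ∉ segment ℝ (a - q) (b - q) := by
  rintro ⟨s, t, hs, ht, hst, h0⟩
  refine h ⟨s, t, hs, ht, hst, ?_⟩
  obtain rfl : s = 1 - t := by linarith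
  simp only [real_smul] at h0 ⊢
  push_cast at h0 ⊢
  linear_combination h0

/-- Off the segment, `a - q` and `b - q` lie in a common open half plane, so their quotient avoids
the cut of `arg`. -/
theorem continuousAt_ang_sub {a b q : ℂ} (h : q ∉ segment ℝ a b) :
    ContinuousAt (fun q => ang (a - q) (b - q)) q := by
  have h1 : a - q ≠ 0 := sub_ne_zero.2 fun e => h (e ▸ left_mem_segment ℝ a b)
  have h2 : b - q ≠ 0 := sub_ne_zero.2 fun e => h (e ▸ right_mem_segment ℝ a b)
  obtain ⟨ω, k1, k2⟩ := exists_re_pos_of_zero_notMem_segment (zero_notMem_segment_sub h)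
  have hs : (b - q) / (a - q) ∈ slitPlane := by
    refine mem_slitPlane_iff_arg.2 ⟨?_, div_ne_zero h2 h1⟩
    have l1 := abs_lt.1 (abs_arg_lt_pi_div_two_iff.2 (Or.inl k1))
    have l2 := abs_lt.1 (abs_arg_lt_pi_div_two_iff.2 (Or.inl k2))
    have := ang_eq_of_re_pos k1 k2
    rw [ang] at this
    rw [this]
    intro
    linarith
  have hd : ContinuousAt (fun q => (b - q) / (a - q)) q := by fun_prop (disch := assumption)
  exact ContinuousAt.comp (f := fun q => (b - q) / (a - q)) (g := arg) (continuousAt_arg hs) hd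

/-- `2 π` times the winding number of the closed curve around `q`. -/
noncomputable def wind (v : ℕ → ℂ) (n : ℕ) (q : ℂ) : ℝ :=
  ∑ i ∈ range n, ang (v i - q) (v (i + 1) - q)

theorem exp_ang {a b : ℂ} (ha : a ≠ 0) (hb : b ≠ 0) :
    exp (ang a b * I) = (b / ‖b‖) / (a / ‖a‖) := by
  rw [ang, exp_arg_mul_I (div_ne_zero hb ha), norm_div]
  push_cast
  field_simp

/-- Every point of `J` is the direction angle of points of `C` close to `c`. -/
def SectorIn (C : Set ℂ) (c : ℂ) (J : Set ℝ) : Prop :=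
  ∃ ρ > 0, ∀ r, 0 < r → r < ρ → ∀ φ ∈ J, circleMap c r φ ∈ C

namespace IsSimpleLoop

variable {v : ℕ → ℂ} {n : ℕ}

theorem notMem_segment {q : ℂ} (hq : q ∉ loopSet v) (i : ℕ) : q ∉ segment ℝ (v i) (v (i + 1)) :=
  fun h => hq (Set.mem_iUnion_of_mem i h)

theorem continuousOn_wind : ContinuousOn (wind v n) (loopSet v)ᶜ := fun _ hq =>
  (tendsto_finsetSum _ fun i _ =>
    (continuousAt_ang_sub (notMem_segment hq i)).tendsto).mono_left nhdsWithin_le_nhds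

theorem exists_wind_eq (h : IsSimpleLoop v n) {q : ℂ} (hq : q ∉ loopSet v) :
    ∃ k : ℤ, wind v n q = k * (2 * π) := by
  have hz : ∀ i, v i - q ≠ 0 := fun i => sub_ne_zero.2 fun e =>
    notMem_segment hq i (e ▸ left_mem_segment ℝ _ _)
  have hz' : ∀ i, ((v i - q) / ‖v i - q‖ : ℂ) ≠ 0 := fun i =>
    div_ne_zero (hz i) (by exact_mod_cast norm_ne_zero_iff.2 (hz i))
  have hv : v n = v 0 := by simpa using h.periodic 0
  have key : ∀ m, exp ((∑ i ∈ range m, ang (v i - q) (v (i + 1) - q) : ℝ) * I) =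
      ((v m - q) / ‖v m - q‖) / ((v 0 - q) / ‖v 0 - q‖) := by
    intro m
    induction m with
    | zero => simp [div_self (hz' 0)]
    | succ m ih =>
      rw [sum_range_succ]
      push_cast at ih ⊢
      rw [add_mul, Complex.exp_add, ih, exp_ang (hz m) (hz _), mul_comm, div_mul_div_cancel₀ (hz' m)]
  have h1 := key n
  rw [hv, div_self (hz' 0), ← Complex.exp_zero] at h1
  obtain ⟨k, hk⟩ := exp_eq_exp_iff_exists_int.1 h1
  refine ⟨k, ?_⟩
  have : (wind v n q : ℂ) * I = ((k * (2 * π) : ℝ) : ℂ) * I := by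
    rw [wind, hk]; push_cast; ring
  exact_mod_cast mul_right_cancel₀ I_ne_zero this

/-- A continuous function with values in `2π ℤ` is constant on a connected set: between two
different values it would also take a half-integral multiple of `2π`. One inequality is enough since
`x` and `y` may be exchanged. -/
theorem wind_le_of_isPreconnected (h : IsSimpleLoop v n) {S : Set ℂ} (hS : S ⊆ (loopSet v)ᶜ)
    (hc : IsPreconnected S) {x y : ℂ} (hx : x ∈ S) (hy : y ∈ S) : wind v n y ≤ wind v n x := by
  by_contra! hlt
  obtain ⟨k, hk⟩ := h.exists_wind_eq (hS hx)
  obtain ⟨l, hl⟩ := h.exists_wind_eq (hS hy)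
  have hkl : k < l := by
    rw [hk, hl] at hlt
    exact_mod_cast lt_of_mul_lt_mul_right hlt (by positivity)
  have hkl' : (k : ℝ) + 1 ≤ l := by exact_mod_cast hkl
  have hpi := Real.pi_pos
  obtain ⟨z, hz, hze⟩ := hc.intermediate_value hx hy (continuousOn_wind.mono hS)
    (show (k + 1 / 2) * (2 * π) ∈ Set.Icc (wind v n x) (wind v n y) by
      rw [hk, hl]
      constructor <;> nlinarith)
  obtain ⟨m, hm⟩ := h.exists_wind_eq (hS hz)
  rw [hm] at hze
  have h1 : (m : ℝ) = k + 1 / 2 := mul_right_cancel₀ (by positivity) hze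
  have h2 : ((2 * m : ℤ) : ℝ) = ((2 * k + 1 : ℤ) : ℝ) := by push_cast; linarith
  have h3 : 2 * m = 2 * k + 1 := by exact_mod_cast h2
  omega

/-- From a point farther out than all vertices, the whole curve is seen in one half plane, and the
sum of angles telescopes around the loop. -/
theorem wind_eq_zero_of_norm (h : IsSimpleLoop v n) {q : ℂ} (hq : ∀ i, ‖v i‖ < ‖q‖) :
    wind v n q = 0 := by
  have hv : v n = v 0 := by simpa using h.periodic 0
  have hre : ∀ i, 0 < ((v i - q) * (starRingEnd ℂ) (-q)).re := by
    intro i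
    have e : ((v i - q) * (starRingEnd ℂ) (-q)) = ((‖q‖ ^ 2 : ℝ) : ℂ) - v i * (starRingEnd ℂ) q := by
      have := mul_conj' q
      rw [map_neg]
      push_cast
      linear_combination this
    rw [e, sub_re, ofReal_re]
    have h1 : (v i * (starRingEnd ℂ) q).re ≤ ‖v i‖ * ‖q‖ := by
      refine (re_le_norm _).trans ?_
      rw [norm_mul, norm_conj]
    nlinarith [hq i, norm_nonneg (v i)]
  have : ∀ i, ang (v i - q) (v (i + 1) - q) = arg ((v (i + 1) - q) * (starRingEnd ℂ) (-q)) -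
      arg ((v i - q) * (starRingEnd ℂ) (-q)) := fun i => ang_eq_of_re_pos (hre i) (hre _)
  simp only [wind, this]
  rw [sum_range_sub (fun i => arg ((v i - q) * (starRingEnd ℂ) (-q))), hv, sub_self]

theorem exists_norm_bound (h : IsSimpleLoop v n) : ∃ M, ∀ i, ‖v i‖ < M := by
  have hn := h.three_le
  refine ⟨∑ i ∈ range n, ‖v i‖ + 1, fun i => ?_⟩
  have hp : v i = v (i % n) := (Function.Periodic.map_mod_nat h.periodic i).symm
  rw [hp]
  have := single_le_sum (f := fun i => ‖v i‖) (s := range n) (fun i _ => norm_nonneg _)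
    (mem_range.2 (Nat.mod_lt i (by omega : 0 < n)))
  linarith

theorem wind_eq_zero_of_not_isBounded (h : IsSimpleLoop v n) {S : Set ℂ}
    (hS : S ⊆ (loopSet v)ᶜ) (hc : IsPreconnected S) (hb : ¬ Bornology.IsBounded S) {x : ℂ}
    (hx : x ∈ S) : wind v n x = 0 := by
  obtain ⟨M, hM⟩ := h.exists_norm_bound
  obtain ⟨y, hy, hyM⟩ : ∃ y ∈ S, M < ‖y‖ := by
    by_contra! hcon
    exact hb (isBounded_iff_forall_norm_le.2 ⟨M, hcon⟩)
  rw [← h.wind_eq_zero_of_norm fun i => (hM i).trans hyM]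
  exact le_antisymm (h.wind_le_of_isPreconnected hS hc hy hx)
    (h.wind_le_of_isPreconnected hS hc hx hy)

theorem mem_enclosed_of_wind_ne_zero (h : IsSimpleLoop v n) {q : ℂ} (hq : q ∉ loopSet v)
    (hw : wind v n q ≠ 0) : q ∈ enclosed (loopSet v) :=
  ⟨hq, fun _ hS hc hx => by_contra fun hb => hw (h.wind_eq_zero_of_not_isBounded hS hc hb hx)⟩

open Filter Topology in
/-- The winding number jumps across an edge. -/
theorem exists_tendsto_wind (h : IsSimpleLoop v n) {r : ℝ} (hr : 0 < r)
    (hr' : r < ‖v 1 - v 0‖) : ∃ c : ℝ,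
    Tendsto (fun φ => wind v n (circleMap (v 0) r (edgeArg v 0 + φ))) (𝓝[>] 0) (𝓝 (π + c)) ∧
    Tendsto (fun φ => wind v n (circleMap (v 0) r (edgeArg v 0 + φ))) (𝓝[<] 0) (𝓝 (-π + c)) := by
  have hn := h.three_le
  set a := edgeArg v 0 with ha
  set ℓ := ‖v 1 - v 0‖ with hℓ
  have hv : v 1 = v 0 + ℓ * exp (a * I) := by
    have := circleMap_edgeArg v 0 1
    simp only [circleMap, one_mul, ofReal_one, zero_add] at this
    linear_combination -this
  have hr0 : (r : ℂ) ≠ 0 := by exact_mod_cast hr.ne'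
  -- `g φ` is the quotient `(v 1 - q) / (v 0 - q)` at the point `q` with angle offset `φ`. At `φ =
  -- 0` it is a negative real because `r < ℓ`, so its argument jumps there by `2π`, while the other
  -- edges contribute continuously.
  set g : ℝ → ℂ := fun φ => 1 - (ℓ / r : ℝ) * exp ((-φ : ℝ) * I) with hg
  have hang : ∀ φ : ℝ, ang (v 0 - circleMap (v 0) r (a + φ)) (v 1 - circleMap (v 0) r (a + φ)) =
      arg (g φ) := fun φ => by
    rw [ang, circleMap, hg, hv]
    congr 1
    have h1 := Complex.exp_ne_zero (a * I)
    have h2 := Complex.exp_ne_zero (φ * I)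
    push_cast
    rw [add_mul, Complex.exp_add, neg_mul, Complex.exp_neg]
    field_simp
    ring
  set c := ∑ i ∈ Ico 1 n, ang (v i - circleMap (v 0) r (a + 0)) (v (i + 1) - circleMap (v 0) r (a + 0))
  have hsum : ∀ φ, wind v n (circleMap (v 0) r (a + φ)) = arg (g φ) +
      ∑ i ∈ Ico 1 n, ang (v i - circleMap (v 0) r (a + φ)) (v (i + 1) - circleMap (v 0) r (a + φ)) := by
    intro φ
    rw [wind, ← Nat.Ico_zero_eq_range, sum_eq_sum_Ico_succ_bot (by omega), ← hang]
  have hq0 := h.notMem_other_edges 0 hr hr'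
  have hrest : Tendsto (fun φ => ∑ i ∈ Ico 1 n,
      ang (v i - circleMap (v 0) r (a + φ)) (v (i + 1) - circleMap (v 0) r (a + φ)))
      (𝓝 0) (𝓝 c) := by
    refine tendsto_finsetSum _ fun i hi => ?_
    have h1 : circleMap (v 0) r (a + 0) ∉ segment ℝ (v i) (v (i + 1)) := by
      intro hm
      refine hq0 ?_
      simp only [Set.mem_iUnion]
      exact ⟨i, by simpa using hi, by simpa [circleMap] using hm⟩
    have h2 : ContinuousAt (fun φ : ℝ => circleMap (v 0) r (a + φ)) 0 :=
      ((continuous_circleMap _ _).comp (continuous_const.add continuous_id)).continuousAt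
    exact ContinuousAt.comp (f := fun φ : ℝ => circleMap (v 0) r (a + φ))
      (continuousAt_ang_sub h1) h2
  have hgc : Continuous g := by fun_prop
  have him : ∀ φ, (g φ).im = ℓ / r * Real.sin φ := fun φ => by
    simp only [hg, sub_im, one_im, im_ofReal_mul, exp_ofReal_mul_I_im, Real.sin_neg]
    ring
  have hg0 : g 0 = ((1 - ℓ / r : ℝ) : ℂ) := by simp [hg]
  have hgre : (g 0).re < 0 := by
    rw [hg0, ofReal_re, sub_neg, lt_div_iff₀ hr]; linarith
  have hgim : (g 0).im = 0 := by rw [hg0, ofReal_im]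
  have hℓ0 : 0 < ℓ / r := by have := hr.trans hr'; positivity
  refine ⟨c, ?_, ?_⟩
  · simp only [hsum]
    refine Tendsto.add ?_ (hrest.mono_left nhdsWithin_le_nhds)
    refine (tendsto_arg_nhdsWithin_im_nonneg_of_re_neg_of_im_zero hgre hgim).comp
      (tendsto_nhdsWithin_iff.2 ⟨hgc.continuousAt.mono_left nhdsWithin_le_nhds, ?_⟩)
    filter_upwards [Ioo_mem_nhdsGT Real.pi_pos] with φ hφ
    rw [him]
    exact mul_nonneg hℓ0.le (Real.sin_pos_of_pos_of_lt_pi hφ.1 hφ.2).le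
  · simp only [hsum]
    refine Tendsto.add ?_ (hrest.mono_left nhdsWithin_le_nhds)
    refine (tendsto_arg_nhdsWithin_im_neg_of_re_neg_of_im_zero hgre hgim).comp
      (tendsto_nhdsWithin_iff.2 ⟨hgc.continuousAt.mono_left nhdsWithin_le_nhds, ?_⟩)
    filter_upwards [Ioo_mem_nhdsLT (neg_lt_zero.2 Real.pi_pos)] with φ hφ
    rw [him]
    exact mul_neg_of_pos_of_neg hℓ0 (Real.sin_neg_of_neg_of_neg_pi_lt hφ.2 hφ.1)

/-- The directions to the left of the curve at the vertex `v (i + 1)`. -/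
noncomputable def leftSector (v : ℕ → ℂ) (i : ℕ) : Set ℝ :=
  Set.Ioo (edgeArg v (i + 1)) (edgeArg v (i + 1) + leftAngle v i)

/-- The directions to the right of the curve at the vertex `v (i + 1)`. -/
noncomputable def rightSector (v : ℕ → ℂ) (i : ℕ) : Set ℝ :=
  Set.Ioo (edgeArg v (i + 1) + leftAngle v i) (edgeArg v (i + 1) + 2 * π)

theorem sectorIn_compl (h : IsSimpleLoop v n) (i : ℕ) :
    SectorIn (loopSet v)ᶜ (v (i + 1)) (leftSector v i) ∧
    SectorIn (loopSet v)ᶜ (v (i + 1)) (rightSector v i) := by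
  obtain ⟨ρ, hρ, H⟩ := h.exists_sector_notMem i
  exact ⟨⟨ρ, hρ, fun r h1 h2 φ hφ => H r h1 h2 φ (Or.inl hφ)⟩,
    ⟨ρ, hρ, fun r h1 h2 φ hφ => H r h1 h2 φ (Or.inr hφ)⟩⟩

end IsSimpleLoop

/-- A truncated sector off `K` is connected, so a single enclosed point in it makes all of it
enclosed. -/
theorem SectorIn.of_mem {K : Set ℂ} {c : ℂ} {J : Set ℝ} (hJ : Convex ℝ J)
    (hK : SectorIn Kᶜ c J)
    (hex : ∀ ρ > 0, ∃ r, 0 < r ∧ r < ρ ∧ ∃ φ ∈ J, circleMap c r φ ∈ enclosed K) :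
    SectorIn (enclosed K) c J := by
  obtain ⟨ρ, hρ, H⟩ := hK
  obtain ⟨r, hr, hrρ, φ, hφ, hm⟩ := hex ρ hρ
  have hsub : (fun p : ℝ × ℝ => circleMap c p.1 p.2) '' Set.Ioo 0 ρ ×ˢ J ⊆ Kᶜ := by
    rintro _ ⟨p, ⟨hp1, hp2⟩, rfl⟩
    exact H p.1 hp1.1 hp1.2 p.2 hp2
  have := subset_enclosed hsub (isPreconnected_image_circleMap c _ (convex_Ioo 0 ρ) J hJ)
    ⟨(r, φ), ⟨⟨hr, hrρ⟩, hφ⟩, rfl⟩ hm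
  exact ⟨ρ, hρ, fun s h1 h2 ψ hψ => this ⟨(s, ψ), ⟨⟨h1, h2⟩, hψ⟩, rfl⟩⟩

theorem SectorIn.compl_of_not {K : Set ℂ} {c : ℂ} {J : Set ℝ} (hJ : Convex ℝ J)
    (hK : SectorIn Kᶜ c J) (hn : ¬ SectorIn (enclosed K) c J) :
    SectorIn (K ∪ enclosed K)ᶜ c J := by
  by_contra hcon
  refine hn (SectorIn.of_mem hJ hK fun ρ hρ => ?_)
  obtain ⟨ρ', hρ', H⟩ := hK
  by_contra! hno
  refine hcon ⟨min ρ ρ', lt_min hρ hρ', fun r h1 h2 φ hφ => ?_⟩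
  rintro (hm | hm)
  · exact H r h1 (h2.trans_le (min_le_right _ _)) φ hφ hm
  · exact hno r h1 (h2.trans_le (min_le_left _ _)) φ hφ hm

namespace IsSimpleLoop

variable {v : ℕ → ℂ} {n : ℕ}

/-- A segment running close to the edge on its left joins the left sectors at its two ends without
meeting the curve. -/
theorem sectorIn_left_succ (h : IsSimpleLoop v n) (i : ℕ)
    (hi : SectorIn (enclosed (loopSet v)) (v (i + 1)) (leftSector v i)) :
    SectorIn (enclosed (loopSet v)) (v (i + 2)) (leftSector v (i + 1)) := by
  obtain ⟨ρ, hρ, H⟩ := hi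
  refine SectorIn.of_mem (convex_Ioo _ _) (h.sectorIn_compl (i + 1)).1 fun ρ' hρ' => ?_
  have hℓ : 0 < ‖v (i + 1 + 1) - v (i + 1)‖ :=
    norm_pos_iff.2 (sub_ne_zero.2 (h.ne_succ (i + 1)).symm)
  obtain ⟨r, hr, hr'⟩ := exists_between (lt_min (lt_min hρ hρ') hℓ)
  simp only [lt_min_iff] at hr'
  obtain ⟨η, hη, hseg⟩ := h.exists_segment_subset_compl (i + 1) hr hr'.2
  have hβ := h.leftAngle_mem i
  have hβ' := h.leftAngle_mem (i + 1)
  obtain ⟨φ, hφ, hφ'⟩ := exists_between (lt_min (lt_min hβ.1 hβ'.1) hη)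
  simp only [lt_min_iff] at hφ'
  refine ⟨r, hr, hr'.1.2, edgeArg v (i + 2) + leftAngle v (i + 1) - φ,
    ⟨by change edgeArg v (i + 2) < _; linarith, by change _ < edgeArg v (i + 2) + _; linarith⟩, ?_⟩
  rw [h.circleMap_leftAngle_sub (i + 1)]
  refine (mem_enclosed_iff_of_segment_subset
    (hseg φ hφ.ne' (by rw [abs_of_pos hφ]; exact hφ'.2))).1 ?_
  exact H r hr hr'.1.1 _ ⟨by linarith, by linarith⟩

theorem sectorIn_right_succ (h : IsSimpleLoop v n) (i : ℕ)
    (hi : SectorIn (enclosed (loopSet v)) (v (i + 1)) (rightSector v i)) :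
    SectorIn (enclosed (loopSet v)) (v (i + 2)) (rightSector v (i + 1)) := by
  obtain ⟨ρ, hρ, H⟩ := hi
  refine SectorIn.of_mem (convex_Ioo _ _) (h.sectorIn_compl (i + 1)).2 fun ρ' hρ' => ?_
  have hℓ : 0 < ‖v (i + 1 + 1) - v (i + 1)‖ :=
    norm_pos_iff.2 (sub_ne_zero.2 (h.ne_succ (i + 1)).symm)
  obtain ⟨r, hr, hr'⟩ := exists_between (lt_min (lt_min hρ hρ') hℓ)
  simp only [lt_min_iff] at hr'
  obtain ⟨η, hη, hseg⟩ := h.exists_segment_subset_compl (i + 1) hr hr'.2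
  have hβ := h.leftAngle_mem i
  have hβ' := h.leftAngle_mem (i + 1)
  obtain ⟨φ, hφ, hφ'⟩ := exists_between
    (lt_min (lt_min (sub_pos.2 hβ.2) (sub_pos.2 hβ'.2)) hη)
  simp only [lt_min_iff] at hφ'
  refine ⟨r, hr, hr'.1.2, edgeArg v (i + 2) + leftAngle v (i + 1) - (-φ),
    ⟨by change edgeArg v (i + 2) + _ < _; linarith,
      by change _ < edgeArg v (i + 2) + _; linarith⟩, ?_⟩
  rw [h.circleMap_leftAngle_sub (i + 1)]
  refine (mem_enclosed_iff_of_segment_subset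
    (hseg (-φ) (neg_ne_zero.2 hφ.ne') (by rw [abs_neg, abs_of_pos hφ]; exact hφ'.2))).1 ?_
  -- The angle `-φ` relative to the edge belongs to the right sector only after adding `2π`.
  rw [← periodic_circleMap]
  exact H r hr hr'.1.1 _ ⟨by linarith, by linarith⟩

/-- Transport along edges only goes forward; on a closed curve this still reaches every vertex, by
going around often enough. -/
theorem forall_of_succ {Q : ℕ → Prop} (n m : ℕ) (hn : 0 < n) (hQ : ∀ i, Q i → Q (i + 1))
    (hp : ∀ i, Q (i + n) → Q i) (hm : Q m) : ∀ i, Q i := by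
  have h1 : ∀ k, Q (m + k) := fun k => by
    induction k with
    | zero => exact hm
    | succ k ih => exact hQ _ ih
  have h2 : ∀ k i, Q (i + k * n) → Q i := fun k => by
    induction k with
    | zero => simp
    | succ k ih => exact fun i hi => ih i (hp _ (by rwa [add_assoc, ← Nat.succ_mul]))
  intro i
  refine h2 m i ?_
  have : m ≤ m * n := Nat.le_mul_of_pos_right _ hn
  rw [show i + m * n = m + (i + m * n - m) by omega]
  exact h1 _

theorem edgeArg_add (h : IsSimpleLoop v n) (i : ℕ) : edgeArg v (i + n) = edgeArg v i := by
  rw [edgeArg, add_right_comm, h.periodic, h.periodic, edgeArg]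

theorem turn_add (h : IsSimpleLoop v n) (i : ℕ) : turn v (i + n) = turn v i := by
  rw [turn, add_right_comm, add_right_comm _ n 2, h.periodic, h.periodic, h.periodic, turn]

theorem sector_add (h : IsSimpleLoop v n) (i : ℕ) :
    leftSector v (i + n) = leftSector v i ∧ rightSector v (i + n) = rightSector v i := by
  simp only [leftSector, rightSector, leftAngle, h.turn_add, add_right_comm i n 1, h.edgeArg_add,
    and_self]

theorem sectorIn_left_all (h : IsSimpleLoop v n) {m : ℕ}
    (hm : SectorIn (enclosed (loopSet v)) (v (m + 1)) (leftSector v m)) (i : ℕ) :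
    SectorIn (enclosed (loopSet v)) (v (i + 1)) (leftSector v i) := by
  have hn := h.three_le
  refine forall_of_succ (Q := fun i => SectorIn (enclosed (loopSet v)) (v (i + 1)) (leftSector v i))
    n m (by omega) h.sectorIn_left_succ (fun i hi => ?_) hm i
  rwa [(h.sector_add i).1, add_right_comm, h.periodic] at hi

theorem sectorIn_right_all (h : IsSimpleLoop v n) {m : ℕ}
    (hm : SectorIn (enclosed (loopSet v)) (v (m + 1)) (rightSector v m)) (i : ℕ) :
    SectorIn (enclosed (loopSet v)) (v (i + 1)) (rightSector v i) := by
  have hn := h.three_le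
  refine forall_of_succ (Q := fun i => SectorIn (enclosed (loopSet v)) (v (i + 1)) (rightSector v i))
    n m (by omega) h.sectorIn_right_succ (fun i hi => ?_) hm i
  rwa [(h.sector_add i).2, add_right_comm, h.periodic] at hi

theorem im_le_of_mem_loopSet (h : IsSimpleLoop v n) (hl : LowestAtZero v n) {z : ℂ}
    (hz : z ∈ loopSet v) : (v 0).im ≤ z.im := by
  have hn := h.three_le
  have hvert : ∀ i, (v 0).im ≤ (v i).im := by
    intro i
    have hp : v i = v (i % n) := (Function.Periodic.map_mod_nat h.periodic i).symm
    rw [hp]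
    rcases Nat.eq_zero_or_pos (i % n) with h0 | h0
    · rw [h0]
    · have := arg_nonneg_iff.1 (hl (i % n) h0 (Nat.mod_lt i (by omega))).1
      rwa [sub_im, sub_nonneg] at this
  obtain ⟨i, hi⟩ := Set.mem_iUnion.1 hz
  obtain ⟨s, t, hs, ht, hst, rfl⟩ := hi
  have h1 := mul_le_mul_of_nonneg_left (hvert i) hs
  have h2 := mul_le_mul_of_nonneg_left (hvert (i + 1)) ht
  simp only [real_smul, add_im, im_ofReal_mul]
  calc (v 0).im = s * (v 0).im + t * (v 0).im := by rw [← add_mul, hst, one_mul]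
    _ ≤ _ := add_le_add h1 h2

/-- A sector at the lowest vertex that contains the downward direction is not enclosed. -/
theorem exists_sector_wind_eq_zero (h : IsSimpleLoop v n) (hl : LowestAtZero v n) {J : Set ℝ}
    (hJ : Convex ℝ J) (hK : SectorIn (loopSet v)ᶜ (v 0) J) (hd : 3 * π / 2 ∈ J) :
    ∃ ρ > 0, ∀ r, 0 < r → r < ρ → ∀ φ ∈ J, circleMap (v 0) r φ ∉ enclosed (loopSet v) ∧
      wind v n (circleMap (v 0) r φ) = 0 := by
  obtain ⟨ρ, hρ, H⟩ := hK
  refine ⟨ρ, hρ, fun r hr hrρ φ hφ => ?_⟩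
  have hexp : exp ((3 * π / 2 : ℝ) * I) = -I := by
    have : ((3 * π / 2 : ℝ) : ℂ) * I = π * I + π / 2 * I := by push_cast; ring
    rw [this, Complex.exp_add, exp_pi_mul_I, exp_pi_div_two_mul_I]
    ring
  set S := (fun p : ℝ × ℝ => circleMap (v 0) p.1 p.2) '' Set.Ioo 0 ρ ×ˢ J with hS
  -- `T` is the vertical ray going down from the lowest vertex. It avoids the curve and joins the
  -- sector `S` to infinity.
  set T := (fun p : ℝ × ℝ => circleMap (v 0) p.1 p.2) '' Set.Ioi 0 ×ˢ {3 * π / 2} with hT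
  have hSK : S ⊆ (loopSet v)ᶜ := by
    rintro _ ⟨p, ⟨hp1, hp2⟩, rfl⟩
    exact H p.1 hp1.1 hp1.2 p.2 hp2
  have hTK : T ⊆ (loopSet v)ᶜ := by
    rintro _ ⟨⟨t, ψ⟩, ⟨hp1, hp2⟩, rfl⟩ hm
    simp only [Set.mem_Ioi, Set.mem_singleton_iff] at hp1 hp2
    have := h.im_le_of_mem_loopSet hl hm
    simp only [circleMap, hp2, hexp] at this
    simp at this
    linarith
  have hTb : ¬ Bornology.IsBounded T := by
    intro hb
    obtain ⟨M, hM⟩ := isBounded_iff_forall_norm_le.1 hb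
    have hmem : circleMap (v 0) (|M| + ‖v 0‖ + 1) (3 * π / 2) ∈ T :=
      ⟨(|M| + ‖v 0‖ + 1, 3 * π / 2), ⟨by simp only [Set.mem_Ioi]; positivity, rfl⟩, rfl⟩
    have h1 := hM _ hmem
    have h2 : ‖circleMap (v 0) (|M| + ‖v 0‖ + 1) (3 * π / 2) - v 0‖ = |M| + ‖v 0‖ + 1 := by
      rw [circleMap, add_sub_cancel_left, norm_mul, norm_exp_ofReal_mul_I, mul_one, norm_real,
        Real.norm_of_nonneg (by positivity)]
    have h3 := norm_sub_le (circleMap (v 0) (|M| + ‖v 0‖ + 1) (3 * π / 2)) (v 0)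
    linarith [le_abs_self M]
  have hcon : IsPreconnected (S ∪ T) :=
    (isPreconnected_image_circleMap _ _ (convex_Ioo 0 ρ) J hJ).union
      (circleMap (v 0) r (3 * π / 2)) ⟨(r, _), ⟨⟨hr, hrρ⟩, hd⟩, rfl⟩
      ⟨(r, _), ⟨hr, rfl⟩, rfl⟩
      (isPreconnected_image_circleMap _ _ (convex_Ioi 0) _ (convex_singleton _))
  have hub : ¬ Bornology.IsBounded (S ∪ T) := fun hb => hTb (hb.subset Set.subset_union_right)
  have hx : circleMap (v 0) r φ ∈ S ∪ T := Or.inl ⟨(r, φ), ⟨⟨hr, hrρ⟩, hφ⟩, rfl⟩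
  exact ⟨fun he => hub (he.2 _ (Set.union_subset hSK hTK) hcon hx),
    h.wind_eq_zero_of_not_isBounded (Set.union_subset hSK hTK) hcon hub hx⟩

-- The lowest vertex decides which side is enclosed. The downward direction lies in the right sector
-- when the total turning is `2π`, and in the left one when it is `-2π`; that sector is connected to
-- infinity and has winding number zero. Crossing the first edge changes the winding number by `2π`,
-- so the opposite sector is enclosed. Transport along the edges carries both facts to all vertices.
open Filter Topology in
theorem sectorIn_enclosed (h : IsSimpleLoop v n) (hl : LowestAtZero v n) :
    (∑ i ∈ range n, turn v i = 2 * π ∧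
      ∀ i, SectorIn (enclosed (loopSet v)) (v (i + 1)) (leftSector v i) ∧
        SectorIn (loopSet v ∪ enclosed (loopSet v))ᶜ (v (i + 1)) (rightSector v i)) ∨
    (∑ i ∈ range n, turn v i = -(2 * π) ∧
      ∀ i, SectorIn (enclosed (loopSet v)) (v (i + 1)) (rightSector v i) ∧
        SectorIn (loopSet v ∪ enclosed (loopSet v))ᶜ (v (i + 1)) (leftSector v i)) := by
  have hn := h.three_le
  have hpi := Real.pi_pos
  have e1 : n - 1 + 1 = n := by omega
  have hv : v n = v 0 := by simpa using h.periodic 0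
  have hea : edgeArg v n = edgeArg v 0 := by simpa using h.edgeArg_add 0
  have hea0 : edgeArg v 0 = arg (v 1 - v 0) := rfl
  have k1 := hl 1 (by omega) (by omega)
  have k2 := hl (n - 1) (by omega) (by omega)
  have hβ := h.leftAngle_mem (n - 1)
  have hℓ : 0 < ‖v 1 - v 0‖ := norm_pos_iff.2 (sub_ne_zero.2 (h.ne_succ 0).symm)
  have hK := h.sectorIn_compl (n - 1)
  rw [e1, hv] at hK
  have hLS : leftSector v (n - 1) = Set.Ioo (edgeArg v 0) (edgeArg v 0 + leftAngle v (n - 1)) := by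
    rw [leftSector, e1, hea]
  have hRS : rightSector v (n - 1) =
      Set.Ioo (edgeArg v 0 + leftAngle v (n - 1)) (edgeArg v 0 + 2 * π) := by
    rw [rightSector, e1, hea]
  have hnotin : ∀ {J : Set ℝ}, J.Nonempty → (∃ ρ > 0, ∀ r, 0 < r → r < ρ → ∀ φ ∈ J,
      circleMap (v 0) r φ ∉ enclosed (loopSet v) ∧ wind v n (circleMap (v 0) r φ) = 0) →
      ¬ SectorIn (enclosed (loopSet v)) (v 0) J := by
    rintro J ⟨φ, hφ⟩ ⟨ρ, hρ, H⟩ ⟨ρ', hρ', H'⟩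
    obtain ⟨r, hr, hr'⟩ := exists_between (lt_min hρ hρ')
    exact (H r hr (hr'.trans_le (min_le_left _ _)) φ hφ).1
      (H' r hr (hr'.trans_le (min_le_right _ _)) φ hφ)
  have hgt : ∀ {δ : ℝ}, 0 < δ → ∀ᶠ φ : ℝ in 𝓝[>] 0, φ ∈ Set.Ioo 0 δ := fun hδ => Ioo_mem_nhdsGT hδ
  have hlt : ∀ {δ : ℝ}, 0 < δ → ∀ᶠ φ : ℝ in 𝓝[<] 0, φ ∈ Set.Ioo (-δ) 0 :=
    fun hδ => Ioo_mem_nhdsLT (neg_lt_zero.2 hδ)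
  rcases h.sum_turn hl with ⟨hlt', hsum, hturn⟩ | ⟨hlt', hsum, hturn⟩
  · left
    have hβe : edgeArg v 0 + leftAngle v (n - 1) = arg (v (n - 1) - v 0) := by
      rw [leftAngle, hturn, hea0]; ring
    have hdown : 3 * π / 2 ∈ rightSector v (n - 1) := by
      rw [hRS, hβe, hea0]
      constructor <;> linarith [k1.1, k2.2]
    have hzero := h.exists_sector_wind_eq_zero hl (J := rightSector v (n - 1)) (convex_Ioo _ _) hK.2
      hdown
    have hR : ¬ SectorIn (enclosed (loopSet v)) (v 0) (rightSector v (n - 1)) :=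
      hnotin ⟨_, hdown⟩ hzero
    have hL : SectorIn (enclosed (loopSet v)) (v 0) (leftSector v (n - 1)) := by
      refine SectorIn.of_mem (convex_Ioo _ _) hK.1 fun ρ hρ => ?_
      obtain ⟨ρ₁, hρ₁, H₁⟩ := hzero
      obtain ⟨ρ₂, hρ₂, H₂⟩ := hK.1
      obtain ⟨r, hr, hr'⟩ := exists_between (lt_min (lt_min hρ hρ₁) (lt_min hρ₂ hℓ))
      simp only [lt_min_iff] at hr'
      obtain ⟨c, hc1, hc2⟩ := h.exists_tendsto_wind hr hr'.2.2
      -- The winding number vanishes on the right of the edge, so its limit from the left is `π + c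
      -- = 2π`.
      have hc : -π + c = 0 := by
        refine tendsto_nhds_unique (hc2.congr' ?_) tendsto_const_nhds
        filter_upwards [hlt (sub_pos.2 hβ.2)] with φ hφ
        rw [← periodic_circleMap]
        refine (H₁ r hr hr'.1.2 _ ?_).2
        rw [hRS]
        constructor <;> linarith [hφ.1, hφ.2]
      have hne := hc1.eventually_ne (show π + c ≠ 0 by linarith)
      obtain ⟨φ, hφ1, hφ2⟩ := (hne.and (hgt hβ.1)).exists
      have hφ : edgeArg v 0 + φ ∈ leftSector v (n - 1) := by
        rw [hLS]
        constructor <;> linarith [hφ2.1, hφ2.2]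
      exact ⟨r, hr, hr'.1.1, _, hφ,
        h.mem_enclosed_of_wind_ne_zero (H₂ r hr hr'.2.1 _ hφ) hφ1⟩
    refine ⟨hsum, fun i => ⟨h.sectorIn_left_all (m := n - 1) (by rwa [e1, hv]) i,
      SectorIn.compl_of_not (convex_Ioo _ _) (h.sectorIn_compl i).2 fun hi => hR ?_⟩⟩
    have := h.sectorIn_right_all hi (n - 1)
    rwa [e1, hv] at this
  · right
    have hβe : edgeArg v 0 + leftAngle v (n - 1) = arg (v (n - 1) - v 0) + 2 * π := by
      rw [leftAngle, hturn, hea0]; ring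
    have hdown : 3 * π / 2 ∈ leftSector v (n - 1) := by
      rw [hLS, hβe, hea0]
      constructor <;> linarith [k1.2, k2.1]
    have hzero := h.exists_sector_wind_eq_zero hl (J := leftSector v (n - 1)) (convex_Ioo _ _) hK.1
      hdown
    have hL : ¬ SectorIn (enclosed (loopSet v)) (v 0) (leftSector v (n - 1)) :=
      hnotin ⟨_, hdown⟩ hzero
    have hR : SectorIn (enclosed (loopSet v)) (v 0) (rightSector v (n - 1)) := by
      refine SectorIn.of_mem (convex_Ioo _ _) hK.2 fun ρ hρ => ?_
      obtain ⟨ρ₁, hρ₁, H₁⟩ := hzero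
      obtain ⟨ρ₂, hρ₂, H₂⟩ := hK.2
      obtain ⟨r, hr, hr'⟩ := exists_between (lt_min (lt_min hρ hρ₁) (lt_min hρ₂ hℓ))
      simp only [lt_min_iff] at hr'
      obtain ⟨c, hc1, hc2⟩ := h.exists_tendsto_wind hr hr'.2.2
      -- Here the left side is the outer one, and the limit from the right is `-π + c = -2π`.
      have hc : π + c = 0 := by
        refine tendsto_nhds_unique (hc1.congr' ?_) tendsto_const_nhds
        filter_upwards [hgt hβ.1] with φ hφ
        refine (H₁ r hr hr'.1.2 _ ?_).2
        rw [hLS]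
        constructor <;> linarith [hφ.1, hφ.2]
      have hne := hc2.eventually_ne (show -π + c ≠ 0 by linarith)
      obtain ⟨φ, hφ1, hφ2⟩ := (hne.and (hlt (sub_pos.2 hβ.2))).exists
      have hφ : edgeArg v 0 + φ + 2 * π ∈ rightSector v (n - 1) := by
        rw [hRS]
        constructor <;> linarith [hφ2.1, hφ2.2]
      rw [← periodic_circleMap] at hφ1
      exact ⟨r, hr, hr'.1.1, _, hφ,
        h.mem_enclosed_of_wind_ne_zero (H₂ r hr hr'.2.1 _ hφ) hφ1⟩
    refine ⟨hsum, fun i => ⟨h.sectorIn_right_all (m := n - 1) (by rwa [e1, hv]) i,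
      SectorIn.compl_of_not (convex_Ioo _ _) (h.sectorIn_compl i).1 fun hi => hL ?_⟩⟩
    have := h.sectorIn_left_all hi (n - 1)
    rwa [e1, hv] at this

end IsSimpleLoop

end PolygonalBilliard

/-! ### Interior angles of a simple polygon in the Euclidean plane. -/

namespace PolygonalBilliard

open Complex Finset

/-- The isometry between the complex and the Euclidean plane. -/
noncomputable def ofComplex : ℂ ≃ₗᵢ[ℝ] Plane := Complex.orthonormalBasisOneI.repr

theorem ofComplex_apply (z : ℂ) : ofComplex z = !₂[z.re, z.im] := by
  ext i
  fin_cases i <;> simp [ofComplex]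

theorem ofComplex_circleMap (c : ℂ) (r θ : ℝ) :
    ofComplex (circleMap c r θ) = ofComplex c + r • EuclideanPolygon.unitVector θ := by
  have : (r : ℂ) * exp (θ * I) = r • exp (θ * I) := by simp
  rw [circleMap, this, map_add, map_smul, ofComplex_apply (exp _)]
  simp [EuclideanPolygon.unitVector, exp_ofReal_mul_I_re, exp_ofReal_mul_I_im]

theorem mem_enclosed_image {E F : Type*} [NormedAddCommGroup E] [NormedSpace ℝ E]
    [NormedAddCommGroup F] [NormedSpace ℝ F] (e : E ≃ₗᵢ[ℝ] F) {K : Set E} {z : E}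
    (hz : z ∈ enclosed K) : e z ∈ enclosed (e '' K) := by
  refine ⟨fun ⟨y, hy, h⟩ => hz.1 (e.injective h ▸ hy), fun S hS hc hzS => ?_⟩
  have h1 := hz.2 (e.symm '' S) (by
    rintro _ ⟨y, hy, rfl⟩ hm
    exact hS hy ⟨_, hm, e.apply_symm_apply y⟩)
    (hc.image _ e.symm.continuous.continuousOn) ⟨_, hzS, e.symm_apply_apply z⟩
  have h2 := e.lipschitz.isBounded_image h1
  rwa [← Set.image_comp, e.self_comp_symm, Set.image_id] at h2

theorem mem_enclosed_image_iff {E F : Type*} [NormedAddCommGroup E] [NormedSpace ℝ E]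
    [NormedAddCommGroup F] [NormedSpace ℝ F] (e : E ≃ₗᵢ[ℝ] F) {K : Set E} {z : E} :
    e z ∈ enclosed (e '' K) ↔ z ∈ enclosed K := by
  refine ⟨fun h => ?_, mem_enclosed_image e⟩
  have := mem_enclosed_image e.symm h
  rwa [← Set.image_comp, e.symm_comp_self, Set.image_id, e.symm_apply_apply] at this

theorem mod_ne_mod {a b N : ℕ} (h1 : a < b) (h2 : b < a + N) : a % N ≠ b % N := by
  intro h
  have h3 : N ∣ b - a := (Nat.modEq_iff_dvd' h1.le).1 h
  have := Nat.eq_zero_of_dvd_of_lt h3 (by omega)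
  omega

namespace SimplePolygon

variable (J : SimplePolygon)

theorem size_pos : 0 < J.size := by have := J.three_le_size; omega

/-- The component of `x` is the largest connected set through `x` off the curve, so testing it alone
is the same as testing all such sets. -/
theorem inside_eq_enclosed : J.inside = enclosed J.curve := by
  ext x
  refine and_congr_right fun hx => ⟨fun hb S hS hc hxS => ?_, fun h => ?_⟩
  · exact hb.subset (hc.subset_connectedComponentIn hxS hS)
  · exact h _ (connectedComponentIn_subset _ _) isPreconnected_connectedComponentIn
      (mem_connectedComponentIn hx)

theorem finRotate_mod {N : ℕ} (hN : 0 < N) (j : ℕ) :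
    finRotate N ⟨j % N, Nat.mod_lt _ hN⟩ = ⟨(j + 1) % N, Nat.mod_lt _ hN⟩ := by
  obtain ⟨k, rfl⟩ : ∃ k, N = k + 1 := ⟨N - 1, by omega⟩
  rw [finRotate_apply]
  ext
  rw [Fin.val_add]
  simp

/-- The periodic sequence of the vertices, as complex numbers. -/
noncomputable def vertexSeq (j : ℕ) : ℂ :=
  ofComplex.symm (J.toPolygon.vertices ⟨j % J.size, Nat.mod_lt _ J.size_pos⟩)

theorem edgeSet_eq (i : Fin J.size) : J.toPolygon.edgeSet ℝ i =
    segment ℝ (J.toPolygon.vertices i) (J.toPolygon.vertices (finRotate _ i)) := by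
  rw [Polygon.edgeSet, affineSegment_eq_segment]

theorem mem_segment_vertexSeq {j : ℕ} {z : ℂ} :
    z ∈ segment ℝ (J.vertexSeq j) (J.vertexSeq (j + 1)) ↔
      ofComplex z ∈ J.toPolygon.edgeSet ℝ ⟨j % J.size, Nat.mod_lt _ J.size_pos⟩ := by
  have h := image_segment ℝ (ofComplex.toLinearEquiv.toLinearMap.toAffineMap)
    (J.vertexSeq j) (J.vertexSeq (j + 1))
  have h' : ofComplex '' segment ℝ (J.vertexSeq j) (J.vertexSeq (j + 1)) =
      J.toPolygon.edgeSet ℝ ⟨j % J.size, Nat.mod_lt _ J.size_pos⟩ := by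
    rw [edgeSet_eq, finRotate_mod J.size_pos]
    simpa [vertexSeq] using h
  rw [← h', ofComplex.injective.mem_set_image]

theorem isSimpleLoop_vertexSeq : IsSimpleLoop J.vertexSeq J.size where
  three_le := J.three_le_size
  periodic j := by simp [vertexSeq]
  ne_succ i h := by
    have h3 := J.three_le_size
    have := J.injective_vertices (ofComplex.symm.injective h)
    exact mod_ne_mod (Nat.lt_succ_self i) (by omega) (Fin.mk.inj_iff.1 this)
  adjacent i := by
    rintro z ⟨h1, h2⟩
    have h3 := J.three_le_size
    rw [mem_segment_vertexSeq] at h1 h2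
    have hne : (⟨i % J.size, Nat.mod_lt _ J.size_pos⟩ : Fin J.size) ≠
        ⟨(i + 1) % J.size, Nat.mod_lt _ J.size_pos⟩ := fun h =>
      mod_ne_mod (Nat.lt_succ_self i) (by omega) (Fin.mk.inj_iff.1 h)
    rcases J.edges_meet _ _ hne _ ⟨h1, h2⟩ with ⟨_, h⟩ | ⟨h, _⟩
    · rw [Set.mem_singleton_iff, vertexSeq, ← h, LinearIsometryEquiv.symm_apply_apply]
    · rw [finRotate_mod J.size_pos] at h
      exact absurd (Fin.mk.inj_iff.1 h) (mod_ne_mod (by omega) (by omega))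
  disjoint i j h1 h2 := by
    rw [Set.disjoint_left]
    intro z hi hj
    rw [mem_segment_vertexSeq] at hi hj
    have hne : (⟨i % J.size, Nat.mod_lt _ J.size_pos⟩ : Fin J.size) ≠
        ⟨j % J.size, Nat.mod_lt _ J.size_pos⟩ := fun h =>
      mod_ne_mod (by omega) (by omega) (Fin.mk.inj_iff.1 h)
    rcases J.edges_meet _ _ hne _ ⟨hi, hj⟩ with ⟨h, _⟩ | ⟨h, _⟩
    · rw [finRotate_mod J.size_pos] at h
      exact mod_ne_mod h1 (by omega) (Fin.mk.inj_iff.1 h).symm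
    · rw [finRotate_mod J.size_pos] at h
      exact mod_ne_mod (by omega) h2 (Fin.mk.inj_iff.1 h)

theorem exists_lowestAtZero : ∃ m, IsSimpleLoop.LowestAtZero (fun j => J.vertexSeq (j + m)) J.size := by
  have : Nonempty (Fin J.size) := ⟨⟨0, J.size_pos⟩⟩
  -- Minimising height first and then the real part: among vertices of equal height all others lie
  -- to the right, which rules out the argument `π`.
  obtain ⟨m, hm⟩ := Finite.exists_min (fun i : Fin J.size =>
    toLex ((ofComplex.symm (J.toPolygon.vertices i)).im, (ofComplex.symm (J.toPolygon.vertices i)).re))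
  refine ⟨m, fun j h0 hj => ?_⟩
  have hne := (J.isSimpleLoop_vertexSeq.shift m).ne (i := 0) h0 (by omega)
  have hmm : (⟨(0 + m) % J.size, Nat.mod_lt _ J.size_pos⟩ : Fin J.size) = m := by
    ext; simp [Nat.mod_eq_of_lt m.2]
  have h1 := hm ⟨(j + m) % J.size, Nat.mod_lt _ J.size_pos⟩
  have h2 : J.vertexSeq (0 + m) = ofComplex.symm (J.toPolygon.vertices m) := by
    rw [vertexSeq, hmm]
  simp only [← h2] at h1
  change toLex ((J.vertexSeq (0 + m)).im, (J.vertexSeq (0 + m)).re) ≤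
    toLex ((J.vertexSeq (j + m)).im, (J.vertexSeq (j + m)).re) at h1
  rw [Prod.Lex.toLex_le_toLex] at h1
  simp only at h1
  constructor
  · rw [arg_nonneg_iff, sub_im]
    rcases h1 with h1 | h1 <;> linarith
  · refine lt_of_le_of_ne (arg_le_pi _) fun h => ?_
    rw [arg_eq_pi_iff, sub_re, sub_im] at h
    rcases h1 with h1 | h1 <;> linarith

theorem ofComplex_image_loopSet (m : ℕ) :
    ofComplex '' loopSet (fun j => J.vertexSeq (j + m)) = J.curve := by
  ext x
  obtain ⟨z, rfl⟩ := ofComplex.surjective x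
  rw [ofComplex.injective.mem_set_image]
  constructor
  · intro h
    obtain ⟨j, hj⟩ := Set.mem_iUnion.1 h
    simp only [add_right_comm _ 1 m] at hj
    rw [mem_segment_vertexSeq] at hj
    exact Set.mem_iUnion_of_mem _ hj
  · intro h
    obtain ⟨i, hi⟩ := Set.mem_iUnion.1 h
    have hm : m ≤ m * J.size := Nat.le_mul_of_pos_right _ J.size_pos
    refine Set.mem_iUnion_of_mem (i + m * J.size - m) ?_
    have e : (i : ℕ) + m * J.size - m + m = i + m * J.size := by omega
    simp only [add_right_comm _ 1 m]
    rw [mem_segment_vertexSeq]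
    simp only [e]
    convert hi
    simp [Nat.mod_eq_of_lt i.2]

/-- The interior angles of a simple polygon: directions in `(a i, b i)` lead from the `i`-th vertex
to the inside, the opposite ones to the outside, and the angles add up to `(n - 2) π`. -/
theorem exists_angles : ∃ a b : Fin J.size → ℝ, (∀ i, a i < b i ∧ b i < a i + 2 * π) ∧
    ∑ i, (b i - a i) = π * (J.size - 2) ∧
    ∀ i, ∃ ρ > (0 : ℝ), ∀ r : ℝ, 0 < r → r < ρ →
      (∀ θ ∈ Set.Ioo (a i) (b i),
        J.toPolygon.vertices i + r • EuclideanPolygon.unitVector θ ∈ J.inside) ∧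
      (∀ θ ∈ Set.Ioo (b i) (a i + 2 * π),
        J.toPolygon.vertices i + r • EuclideanPolygon.unitVector θ ∉ J.curve ∪ J.inside) := by
  obtain ⟨m, hl⟩ := J.exists_lowestAtZero
  have h := J.isSimpleLoop_vertexSeq.shift m
  set v := fun j => J.vertexSeq (j + m) with hv
  have hcurve := J.ofComplex_image_loopSet m
  rw [← hv] at hcurve
  have hins : ∀ z, ofComplex z ∈ J.inside ↔ z ∈ enclosed (loopSet v) := fun z => by
    rw [inside_eq_enclosed, ← hcurve, mem_enclosed_image_iff]
  have hcur : ∀ z, ofComplex z ∈ J.curve ↔ z ∈ loopSet v := fun z => by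
    rw [← hcurve, ofComplex.injective.mem_set_image]
  -- The sectors with index `k` sit at `v (k + 1)`, and `v` is shifted by `m` so that it starts at
  -- the lowest vertex; `σ` undoes both shifts.
  let σ : Fin J.size → Fin J.size := fun k => ⟨(k + 1 + m) % J.size, Nat.mod_lt _ J.size_pos⟩
  have hσ : Function.Injective σ := by
    intro k l hkl
    by_contra hne
    have hkl' := Fin.mk.inj_iff.1 hkl
    rcases lt_or_gt_of_ne (fun h => hne (Fin.ext h) : (k : ℕ) ≠ l) with hlt | hlt
    · exact mod_ne_mod (by omega) (by have := l.2; omega) hkl'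
    · exact mod_ne_mod (by omega) (by have := k.2; omega) hkl'.symm
  let τ : Fin J.size ≃ Fin J.size := Equiv.ofBijective σ (Finite.injective_iff_bijective.1 hσ)
  have hvert : ∀ k : Fin J.size, J.toPolygon.vertices (τ k) = ofComplex (v (k + 1)) := fun k => by
    simp only [hv, vertexSeq, LinearIsometryEquiv.apply_symm_apply]
    rfl
  have key : ∀ a b : ℕ → ℝ, (∀ k, a k < b k ∧ b k < a k + 2 * π) →
      ∑ k ∈ range J.size, (b k - a k) = π * (J.size - 2) →
      (∀ k, SectorIn (enclosed (loopSet v)) (v (k + 1)) (Set.Ioo (a k) (b k)) ∧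
        SectorIn (loopSet v ∪ enclosed (loopSet v))ᶜ (v (k + 1)) (Set.Ioo (b k) (a k + 2 * π))) →
      ∃ a b : Fin J.size → ℝ, (∀ i, a i < b i ∧ b i < a i + 2 * π) ∧
      ∑ i, (b i - a i) = π * (J.size - 2) ∧
      ∀ i, ∃ ρ > (0 : ℝ), ∀ r : ℝ, 0 < r → r < ρ →
        (∀ θ ∈ Set.Ioo (a i) (b i),
          J.toPolygon.vertices i + r • EuclideanPolygon.unitVector θ ∈ J.inside) ∧
        (∀ θ ∈ Set.Ioo (b i) (a i + 2 * π),
          J.toPolygon.vertices i + r • EuclideanPolygon.unitVector θ ∉ J.curve ∪ J.inside) := by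
    intro a b hab hsum hsec
    refine ⟨fun i => a (τ.symm i), fun i => b (τ.symm i), fun i => hab _, ?_, fun i => ?_⟩
    · rw [← hsum, ← Fin.sum_univ_eq_sum_range (fun k => b k - a k)]
      exact Equiv.sum_comp τ.symm (fun k : Fin J.size => b k - a k)
    · obtain ⟨k, rfl⟩ := τ.surjective i
      obtain ⟨⟨ρ₁, hρ₁, H₁⟩, ⟨ρ₂, hρ₂, H₂⟩⟩ := hsec k
      simp only [Equiv.symm_apply_apply]
      refine ⟨min ρ₁ ρ₂, lt_min hρ₁ hρ₂, fun r hr hr' => ⟨fun θ hθ => ?_, fun θ hθ => ?_⟩⟩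
      · rw [hvert, ← ofComplex_circleMap, hins]
        exact H₁ r hr (hr'.trans_le (min_le_left _ _)) θ hθ
      · rw [hvert, ← ofComplex_circleMap, Set.mem_union, hins, hcur]
        exact H₂ r hr (hr'.trans_le (min_le_right _ _)) θ hθ
  rcases h.sectorIn_enclosed hl with ⟨hsum, hsec⟩ | ⟨hsum, hsec⟩
  · refine key (fun k => edgeArg v (k + 1))
      (fun k => edgeArg v (k + 1) + IsSimpleLoop.leftAngle v k) (fun k => ?_) ?_ hsec
    · have := h.leftAngle_mem k
      constructor <;> linarith [this.1, this.2]
    · simp only [add_sub_cancel_left, IsSimpleLoop.leftAngle, sum_sub_distrib, hsum, sum_const,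
        card_range, nsmul_eq_mul]
      ring
  -- For a clockwise curve the inside is on the right, with angle `2π - leftAngle = π + turn`; since
  -- the turns add up to `-2π`, the sum is again `π (n - 2)`. The outer sector is the left one
  -- shifted by `2π`.
  · refine key (fun k => edgeArg v (k + 1) + IsSimpleLoop.leftAngle v k)
      (fun k => edgeArg v (k + 1) + 2 * π) (fun k => ?_) ?_ fun k => ⟨(hsec k).1, ?_⟩
    · have := h.leftAngle_mem k
      constructor <;> linarith [this.1, this.2]
    · simp only [add_sub_add_left_eq_sub, IsSimpleLoop.leftAngle, sum_sub_distrib, hsum, sum_const,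
        card_range, nsmul_eq_mul]
      ring
    · obtain ⟨ρ, hρ, H⟩ := (hsec k).2
      refine ⟨ρ, hρ, fun r hr hr' φ hφ => ?_⟩
      have := H r hr hr' (φ - 2 * π) (by
        simp only [IsSimpleLoop.leftSector]
        constructor <;> linarith [hφ.1, hφ.2])
      rwa [(periodic_circleMap _ _).sub_eq] at this

end SimplePolygon

end PolygonalBilliard

/-! ### The domain with obstacles and the sum of its angles. -/

namespace PolygonalBilliard

open Finset

section Enclosed

variable {E : Type*} [NormedAddCommGroup E] [NormedSpace ℝ E] {K : Set E}

theorem isOpen_enclosed (hK : IsClosed K) : IsOpen (enclosed K) := by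
  refine Metric.isOpen_iff.2 fun x hx => ?_
  obtain ⟨ε, hε, hball⟩ := Metric.isOpen_iff.1 hK.isOpen_compl x hx.1
  exact ⟨ε, hε, subset_enclosed hball (convex_ball x ε).isPreconnected (Metric.mem_ball_self hε) hx⟩

theorem isClosed_union_enclosed (hK : IsClosed K) : IsClosed (K ∪ enclosed K) := by
  refine isOpen_compl_iff.1 (Metric.isOpen_iff.2 fun x hx => ?_)
  rw [Set.mem_compl_iff, Set.mem_union, not_or] at hx
  obtain ⟨ε, hε, hball⟩ := Metric.isOpen_iff.1 hK.isOpen_compl x hx.1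
  refine ⟨ε, hε, fun y hy => ?_⟩
  rintro (h | h)
  · exact hball hy h
  · exact hx.2 (subset_enclosed hball (convex_ball x ε).isPreconnected hy h
      (Metric.mem_ball_self hε))

/-- From a point beyond a ball that contains `K`, the radial ray escapes to infinity without meeting
`K`. -/
theorem isBounded_enclosed (hK : Bornology.IsBounded K) : Bornology.IsBounded (enclosed K) := by
  obtain ⟨M, hM⟩ := isBounded_iff_forall_norm_le.1 hK
  refine isBounded_iff_forall_norm_le.2 ⟨|M|, fun x hx => ?_⟩
  by_contra! hlt
  have hx0 : 0 < ‖x‖ := (abs_nonneg M).trans_lt hlt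
  have hb := hx.2 ((fun t : ℝ => t • x) '' Set.Ici 1) (by
    rintro _ ⟨t, ht, rfl⟩ hm
    have h1 := hM _ hm
    have ht1 : (1 : ℝ) ≤ t := ht
    simp only [norm_smul, Real.norm_of_nonneg (zero_le_one.trans ht1)] at h1
    have h2 := le_mul_of_one_le_left hx0.le ht1
    linarith [le_abs_self M]) ((convex_Ici 1).isPreconnected.image _ (by fun_prop))
    ⟨1, by simp, one_smul ℝ x⟩
  obtain ⟨M', hM'⟩ := isBounded_iff_forall_norm_le.1 hb
  have := hM' _ ⟨1 + |M'| / ‖x‖, by simp only [Set.mem_Ici]; linarith [show 0 ≤ |M'| / ‖x‖ by positivity], rfl⟩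
  have h0 : (0 : ℝ) ≤ 1 + |M'| / ‖x‖ := by positivity
  simp only [norm_smul, Real.norm_of_nonneg h0] at this
  rw [add_mul, one_mul, div_mul_cancel₀ _ hx0.ne'] at this
  linarith [le_abs_self M']

end Enclosed

namespace SimplePolygon

variable (J : SimplePolygon)

theorem isCompact_curve : IsCompact J.curve :=
  isCompact_iUnion fun i => by rw [edgeSet_eq]; exact isCompact_segment _ _

theorem vertices_mem_curve (i : Fin J.size) : J.toPolygon.vertices i ∈ J.curve :=
  Set.mem_iUnion_of_mem i (by rw [edgeSet_eq]; exact left_mem_segment ℝ _ _)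

theorem isPreconnected_curve : IsPreconnected J.curve := by
  rw [← J.ofComplex_image_loopSet 0]
  refine IsPreconnected.image ?_ _ ofComplex.continuous.continuousOn
  exact IsPreconnected.iUnion_of_chain (fun i => (convex_segment _ _).isPreconnected)
    fun i => ⟨_, right_mem_segment ℝ _ _, left_mem_segment ℝ _ _⟩

theorem isOpen_inside : IsOpen J.inside := by
  rw [inside_eq_enclosed]; exact isOpen_enclosed J.isCompact_curve.isClosed

theorem isClosed_union_inside : IsClosed (J.curve ∪ J.inside) := by
  rw [inside_eq_enclosed]; exact isClosed_union_enclosed J.isCompact_curve.isClosed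

theorem isBounded_inside : Bornology.IsBounded J.inside := by
  rw [inside_eq_enclosed]; exact isBounded_enclosed J.isCompact_curve.isBounded

theorem subset_inside {S : Set Plane} (hS : S ⊆ J.curveᶜ) (hc : IsPreconnected S) {x : Plane}
    (hx : x ∈ S) (h : x ∈ J.inside) : S ⊆ J.inside := by
  rw [inside_eq_enclosed] at *; exact subset_enclosed hS hc hx h

/-- A point outside lies in an unbounded connected set outside. -/
theorem exists_unbounded {x : Plane} (hx : x ∉ J.curve ∪ J.inside) : ∃ S, IsPreconnected S ∧
    ¬ Bornology.IsBounded S ∧ x ∈ S ∧ Disjoint S (J.curve ∪ J.inside) := by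
  rw [Set.mem_union, not_or] at hx
  have h := hx.2
  rw [inside_eq_enclosed] at h
  simp only [enclosed, Set.mem_ofPred_eq, hx.1, not_false_eq_true, true_and, not_forall] at h
  obtain ⟨S, hS, hc, hxS, hb⟩ := h
  refine ⟨S, hc, hb, hxS, Set.disjoint_left.2 fun y hy hm => ?_⟩
  rcases hm with hm | hm
  · exact hS hy hm
  · exact hx.2 (J.subset_inside hS hc hy hm hxS)

/-- The curve lies in an unbounded connected set that avoids the inside. -/
theorem exists_unbounded_curve : ∃ S, IsPreconnected S ∧
    ¬ Bornology.IsBounded S ∧ J.curve ⊆ S ∧ Disjoint S J.inside := by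
  obtain ⟨a, b, hab, -, H⟩ := J.exists_angles
  obtain ⟨ρ, hρ, H⟩ := H ⟨0, J.size_pos⟩
  set i : Fin J.size := ⟨0, J.size_pos⟩
  obtain ⟨θ, hθ⟩ := exists_between (hab i).2
  set u := EuclideanPolygon.unitVector θ
  -- The curve is left along an outward direction at one vertex, and from the point reached there an
  -- outer set leads to infinity.
  obtain ⟨S, hc, hb, hxS, hd⟩ := J.exists_unbounded ((H (ρ / 2) (by linarith) (by linarith)).2 θ hθ)
  set T := (fun r : ℝ => J.toPolygon.vertices i + r • u) '' Set.Icc 0 (ρ / 2)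
  have hT : IsPreconnected T := (convex_Icc _ _).isPreconnected.image _ (by fun_prop)
  refine ⟨J.curve ∪ (T ∪ S), ?_, fun h => hb (h.subset ?_), Set.subset_union_left, ?_⟩
  · refine J.isPreconnected_curve.union (J.toPolygon.vertices i) (J.vertices_mem_curve i)
      (Or.inl ⟨0, ⟨le_rfl, by linarith⟩, by simp⟩) ?_
    exact hT.union _ ⟨ρ / 2, ⟨by linarith, le_rfl⟩, rfl⟩ hxS hc
  · exact fun x hx => Or.inr (Or.inr hx)
  · have hci : Disjoint J.curve J.inside := Set.disjoint_left.2 fun x hx hm => hm.1 hx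
    refine Set.disjoint_union_left.2 ⟨hci, Set.disjoint_union_left.2 ⟨?_, ?_⟩⟩
    · rw [Set.disjoint_left]
      rintro _ ⟨r, ⟨hr, hr'⟩, rfl⟩ hm
      rcases hr.eq_or_lt with rfl | hr
      · exact hm.1 (by simpa using J.vertices_mem_curve i)
      · exact (H r hr (by linarith)).2 θ hθ (Or.inr hm)
    · exact hd.mono_right Set.subset_union_right

/-- A point not inside `J` is connected to infinity by a set that avoids the inside of `J`, hence
avoids `J'`; such a point is not enclosed by `J'`. -/
theorem inside_subset_inside {J' : SimplePolygon} (h : J'.curve ⊆ J.inside) :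
    J'.inside ⊆ J.inside := by
  intro y hy
  rw [inside_eq_enclosed] at hy
  by_contra hcon
  by_cases hyc : y ∈ J.curve
  · obtain ⟨S, hc, hb, hS, hd⟩ := J.exists_unbounded_curve
    exact hb (hy.2 S (fun x hx hm => Set.disjoint_left.1 hd hx (h hm)) hc (hS hyc))
  · obtain ⟨S, hc, hb, hyS, hd⟩ := J.exists_unbounded (x := y) (by rintro (hm | hm) <;> tauto)
    exact hb (hy.2 S (fun x hx hm => Set.disjoint_left.1 hd hx (Or.inr (h hm))) hc hyS)

end SimplePolygon

namespace EuclideanPolygon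

variable (P : EuclideanPolygon)

/-- The open domain. -/
def region : Set Plane := P.carrier \ P.bdry

theorem mem_region_iff {x : Plane} : x ∈ P.region ↔
    x ∈ P.outer.inside ∧ ∀ i, x ∉ (P.obstacle i).curve ∪ (P.obstacle i).inside := by
  simp only [region, carrier, bdry, Set.mem_sdiff, Set.mem_union, Set.mem_iUnion, not_exists, not_or]
  constructor
  · rintro ⟨⟨h1, h2⟩, h3⟩
    exact ⟨h1.resolve_left (h3 none), fun i => ⟨h3 (some i), h2 i⟩⟩
  · rintro ⟨h1, h2⟩
    refine ⟨⟨Or.inr h1, fun i => (h2 i).2⟩, ?_⟩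
    rintro (_ | i)
    · exact h1.1
    · exact (h2 i).1

theorem isCompact_bdry : IsCompact P.bdry := isCompact_iUnion fun c => (P.component c).isCompact_curve

theorem isOpen_region : IsOpen P.region := by
  have : P.region = P.outer.inside ∩ (⋃ i, ((P.obstacle i).curve ∪ (P.obstacle i).inside))ᶜ := by
    ext x
    rw [mem_region_iff, Set.mem_inter_iff, Set.mem_compl_iff, Set.mem_iUnion, not_exists]
  rw [this]
  exact P.outer.isOpen_inside.inter
    (isClosed_iUnion_of_finite fun i => (P.obstacle i).isClosed_union_inside).isOpen_compl

theorem isBounded_region : Bornology.IsBounded P.region :=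
  P.outer.isBounded_inside.subset fun _ hx => (P.mem_region_iff.1 hx).1

/-- Each boundary curve separately keeps `S` on one side. This is how paths are recognised as
staying in the domain. -/
theorem subset_region {S : Set Plane} (hS : S ⊆ P.bdryᶜ) (hc : IsPreconnected S) {x : Plane}
    (hx : x ∈ S) (h : x ∈ P.region) : S ⊆ P.region := by
  have hS' : ∀ c, S ⊆ (P.component c).curveᶜ := fun c y hy hm =>
    hS hy (Set.mem_iUnion_of_mem c hm)
  rw [mem_region_iff] at h
  intro y hy
  rw [mem_region_iff]
  refine ⟨P.outer.subset_inside (hS' none) hc hx h.1 hy, fun i => ?_⟩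
  rintro (hm | hm)
  · exact hS' (some i) hy hm
  · exact h.2 i (Or.inr ((P.obstacle i).subset_inside (hS' (some i)) hc hy hm hx))

/-- The index type of the corners, and of the sides. -/
abbrev Corner : Type := Σ c : Option (Fin P.numObstacles), Fin (P.component c).size

/-- The corner with a given index. -/
def cornerPoint (s : P.Corner) : Plane := (P.component s.1).toPolygon.vertices s.2

theorem cornerPoint_mem_curve (s : P.Corner) : P.cornerPoint s ∈ (P.component s.1).curve :=
  (P.component s.1).vertices_mem_curve s.2

theorem cornerPoint_mem_bdry (s : P.Corner) : P.cornerPoint s ∈ P.bdry :=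
  Set.mem_iUnion_of_mem s.1 (P.cornerPoint_mem_curve s)

theorem disjoint_curve {c c' : Option (Fin P.numObstacles)} (h : c ≠ c') :
    Disjoint (P.component c).curve (P.component c').curve := by
  rw [Set.disjoint_left]
  intro x hx hx'
  rcases c with _ | c <;> rcases c' with _ | c'
  · exact h rfl
  · exact (P.obstacle_subset c' hx').1 hx
  · exact (P.obstacle_subset c hx).1 hx'
  · exact Set.disjoint_left.1 (P.obstacle_disjoint c c' (by simpa using h)) hx (Or.inl hx')

theorem cornerPoint_injective : Function.Injective P.cornerPoint := by
  rintro ⟨c, i⟩ ⟨c', j⟩ h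
  have hc : c = c' := by
    by_contra hne
    refine Set.disjoint_left.1 (P.disjoint_curve hne) (P.cornerPoint_mem_curve ⟨c, i⟩) ?_
    rw [h]
    exact P.cornerPoint_mem_curve ⟨c', j⟩
  subst hc
  exact congrArg (Sigma.mk c) ((P.component c).injective_vertices h)

theorem corners_eq_range : P.corners = Set.range P.cornerPoint := by
  ext x
  simp only [corners, Set.mem_iUnion, Set.mem_range, Sigma.exists]
  rfl

/-- `κ` is split into one term per boundary curve, matching the interior angle sum of the outer
curve and the exterior angle sums of the obstacles. -/
theorem kappa_eq : (P.kappa : ℝ) = ((P.outer.size : ℝ) - 2) +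
    ∑ i, ((P.obstacle i).size + 2 : ℝ) := by
  have h : P.corners.ncard = P.outer.size + ∑ i, (P.obstacle i).size := by
    rw [corners_eq_range, ← Nat.card_coe_set_eq, Nat.card_range_of_injective P.cornerPoint_injective,
      Nat.card_eq_fintype_card, Fintype.card_sigma, Fintype.sum_option]
    simp only [Fintype.card_fin]
    rfl
  rw [kappa, h]
  push_cast
  rw [sum_add_distrib]
  simp
  ring

/-- The angles of the domain at its corners: directions in `(a s, b s)` lead from the corner `s`
into the domain, the opposite ones out of it, and the angles add up to `π κ`. -/
theorem exists_angles : ∃ a b : P.Corner → ℝ, (∀ s, a s < b s ∧ b s < a s + 2 * π) ∧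
    ∑ s, (b s - a s) = π * P.kappa ∧
    ∀ s, ∃ ρ > (0 : ℝ), ∀ r : ℝ, 0 < r → r < ρ →
      (∀ θ ∈ Set.Ioo (a s) (b s), P.cornerPoint s + r • unitVector θ ∈ P.region) ∧
      (∀ θ ∈ Set.Ioo (b s) (a s + 2 * π), P.cornerPoint s + r • unitVector θ ∉ P.region) := by
  choose a b hab hsum H using SimplePolygon.exists_angles
  have hnear : ∀ {x : Plane} {U : Set Plane}, IsOpen U → x ∈ U → ∃ ρ > (0 : ℝ), ∀ r : ℝ, 0 < r →
      r < ρ → ∀ θ, x + r • unitVector θ ∈ U := by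
    intro x U hU hx
    obtain ⟨ε, hε, hball⟩ := Metric.isOpen_iff.1 hU x hx
    refine ⟨ε, hε, fun r hr hr' θ => hball ?_⟩
    have : ‖unitVector θ‖ = 1 := by
      simp [unitVector, EuclideanSpace.norm_eq]
    rw [Metric.mem_ball, dist_eq_norm, add_sub_cancel_left, norm_smul, this, mul_one,
      Real.norm_of_nonneg hr.le]
    exact hr'
  have hper : ∀ θ, unitVector (θ - 2 * π) = unitVector θ := fun θ => by
    simp [unitVector]
  -- At an obstacle corner the domain lies outside the obstacle, so its sector is the complementary
  -- one, from `b` to `a + 2π`.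
  refine ⟨fun s => match s with
      | ⟨none, i⟩ => a P.outer i
      | ⟨some k, i⟩ => b (P.obstacle k) i,
    fun s => match s with
      | ⟨none, i⟩ => b P.outer i
      | ⟨some k, i⟩ => a (P.obstacle k) i + 2 * π, ?_, ?_, ?_⟩
  · rintro ⟨(_ | k), i⟩
    · exact hab P.outer i
    · have := hab (P.obstacle k) i
      constructor <;> simp only <;> linarith [this.1, this.2]
  · rw [Fintype.sum_sigma, Fintype.sum_option, kappa_eq, mul_add, mul_sum]
    congr 1
    · exact hsum P.outer
    · refine sum_congr rfl fun k _ => ?_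
      have h1 := hsum (P.obstacle k)
      have h2 : ∀ i, a (P.obstacle k) i + 2 * π - b (P.obstacle k) i =
        2 * π - (b (P.obstacle k) i - a (P.obstacle k) i) := fun i => by ring
      have h3 : ∑ i : Fin (P.obstacle k).size, (a (P.obstacle k) i + 2 * π - b (P.obstacle k) i) =
          π * ((P.obstacle k).size + 2) := by
        simp only [h2]
        rw [sum_sub_distrib, h1]
        simp
        ring
      exact h3
  · rintro ⟨(_ | k), i⟩
    · obtain ⟨ρ, hρ, H⟩ := H P.outer i
      -- Near a corner of the outer curve only that curve matters, since the closed obstacles stay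
      -- at positive distance.
      obtain ⟨ρ', hρ', H'⟩ := hnear (x := P.outer.toPolygon.vertices i)
        (isClosed_iUnion_of_finite fun k => (P.obstacle k).isClosed_union_inside).isOpen_compl (by
          rw [Set.mem_compl_iff, Set.mem_iUnion, not_exists]
          intro k hm
          have : P.outer.toPolygon.vertices i ∈ P.outer.inside := by
            rcases hm with hm | hm
            · exact P.obstacle_subset k hm
            · exact P.outer.inside_subset_inside (P.obstacle_subset k) hm
          exact this.1 (P.outer.vertices_mem_curve i))
      refine ⟨min ρ ρ', lt_min hρ hρ', fun r hr hr' => ?_⟩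
      rw [lt_min_iff] at hr'
      refine ⟨fun θ hθ => ?_, fun θ hθ hm => ?_⟩
      · rw [mem_region_iff]
        refine ⟨(H r hr hr'.1).1 θ hθ, ?_⟩
        have h' := H' r hr hr'.2 θ
        rw [Set.mem_compl_iff, Set.mem_iUnion, not_exists] at h'
        exact h'
      · exact (H r hr hr'.1).2 θ hθ (Or.inr (P.mem_region_iff.1 hm).1)
    · obtain ⟨ρ, hρ, H⟩ := H (P.obstacle k) i
      -- Near a corner of obstacle `k`, points stay inside the outer curve and away from all other
      -- obstacles.
      obtain ⟨ρ', hρ', H'⟩ := hnear (x := (P.obstacle k).toPolygon.vertices i)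
        (P.outer.isOpen_inside.inter (isClosed_iUnion_of_finite fun l : {l // l ≠ k} =>
          (P.obstacle l).isClosed_union_inside).isOpen_compl) (by
          refine ⟨P.obstacle_subset k ((P.obstacle k).vertices_mem_curve i), ?_⟩
          rw [Set.mem_compl_iff, Set.mem_iUnion, not_exists]
          rintro ⟨l, hl⟩ hm
          exact Set.disjoint_left.1 (P.obstacle_disjoint k l hl.symm)
            ((P.obstacle k).vertices_mem_curve i) hm)
      refine ⟨min ρ ρ', lt_min hρ hρ', fun r hr hr' => ?_⟩
      rw [lt_min_iff] at hr'
      refine ⟨fun θ hθ => ?_, fun θ hθ hm => ?_⟩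
      · rw [mem_region_iff]
        have h' := H' r hr hr'.2 θ
        refine ⟨h'.1, fun l => ?_⟩
        by_cases hl : l = k
        · subst hl
          exact (H r hr hr'.1).2 θ hθ
        · have := h'.2
          rw [Set.mem_compl_iff, Set.mem_iUnion, not_exists] at this
          exact this ⟨l, hl⟩
      · simp only at hθ
        have := (H r hr hr'.1).1 (θ - 2 * π) ⟨by linarith [hθ.1], by linarith [hθ.2]⟩
        rw [hper] at this
        exact (P.mem_region_iff.1 hm).2 k (Or.inr this)

end EuclideanPolygon

end PolygonalBilliard

/-! ### Sides, phase points and the inverse of the billiard map. -/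

namespace PolygonalBilliard

open Finset

namespace EuclideanPolygon

theorem ofComplex_exp (θ : ℝ) : ofComplex (Complex.exp (θ * Complex.I)) = unitVector θ := by
  have := ofComplex_circleMap 0 1 θ
  simpa [circleMap] using this

theorem norm_unitVector (θ : ℝ) : ‖unitVector θ‖ = 1 := by
  rw [← ofComplex_exp, LinearIsometryEquiv.norm_map, Complex.norm_exp_ofReal_mul_I]

theorem unitVector_add_two_pi (θ : ℝ) : unitVector (θ + 2 * π) = unitVector θ := by
  simp [unitVector]

theorem unitVector_add_pi (θ : ℝ) : unitVector (θ + π) = -unitVector θ := by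
  ext i
  fin_cases i <;> simp [unitVector]

theorem continuous_unitVector : Continuous unitVector := by
  have : unitVector = fun θ : ℝ => ofComplex (Complex.exp (θ * Complex.I)) :=
    funext fun θ => (ofComplex_exp θ).symm
  rw [this]
  fun_prop

theorem inner_unitVector (α β : ℝ) : inner ℝ (unitVector α) (unitVector β) = Real.cos (α - β) := by
  simp [unitVector, PiLp.inner_apply, Fin.sum_univ_two, Real.cos_sub]
  ring

theorem exists_eq_smul_unitVector (w : Plane) : ∃ θ, w = ‖w‖ • unitVector θ := by
  refine ⟨Complex.arg (ofComplex.symm w), ?_⟩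
  rw [← ofComplex_exp, ← map_smul, ← ofComplex.symm.norm_map w, Complex.real_smul,
    Complex.norm_mul_exp_arg_mul_I, LinearIsometryEquiv.apply_symm_apply]

theorem smul_unitVector_inj {s t α β : ℝ} (hs : 0 < s) (ht : 0 < t)
    (h : s • unitVector α = t • unitVector β) : ∃ n : ℤ, α = β + n * (2 * π) := by
  refine circleMap_eq_circleMap (c := 0) hs ht.le (ofComplex.injective ?_)
  rw [ofComplex_circleMap, ofComplex_circleMap, h]

/-- In terms of the angle, reflection is `θ ↦ 2 ω - θ`, which preserves Lebesgue measure on the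
circle; this is the only metric property of the billiard map that the integral needs. -/
theorem reflection_unitVector {d : Plane} {ω : ℝ} (hd : d ≠ 0) (h : d = ‖d‖ • unitVector ω)
    (θ : ℝ) : (ℝ ∙ d).reflection (unitVector θ) = unitVector (2 * ω - θ) := by
  have hspan : (ℝ ∙ d) = (ℝ ∙ unitVector ω) := by
    rw [h]
    exact Submodule.span_singleton_smul_eq (IsUnit.mk0 _ (norm_ne_zero_iff.2 hd)) _
  have key : (ℝ ∙ unitVector ω).reflection (unitVector θ) = unitVector (2 * ω - θ) := by
    obtain ⟨δ, rfl⟩ : ∃ δ, θ = ω - δ := ⟨ω - θ, by ring⟩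
    rw [Submodule.reflection_singleton_apply, inner_unitVector, norm_unitVector, sub_sub_cancel,
      show 2 * ω - (ω - δ) = ω + δ by ring]
    ext i
    fin_cases i
    · simp [unitVector, Real.cos_add, Real.cos_sub]
      ring
    · simp [unitVector, Real.sin_add, Real.sin_sub]
      ring
  simpa only [hspan] using key

variable (P : EuclideanPolygon)

/-- The second end point of a side. -/
def sideEnd (s : P.Corner) : Plane := (P.component s.1).toPolygon.vertices (finRotate _ s.2)

/-- The side with a given index, without its end points. -/
def openSide (s : P.Corner) : Set Plane := openSegment ℝ (P.cornerPoint s) (P.sideEnd s)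

theorem sideEnd_eq (s : P.Corner) : P.sideEnd s = P.cornerPoint ⟨s.1, finRotate _ s.2⟩ := rfl

theorem cornerPoint_ne_sideEnd (s : P.Corner) : P.cornerPoint s ≠ P.sideEnd s := by
  rw [sideEnd_eq]
  intro h
  obtain ⟨c, i⟩ := s
  have h1 := P.cornerPoint_injective h
  simp only [Sigma.mk.injEq, heq_eq_eq, true_and] at h1
  have h3 := (P.component c).three_le_size
  have hi : i = ⟨i % (P.component c).size, Nat.mod_lt _ (P.component c).size_pos⟩ := by
    ext; simp [Nat.mod_eq_of_lt i.2]
  rw [hi, SimplePolygon.finRotate_mod (P.component c).size_pos] at h1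
  exact mod_ne_mod (Nat.lt_succ_self _) (by omega) (Fin.mk.inj_iff.1 h1)

theorem segment_subset_bdry (s : P.Corner) : segment ℝ (P.cornerPoint s) (P.sideEnd s) ⊆ P.bdry := by
  intro x hx
  refine Set.mem_iUnion_of_mem s.1 (Set.mem_iUnion_of_mem s.2 ?_)
  rw [SimplePolygon.edgeSet_eq]
  exact hx

theorem mem_bdry_iff {x : Plane} :
    x ∈ P.bdry ↔ ∃ s, x ∈ segment ℝ (P.cornerPoint s) (P.sideEnd s) := by
  refine ⟨fun h => ?_, fun ⟨s, hs⟩ => P.segment_subset_bdry s hs⟩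
  obtain ⟨c, hc⟩ := Set.mem_iUnion.1 h
  obtain ⟨i, hi⟩ := Set.mem_iUnion.1 hc
  rw [SimplePolygon.edgeSet_eq] at hi
  exact ⟨⟨c, i⟩, hi⟩

theorem mem_corners_or_openSide {x : Plane} (h : x ∈ P.bdry) :
    x ∈ P.corners ∨ ∃ s, x ∈ P.openSide s := by
  obtain ⟨s, hs⟩ := P.mem_bdry_iff.1 h
  rw [corners_eq_range]
  by_cases h1 : P.cornerPoint s = x
  · exact Or.inl ⟨s, h1⟩
  by_cases h2 : P.sideEnd s = x
  · exact Or.inl ⟨⟨s.1, finRotate _ s.2⟩, h2⟩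
  · exact Or.inr ⟨s, mem_openSegment_of_ne_left_right h1 h2 hs⟩

theorem openSide_disjoint {s t : P.Corner} (h : s ≠ t) : Disjoint (P.openSide s) (P.openSide t) := by
  rw [Set.disjoint_left]
  intro x hs ht
  exact h (P.side_unique x hs ht)

/-- A point of an open side lies on no other closed side. -/
theorem eq_of_mem_openSide_of_mem_segment {s t : P.Corner} {x : Plane} (hs : x ∈ P.openSide s)
    (ht : x ∈ segment ℝ (P.cornerPoint t) (P.sideEnd t)) : s = t := by
  obtain ⟨c, i⟩ := s
  obtain ⟨c', j⟩ := t
  have h1 : x ∈ (P.component c).toPolygon.edgeSet ℝ i := by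
    rw [SimplePolygon.edgeSet_eq]; exact openSegment_subset_segment ℝ _ _ hs
  have h2 : x ∈ (P.component c').toPolygon.edgeSet ℝ j := by
    rw [SimplePolygon.edgeSet_eq]; exact ht
  have hc : c = c' := by
    by_contra hne
    exact Set.disjoint_left.1 (P.disjoint_curve hne) (Set.mem_iUnion_of_mem i h1)
      (Set.mem_iUnion_of_mem j h2)
  subst hc
  by_contra hne
  have hij : i ≠ j := by rintro rfl; exact hne rfl
  have hn := P.cornerPoint_ne_sideEnd ⟨c, i⟩
  rcases (P.component c).edges_meet i j hij x ⟨h1, h2⟩ with ⟨rfl, h⟩ | ⟨-, h⟩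
  · have : x = P.sideEnd ⟨c, i⟩ := h
    rw [this] at hs
    exact hn (right_mem_openSegment_iff.1 hs)
  · have : x = P.cornerPoint ⟨c, i⟩ := h
    rw [this] at hs
    exact hn (left_mem_openSegment_iff.1 hs)

theorem openSide_disjoint_corners (s : P.Corner) : Disjoint (P.openSide s) P.corners := by
  rw [Set.disjoint_left]
  intro x hx hc
  rw [corners_eq_range] at hc
  obtain ⟨t, rfl⟩ := hc
  have h1 := P.eq_of_mem_openSide_of_mem_segment hx (left_mem_segment ℝ _ _)
  subst h1
  exact P.cornerPoint_ne_sideEnd s (left_mem_openSegment_iff.1 hx)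

theorem finite_corners : P.corners.Finite := by
  rw [corners_eq_range]; exact Set.finite_range _

/-- The direction angle of a side. -/
noncomputable def sideArg (s : P.Corner) : ℝ :=
  (exists_eq_smul_unitVector (P.sideEnd s - P.cornerPoint s)).choose

theorem sideEnd_sub (s : P.Corner) : P.sideEnd s - P.cornerPoint s =
    ‖P.sideEnd s - P.cornerPoint s‖ • unitVector (P.sideArg s) :=
  (exists_eq_smul_unitVector (P.sideEnd s - P.cornerPoint s)).choose_spec

theorem reflection_side (s : P.Corner) (θ : ℝ) :
    (ℝ ∙ (P.sideEnd s - P.cornerPoint s)).reflection (unitVector θ) =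
      unitVector (2 * P.sideArg s - θ) :=
  reflection_unitVector (sub_ne_zero.2 (P.cornerPoint_ne_sideEnd s).symm) (P.sideEnd_sub s) θ

/-- The unit normal of a side. -/
noncomputable def sideNormal (s : P.Corner) : Plane := unitVector (P.sideArg s + π / 2)

theorem inner_sideNormal (s : P.Corner) (θ : ℝ) :
    inner ℝ (unitVector θ) (P.sideNormal s) = Real.sin (θ - P.sideArg s) := by
  rw [sideNormal, inner_unitVector, ← sub_sub, Real.cos_sub_pi_div_two]

theorem inner_sub_sideNormal {s : P.Corner} {x y : Plane}
    (hx : x ∈ segment ℝ (P.cornerPoint s) (P.sideEnd s))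
    (hy : y ∈ segment ℝ (P.cornerPoint s) (P.sideEnd s)) :
    inner ℝ (x - y) (P.sideNormal s) = 0 := by
  rw [segment_eq_image'] at hx hy
  obtain ⟨a, -, rfl⟩ := hx
  obtain ⟨b, -, rfl⟩ := hy
  simp only
  rw [add_sub_add_left_eq_sub, ← sub_smul, P.sideEnd_sub, smul_smul, inner_smul_left,
    inner_sideNormal]
  simp

namespace PhasePoint

variable {P}

/-- The length of the segment. -/
noncomputable def length (x : P.PhasePoint) : ℝ := ‖x.target - x.source‖

theorem length_pos (x : P.PhasePoint) : 0 < x.length :=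
  norm_pos_iff.2 (sub_ne_zero.2 x.source_ne_target.symm)

theorem target_eq (x : P.PhasePoint) : x.target = x.source + x.length • x.direction := by
  have := x.length_pos.ne'
  rw [length] at this
  rw [direction, length, smul_smul, mul_inv_cancel₀ this, one_smul]
  abel

theorem source_eq (x : P.PhasePoint) : x.source = x.target - x.length • x.direction := by
  rw [x.target_eq]; abel

theorem norm_direction (x : P.PhasePoint) : ‖x.direction‖ = 1 := by
  have := x.length_pos.ne'
  rw [length] at this
  rw [direction, norm_smul, norm_inv, norm_norm, inv_mul_cancel₀ this]

theorem mem_region (x : P.PhasePoint) {t : ℝ} (h0 : 0 < t) (h1 : t < x.length) :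
    x.source + t • x.direction ∈ P.region := by
  refine x.interior_subset ?_
  rw [openSegment_eq_image']
  refine ⟨t / x.length, ⟨div_pos h0 x.length_pos, (div_lt_one x.length_pos).2 h1⟩, ?_⟩
  simp only [direction]
  rw [smul_smul]
  rfl

theorem mem_region' (x : P.PhasePoint) {t : ℝ} (h0 : 0 < t) (h1 : t < x.length) :
    x.target - t • x.direction ∈ P.region := by
  have := x.mem_region (t := x.length - t) (by linarith) (by linarith)
  rwa [x.target_eq, add_sub_assoc, ← sub_smul]

theorem notMem_bdry (x : P.PhasePoint) {t : ℝ} (h0 : 0 < t) (h1 : t < x.length) :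
    x.source + t • x.direction ∉ P.bdry := (x.mem_region h0 h1).2

theorem notMem_bdry' (x : P.PhasePoint) {t : ℝ} (h0 : 0 < t) (h1 : t < x.length) :
    x.target - t • x.direction ∉ P.bdry := (x.mem_region' h0 h1).2

/-- A phase point is determined by its source and its direction. -/
theorem ext_source {x y : P.PhasePoint} (hs : x.source = y.source)
    (hd : x.direction = y.direction) : x = y := by
  have hl : x.length = y.length := by
    rcases lt_trichotomy x.length y.length with h | h | h
    · exact absurd x.target_mem (by rw [x.target_eq, hs, hd]; exact y.notMem_bdry x.length_pos h)
    · exact h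
    · exact absurd y.target_mem (by rw [y.target_eq, ← hs, ← hd]; exact x.notMem_bdry y.length_pos h)
  exact PhasePoint.ext hs (by rw [x.target_eq, y.target_eq, hs, hd, hl])

/-- A phase point is determined by its target and its direction. -/
theorem ext_target {x y : P.PhasePoint} (hs : x.target = y.target)
    (hd : x.direction = y.direction) : x = y := by
  have hl : x.length = y.length := by
    rcases lt_trichotomy x.length y.length with h | h | h
    · exact absurd x.source_mem (by rw [x.source_eq, hs, hd]; exact y.notMem_bdry' x.length_pos h)
    · exact h
    · exact absurd y.source_mem (by rw [y.source_eq, ← hs, ← hd]; exact x.notMem_bdry' y.length_pos h)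
  exact PhasePoint.ext (by rw [x.source_eq, y.source_eq, hs, hd, hl]) hs

end PhasePoint

/-- From a boundary point at which a direction leads backwards into the domain, one meets the
boundary again. -/
theorem exists_phasePoint {b : Plane} (hb : b ∈ P.bdry) {θ : ℝ}
    (h : ∃ ρ > (0 : ℝ), ∀ r : ℝ, 0 < r → r < ρ → b - r • unitVector θ ∈ P.region) :
    ∃ x : P.PhasePoint, x.target = b ∧ x.direction = unitVector θ := by
  obtain ⟨ρ, hρ, hin⟩ := h
  set H : Set ℝ := {t | 0 < t ∧ b - t • unitVector θ ∉ P.region}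
  -- Going back farther than the diameter of a ball containing the bounded domain allows leaves the
  -- domain.
  have hne : H.Nonempty := by
    by_contra hcon
    obtain ⟨M, hM⟩ := isBounded_iff_forall_norm_le.1 P.isBounded_region
    have hpos : 0 < |M| + ‖b‖ + 1 := by positivity
    have hmem : b - (|M| + ‖b‖ + 1) • unitVector θ ∈ P.region := by
      by_contra hn
      exact hcon ⟨_, hpos, hn⟩
    have h1 := hM _ hmem
    have h2 := norm_sub_norm_le ((|M| + ‖b‖ + 1) • unitVector θ) b
    rw [norm_smul, norm_unitVector, Real.norm_of_nonneg hpos.le, mul_one, norm_sub_rev] at h2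
    linarith [le_abs_self M]
  have hlow : ∀ t ∈ H, ρ ≤ t := fun t ht => by
    by_contra! hlt
    exact ht.2 (hin t ht.1 hlt)
  have hbdd : BddBelow H := ⟨ρ, hlow⟩
  set t := sInf H
  have htρ : ρ ≤ t := le_csInf hne hlow
  have ht : 0 < t := hρ.trans_le htρ
  have hlt : ∀ s, 0 < s → s < t → b - s • unitVector θ ∈ P.region := fun s hs hst => by
    by_contra hn
    exact absurd (csInf_le hbdd ⟨hs, hn⟩) (not_le.2 hst)
  have hcont : Continuous fun s : ℝ => b - s • unitVector θ := by fun_prop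
  -- At the first exit time the point is on the boundary: otherwise a whole piece of the line around
  -- it would avoid the boundary and, being connected to points of the domain, stay in it beyond the
  -- infimum `t`.
  have htb : b - t • unitVector θ ∈ P.bdry := by
    by_contra hn
    obtain ⟨ε, hε, hball⟩ := Metric.isOpen_iff.1
      (P.isCompact_bdry.isClosed.isOpen_compl.preimage hcont) t hn
    have hsub : (fun s : ℝ => b - s • unitVector θ) '' Metric.ball t ε ⊆ P.bdryᶜ := by
      rintro _ ⟨s, hs, rfl⟩
      exact hball hs
    have hpre : IsPreconnected ((fun s : ℝ => b - s • unitVector θ) '' Metric.ball t ε) :=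
      (convex_ball t ε).isPreconnected.image _ hcont.continuousOn
    obtain ⟨s, hs1, hs2⟩ := exists_between (max_lt ht (sub_lt_self t hε))
    rw [max_lt_iff] at hs1
    have hall := P.subset_region hsub hpre ⟨s, by
      rw [Metric.mem_ball, Real.dist_eq, abs_lt]; constructor <;> linarith, rfl⟩ (hlt s hs1.1 hs2)
    obtain ⟨t', ht', htt'⟩ := exists_lt_of_csInf_lt hne (lt_add_of_pos_right t hε)
    refine ht'.2 (hall ⟨t', ?_, rfl⟩)
    rw [Metric.mem_ball, Real.dist_eq, abs_lt]
    constructor <;> linarith [csInf_le hbdd ht']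
  have hu : ‖b - (b - t • unitVector θ)‖ = t := by
    rw [sub_sub_cancel, norm_smul, norm_unitVector, Real.norm_of_nonneg ht.le, mul_one]
  refine ⟨⟨b - t • unitVector θ, b, htb, hb, fun h => ?_, ?_⟩, rfl, ?_⟩
  · rw [h, sub_self, norm_zero] at hu
    exact ht.ne hu
  · rw [openSegment_symm, openSegment_eq_image']
    rintro _ ⟨s, hs, rfl⟩
    have := hlt (s * t) (mul_pos hs.1 ht) (by nlinarith [hs.2])
    have e : b + s • (b - t • unitVector θ - b) = b - (s * t) • unitVector θ := by
      rw [sub_sub_cancel_left, smul_neg, smul_smul, sub_eq_add_neg]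
    simp only [e]
    exact this
  · simp only [PhasePoint.direction]
    rw [hu, sub_sub_cancel, smul_smul, inv_mul_cancel₀ ht.ne', one_smul]

variable {P} in
/-- A segment that starts on an open side is transversal to it. -/
theorem PhasePoint.sin_ne_zero {x : P.PhasePoint} {s : P.Corner} (hs : x.source ∈ P.openSide s)
    {θ : ℝ} (hθ : x.direction = unitVector θ) : Real.sin (θ - P.sideArg s) ≠ 0 := by
  intro h0
  obtain ⟨n, hn⟩ := Real.sin_eq_zero_iff.1 h0
  set ℓ := ‖P.sideEnd s - P.cornerPoint s‖
  have hℓ : 0 < ℓ := norm_pos_iff.2 (sub_ne_zero.2 (P.cornerPoint_ne_sideEnd s).symm)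
  obtain ⟨σ, hσ, hu⟩ : ∃ σ : ℝ, σ ≠ 0 ∧
      unitVector θ = σ • (P.sideEnd s - P.cornerPoint s) := by
    have h1 : θ = n * π + P.sideArg s := by linarith
    refine ⟨(-1) ^ n * ℓ⁻¹, mul_ne_zero (zpow_ne_zero _ (by norm_num)) (inv_ne_zero hℓ.ne'), ?_⟩
    have h2 : unitVector θ = ((-1 : ℝ) ^ n) • unitVector (P.sideArg s) := by
      ext i
      fin_cases i
      · simp [unitVector, h1, Real.cos_add, Real.sin_int_mul_pi, Real.cos_int_mul_pi]
      · simp [unitVector, h1, Real.sin_add, Real.sin_int_mul_pi, Real.cos_int_mul_pi]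
    rw [h2, P.sideEnd_sub s, smul_smul, mul_assoc, inv_mul_cancel₀ hℓ.ne', mul_one]
  have hs' := hs
  rw [openSide, openSegment_eq_image'] at hs'
  obtain ⟨a, ⟨ha0, ha1⟩, ha⟩ := hs'
  -- If the direction were parallel to the side, a short initial piece of the segment would run
  -- along the side, on the boundary.
  have hcont : Filter.Tendsto (fun t : ℝ => a + t * σ) (nhdsWithin 0 (Set.Ioi 0)) (nhds (a + 0 * σ)) :=
    (Continuous.tendsto (by fun_prop) 0).mono_left nhdsWithin_le_nhds
  rw [zero_mul, add_zero] at hcont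
  obtain ⟨t, ht1, ht2⟩ := ((hcont.eventually (Icc_mem_nhds ha0 ha1)).and
    (Ioo_mem_nhdsGT x.length_pos)).exists
  refine x.notMem_bdry ht2.1 ht2.2 (P.segment_subset_bdry s ?_)
  rw [segment_eq_image', hθ, hu, ← ha]
  refine ⟨a + t * σ, ht1, ?_⟩
  simp only
  rw [add_smul, add_assoc, smul_smul]

/-- Near a point of an open side, the boundary is contained in the line of that side. -/
theorem exists_ball_inter_bdry {s : P.Corner} {b : Plane} (hb : b ∈ P.openSide s) :
    ∃ ε > 0, ∀ y ∈ Metric.ball b ε, y ∈ P.bdry → inner ℝ (y - b) (P.sideNormal s) = 0 := by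
  have hcl : IsClosed (⋃ t : {t // t ≠ s}, segment ℝ (P.cornerPoint t.1) (P.sideEnd t.1)) :=
    isClosed_iUnion_of_finite fun t => (isCompact_segment _ _).isClosed
  have hbm : b ∈ (⋃ t : {t // t ≠ s}, segment ℝ (P.cornerPoint t.1) (P.sideEnd t.1))ᶜ := by
    rw [Set.mem_compl_iff, Set.mem_iUnion, not_exists]
    rintro ⟨t, ht⟩ hm
    exact ht (P.eq_of_mem_openSide_of_mem_segment hb hm).symm
  obtain ⟨ε, hε, hball⟩ := Metric.isOpen_iff.1 hcl.isOpen_compl b hbm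
  refine ⟨ε, hε, fun y hy hyb => ?_⟩
  obtain ⟨t, ht⟩ := P.mem_bdry_iff.1 hyb
  by_cases hts : t = s
  · subst hts
    exact P.inner_sub_sideNormal ht (openSegment_subset_segment ℝ _ _ hb)
  · exact absurd (Set.mem_iUnion_of_mem ⟨t, hts⟩ ht) (hball hy)

/-- The inverse of the billiard map. -/
theorem exists_previous {y : P.PhasePoint} {s : P.Corner} (hs : y.source ∈ P.openSide s) {θ : ℝ}
    (hθ : y.direction = unitVector (2 * P.sideArg s - θ)) :
    ∃ x : P.PhasePoint, x.target = y.source ∧ x.direction = unitVector θ := by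
  obtain ⟨ε, hε, hball⟩ := P.exists_ball_inter_bdry hs
  have hsin := PhasePoint.sin_ne_zero hs hθ
  set b := y.source
  set σ := Real.sin (2 * P.sideArg s - θ - P.sideArg s)
  have hσ : Real.sin (θ - P.sideArg s) = -σ := by
    rw [← Real.sin_neg]; congr 1; ring
  -- `H` is the half disc at `b` on the side into which `y` departs. It is convex, avoids the
  -- boundary and meets the domain, so it lies in the domain. The reversed direction `-unitVector θ`
  -- has the same normal component `σ` as the direction of `y`, so it leads into `H` as well.
  set H : Set Plane := Metric.ball b ε ∩ {z | 0 < inner ℝ (z - b) (P.sideNormal s) * σ}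
  have hconv : Convex ℝ H := by
    refine (convex_ball b ε).inter ?_
    intro z hz w hw α β hα hβ hαβ
    have e : α • z + β • w - b = α • (z - b) + β • (w - b) := by
      obtain rfl : α = 1 - β := by linarith
      simp only [sub_smul, smul_sub, one_smul]
      abel
    simp only [Set.mem_ofPred_eq] at hz hw ⊢
    rw [e, inner_add_left, real_inner_smul_left, real_inner_smul_left, add_mul, mul_assoc, mul_assoc]
    rcases hα.eq_or_lt with rfl | hα
    · obtain rfl : β = 1 := by linarith
      simpa using hw
    · have := mul_pos hα hz
      have := mul_nonneg hβ hw.le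
      linarith
  have hHb : H ⊆ P.bdryᶜ := by
    rintro z ⟨hz1, hz2⟩ hzb
    simp only [Set.mem_ofPred_eq, hball z hz1 hzb, zero_mul, lt_irrefl] at hz2
  have hσ2 : 0 < σ * σ := mul_self_pos.2 hsin
  have hin : ∀ {r : ℝ}, 0 < r → r < ε → ∀ {w : Plane}, ‖w‖ = 1 →
      inner ℝ w (P.sideNormal s) = σ → b + r • w ∈ H := by
    intro r hr hrε w hw hwi
    refine ⟨?_, ?_⟩
    · rw [Metric.mem_ball, dist_eq_norm, add_sub_cancel_left, norm_smul, hw, mul_one,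
        Real.norm_of_nonneg hr.le]
      exact hrε
    · rw [Set.mem_ofPred_eq, add_sub_cancel_left, real_inner_smul_left, hwi, mul_assoc]
      positivity
  obtain ⟨r, hr, hr'⟩ := exists_between (lt_min hε y.length_pos)
  rw [lt_min_iff] at hr'
  have hHR : H ⊆ P.region := P.subset_region hHb hconv.isPreconnected
    (hin hr hr'.1 y.norm_direction (by rw [hθ, inner_sideNormal])) (y.mem_region hr hr'.2)
  refine P.exists_phasePoint y.source_mem ⟨ε, hε, fun r hr hr' => hHR ?_⟩
  rw [sub_eq_add_neg, ← smul_neg]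
  refine hin hr hr' (by rw [norm_neg, norm_unitVector]) ?_
  rw [inner_neg_left, inner_sideNormal, hσ, neg_neg]

end EuclideanPolygon

end PolygonalBilliard

/-! ### Measurable families of finite point sets. -/

namespace PolygonalBilliard

open Finset

/-- A family of finite sets of points that is listed by finitely many measurable functions. -/
def IsMeasurableFamily (A : ℝ → Set Plane) : Prop :=
  ∃ (ι : Type) (_ : Finite ι) (E : ι → Set ℝ) (q : ι → ℝ → Plane),
    (∀ j, MeasurableSet (E j)) ∧ (∀ j, Measurable (q j)) ∧
      ∀ θ, A θ = {p | ∃ j, θ ∈ E j ∧ q j θ = p}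

namespace IsMeasurableFamily

variable {A : ℝ → Set Plane}

theorem const {F : Set Plane} (hF : F.Finite) : IsMeasurableFamily fun _ => F :=
  ⟨F, hF.to_subtype, fun _ => Set.univ, fun p _ => p, fun _ => MeasurableSet.univ,
    fun _ => measurable_const, fun θ => by ext p; simp⟩

theorem iUnion {κ : Type} [Finite κ] {A : κ → ℝ → Set Plane} (h : ∀ c, IsMeasurableFamily (A c)) :
    IsMeasurableFamily fun θ => ⋃ c, A c θ := by
  choose ι hι E q hE hq hA using h
  refine ⟨Σ c, ι c, inferInstance, fun j => E j.1 j.2, fun j => q j.1 j.2, fun j => hE _ _,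
    fun j => hq _ _, fun θ => ?_⟩
  ext p
  simp only [Set.mem_iUnion, hA, Set.mem_ofPred_eq, Sigma.exists]

theorem comp (h : IsMeasurableFamily A) {g : ℝ → ℝ} (hg : Measurable g) :
    IsMeasurableFamily fun θ => A (g θ) := by
  obtain ⟨ι, hι, E, q, hE, hq, hA⟩ := h
  exact ⟨ι, hι, fun j => g ⁻¹' E j, fun j θ => q j (g θ), fun j => hg (hE j),
    fun j => (hq j).comp hg, fun θ => hA (g θ)⟩

theorem inter (h : IsMeasurableFamily A) {C : Set Plane} (hC : MeasurableSet C) :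
    IsMeasurableFamily fun θ => A θ ∩ C := by
  obtain ⟨ι, hι, E, q, hE, hq, hA⟩ := h
  refine ⟨ι, hι, fun j => E j ∩ q j ⁻¹' C, q, fun j => (hE j).inter (hq j hC), hq, fun θ => ?_⟩
  ext p
  simp only [hA, Set.mem_inter_iff, Set.mem_ofPred_eq, Set.mem_preimage]
  constructor
  · rintro ⟨⟨j, hj, rfl⟩, hp⟩
    exact ⟨j, ⟨hj, hp⟩, rfl⟩
  · rintro ⟨j, ⟨hj, hp⟩, rfl⟩
    exact ⟨⟨j, hj, rfl⟩, hp⟩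

/-- The image under a measurable relation each of whose values is among finitely many measurable
functions of the argument. -/
theorem relImage (h : IsMeasurableFamily A) {κ : Type} [Finite κ] {f : κ → Plane × ℝ → Plane}
    (hf : ∀ c, Measurable (f c)) {M : Set (Plane × Plane × ℝ)} (hM : MeasurableSet M)
    (hMf : ∀ a b θ, (a, b, θ) ∈ M → ∃ c, f c (b, θ) = a) :
    IsMeasurableFamily fun θ => {a | ∃ b ∈ A θ, (a, b, θ) ∈ M} := by
  obtain ⟨ι, hι, E, q, hE, hq, hA⟩ := h
  have hm : ∀ j c, Measurable fun θ => f c (q j θ, θ) := fun j c =>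
    (hf c).comp ((hq j).prodMk measurable_id)
  refine ⟨ι × κ, inferInstance,
    fun j => E j.1 ∩ (fun θ => (f j.2 (q j.1 θ, θ), q j.1 θ, θ)) ⁻¹' M,
    fun j θ => f j.2 (q j.1 θ, θ), fun j => (hE j.1).inter
      (((hm j.1 j.2).prodMk ((hq j.1).prodMk measurable_id)) hM), fun j => hm _ _, fun θ => ?_⟩
  ext a
  simp only [hA, Set.mem_ofPred_eq, Set.mem_inter_iff, Set.mem_preimage, Prod.exists]
  constructor
  · rintro ⟨_, ⟨j, hj, rfl⟩, hab⟩
    obtain ⟨c, rfl⟩ := hMf _ _ _ hab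
    exact ⟨j, c, ⟨hj, hab⟩, rfl⟩
  · rintro ⟨j, c, ⟨hj, hab⟩, rfl⟩
    exact ⟨_, ⟨j, hj, rfl⟩, hab⟩

theorem exists_forall_ncard_le (h : IsMeasurableFamily A) :
    ∃ m : ℕ, ∀ θ, (A θ).Finite ∧ (A θ).ncard ≤ m := by
  obtain ⟨ι, hι, E, q, hE, hq, hA⟩ := h
  refine ⟨Nat.card ι, fun θ => ?_⟩
  have hsub : A θ ⊆ Set.range fun j => q j θ := by
    rw [hA]
    rintro _ ⟨j, -, rfl⟩
    exact ⟨j, rfl⟩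
  have hfin := Set.finite_range fun j => q j θ
  refine ⟨hfin.subset hsub, (Set.ncard_le_ncard hsub hfin).trans ?_⟩
  rw [← Nat.card_coe_set_eq]
  exact Finite.card_range_le _

/-- Different indices may list the same point, so indices are added one by one. A new index `a` adds
one exactly on the measurable set `N` where it is active and its point differs from all points
already listed. -/
theorem measurable_ncard (h : IsMeasurableFamily A) : Measurable fun θ => ((A θ).ncard : ℝ) := by
  classical
  obtain ⟨ι, hι, E, q, hE, hq, hA⟩ := h
  have := Fintype.ofFinite ι
  have key : ∀ t : Finset ι,
      Measurable fun θ => (({p | ∃ j ∈ t, θ ∈ E j ∧ q j θ = p} : Set Plane).ncard : ℝ) := by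
    intro t
    induction t using Finset.induction_on with
    | empty => simp
    | insert a t ha ih =>
      set N : Set ℝ := E a ∩ ⋂ j ∈ t, (E j ∩ {θ | q j θ = q a θ})ᶜ with hN
      have hNm : MeasurableSet N := (hE a).inter (Finset.measurableSet_biInter t fun j _ =>
        ((hE j).inter (measurableSet_eq_fun (hq j) (hq a))).compl)
      have hfin : ∀ θ, ({p | ∃ j ∈ t, θ ∈ E j ∧ q j θ = p} : Set Plane).Finite := fun θ =>
        ((t.finite_toSet.image fun j => q j θ)).subset (by
          rintro _ ⟨j, hj, -, rfl⟩
          exact ⟨j, hj, rfl⟩)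
      have e : (fun θ => (({p | ∃ j ∈ insert a t, θ ∈ E j ∧ q j θ = p} : Set Plane).ncard : ℝ)) =
          fun θ => (({p | ∃ j ∈ t, θ ∈ E j ∧ q j θ = p} : Set Plane).ncard : ℝ) +
            N.indicator (fun _ => 1) θ := by
        funext θ
        by_cases hθ : θ ∈ N
        · have hmem : q a θ ∉ ({p | ∃ j ∈ t, θ ∈ E j ∧ q j θ = p} : Set Plane) := by
            rintro ⟨j, hj, hθj, he⟩
            have := Set.mem_iInter₂.1 hθ.2 j hj
            exact this ⟨hθj, he⟩
          have : ({p | ∃ j ∈ insert a t, θ ∈ E j ∧ q j θ = p} : Set Plane) =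
              insert (q a θ) {p | ∃ j ∈ t, θ ∈ E j ∧ q j θ = p} := by
            ext p
            simp only [Set.mem_ofPred_eq, Finset.mem_insert, Set.mem_insert_iff, exists_eq_or_imp]
            exact or_congr_left ⟨fun h => h.2.symm, fun h => ⟨hθ.1, h.symm⟩⟩
          rw [this, Set.ncard_insert_of_notMem hmem (hfin θ), Set.indicator_of_mem hθ]
          push_cast
          rfl
        · have : ({p | ∃ j ∈ insert a t, θ ∈ E j ∧ q j θ = p} : Set Plane) =
              {p | ∃ j ∈ t, θ ∈ E j ∧ q j θ = p} := by
            ext p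
            simp only [Set.mem_ofPred_eq, Finset.mem_insert, exists_eq_or_imp]
            refine or_iff_right_of_imp ?_
            rintro ⟨hθa, rfl⟩
            by_contra! hcon
            refine hθ ⟨hθa, Set.mem_iInter₂.2 fun j hj => ?_⟩
            rintro ⟨hθj, he⟩
            exact hcon j hj hθj he
          rw [this, Set.indicator_of_notMem hθ, add_zero]
      rw [e]
      exact ih.add (measurable_const.indicator hNm)
  simpa [hA] using key Finset.univ

theorem intervalIntegrable (h : IsMeasurableFamily A) (a b : ℝ) :
    IntervalIntegrable (fun θ => ((A θ).ncard : ℝ)) MeasureTheory.volume a b := by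
  obtain ⟨m, hm⟩ := h.exists_forall_ncard_le
  rw [intervalIntegrable_iff]
  refine MeasureTheory.Measure.integrableOn_of_bounded (M := m) (by simp)
    h.measurable_ncard.aestronglyMeasurable (Filter.Eventually.of_forall fun θ => ?_)
  rw [Real.norm_of_nonneg (by positivity)]
  exact_mod_cast (hm θ).2

end IsMeasurableFamily

theorem isOpen_setOf_forall_mem {X Y : Type*} [TopologicalSpace X] [TopologicalSpace Y] {K : Set Y}
    (hK : IsCompact K) {U : Set (X × Y)} (hU : IsOpen U) :
    IsOpen {x | ∀ y ∈ K, (x, y) ∈ U} := by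
  rw [isOpen_iff_eventually]
  intro x hx
  exact hK.eventually_forall_of_forall_eventually fun y hy => hU.mem_nhds (hx y hy)

/-- The pairs of points whose open segment lies in an open set form a Borel set. -/
theorem measurableSet_openSegment_subset {U : Set Plane} (hU : IsOpen U) :
    MeasurableSet {p : Plane × Plane | openSegment ℝ p.1 p.2 ⊆ U} := by
  -- The open parameter interval is exhausted by compact ones, and for a compact one the condition
  -- on the end points is open.
  have e : {p : Plane × Plane | openSegment ℝ p.1 p.2 ⊆ U} =
      ⋂ n : ℕ, {p | ∀ t ∈ Set.Icc (1 / (n + 1) : ℝ) (1 - 1 / (n + 1)),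
        (p, t) ∈ {z : (Plane × Plane) × ℝ | z.1.1 + z.2 • (z.1.2 - z.1.1) ∈ U}} := by
    ext p
    simp only [Set.mem_iInter, Set.mem_ofPred_eq, openSegment_eq_image']
    constructor
    · rintro h n t ⟨ht1, ht2⟩
      have : (0 : ℝ) < 1 / (n + 1) := by positivity
      exact h ⟨t, ⟨by linarith, by linarith⟩, rfl⟩
    · rintro h _ ⟨t, ⟨ht1, ht2⟩, rfl⟩
      obtain ⟨n, hn⟩ := exists_nat_one_div_lt (lt_min ht1 (sub_pos.2 ht2))
      rw [lt_min_iff] at hn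
      exact h n t ⟨hn.1.le, by linarith [hn.2]⟩
  rw [e]
  refine MeasurableSet.iInter fun n => (isOpen_setOf_forall_mem isCompact_Icc ?_).measurableSet
  exact hU.preimage (by fun_prop)

namespace EuclideanPolygon

variable (P : EuclideanPolygon)

/-- The segment from `a` to `b` is a phase point with direction `θ`. -/
def IsPhase (a b : Plane) (θ : ℝ) : Prop :=
  ∃ x : P.PhasePoint, x.source = a ∧ x.target = b ∧ x.direction = unitVector θ

theorem isPhase_iff {a b : Plane} {θ : ℝ} : P.IsPhase a b θ ↔ a ∈ P.bdry ∧ b ∈ P.bdry ∧ a ≠ b ∧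
    openSegment ℝ a b ⊆ P.region ∧ ‖b - a‖⁻¹ • (b - a) = unitVector θ := by
  constructor
  · rintro ⟨x, rfl, rfl, h⟩
    exact ⟨x.source_mem, x.target_mem, x.source_ne_target, x.interior_subset, h⟩
  · rintro ⟨h1, h2, h3, h4, h5⟩
    exact ⟨⟨a, b, h1, h2, h3, h4⟩, rfl, rfl, h5⟩

theorem measurableSet_isPhase :
    MeasurableSet {p : Plane × Plane × ℝ | P.IsPhase p.1 p.2.1 p.2.2} := by
  have hb := P.isCompact_bdry.isClosed.measurableSet
  have hu := continuous_unitVector.measurable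
  have h1 : MeasurableSet {p : Plane × Plane × ℝ | p.1 ∈ P.bdry} := measurable_fst hb
  have h2 : MeasurableSet {p : Plane × Plane × ℝ | p.2.1 ∈ P.bdry} :=
    (measurable_fst.comp measurable_snd) hb
  have h3 : MeasurableSet {p : Plane × Plane × ℝ | p.1 = p.2.1} :=
    measurableSet_eq_fun measurable_fst (measurable_fst.comp measurable_snd)
  have h4 : MeasurableSet {p : Plane × Plane × ℝ | openSegment ℝ p.1 p.2.1 ⊆ P.region} :=
    (measurable_fst.prodMk (measurable_fst.comp measurable_snd))
      (measurableSet_openSegment_subset P.isOpen_region)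
  have h5 : MeasurableSet {p : Plane × Plane × ℝ |
      ‖p.2.1 - p.1‖⁻¹ • (p.2.1 - p.1) = unitVector p.2.2} :=
    measurableSet_eq_fun (by fun_prop) (by fun_prop)
  have e : {p : Plane × Plane × ℝ | P.IsPhase p.1 p.2.1 p.2.2} =
      {p | p.1 ∈ P.bdry} ∩ ({p | p.2.1 ∈ P.bdry} ∩ ({p | p.1 = p.2.1}ᶜ ∩
        ({p | openSegment ℝ p.1 p.2.1 ⊆ P.region} ∩
          {p | ‖p.2.1 - p.1‖⁻¹ • (p.2.1 - p.1) = unitVector p.2.2}))) := by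
    ext p
    exact P.isPhase_iff
  rw [e]
  exact h1.inter (h2.inter (h3.compl.inter (h4.inter h5)))

/-- The source of a phase point is a corner or the intersection of its line with that of a side. -/
theorem isMeasurableFamily_isPhase {A : ℝ → Set Plane} (h : IsMeasurableFamily A) :
    IsMeasurableFamily fun θ => {a | ∃ b ∈ A θ, P.IsPhase a b θ} := by
  have hu := continuous_unitVector.measurable
  refine h.relImage (κ := P.Corner ⊕ P.Corner)
    -- On side `s` the source is found by going back from `b` along the direction until the normal
    -- coordinate of the side vanishes. The denominator is nonzero whenever the formula is used, by
    -- transversality.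
    (f := Sum.elim (fun c _ => P.cornerPoint c) fun s p =>
      p.1 - (inner ℝ (p.1 - P.cornerPoint s) (P.sideNormal s) /
        inner ℝ (unitVector p.2) (P.sideNormal s)) • unitVector p.2)
    ?_ P.measurableSet_isPhase ?_
  · rintro (c | s)
    · exact measurable_const
    · simp only [Sum.elim_inr]
      fun_prop
  · rintro a b θ ⟨x, rfl, rfl, hx⟩
    rcases P.mem_corners_or_openSide x.source_mem with hc | ⟨s, hs⟩
    · rw [corners_eq_range] at hc
      obtain ⟨c, hc⟩ := hc
      exact ⟨Sum.inl c, hc⟩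
    · refine ⟨Sum.inr s, ?_⟩
      have h1 := PhasePoint.sin_ne_zero hs hx
      rw [← inner_sideNormal] at h1
      have h2 := P.inner_sub_sideNormal (openSegment_subset_segment ℝ _ _ hs)
        (left_mem_segment ℝ _ _)
      have h3 : x.target - P.cornerPoint s =
          (x.source - P.cornerPoint s) + x.length • unitVector θ := by
        rw [x.target_eq, hx]; abel
      simp only [Sum.elim_inr]
      rw [h3, inner_add_left, h2, zero_add, real_inner_smul_left, mul_div_cancel_right₀ _ h1,
        x.source_eq, hx]

end EuclideanPolygon

end PolygonalBilliard

/-! ### Counting singular orbits and integrating over the direction. -/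

namespace PolygonalBilliard

open Finset MeasureTheory

namespace EuclideanPolygon

variable {P : EuclideanPolygon}

namespace PhasePoint

theorem hasSingularOrbit_one {x : P.PhasePoint} : x.HasSingularOrbit 1 ↔ x.IsSingular := by
  constructor
  · rintro ⟨-, o, rfl, -, h⟩
    exact h
  · intro h
    exact ⟨le_rfl, fun _ => x, rfl, fun i hi => by omega, h⟩

theorem hasSingularOrbit_add_two {x : P.PhasePoint} {k : ℕ} : x.HasSingularOrbit (k + 2) ↔
    ¬ x.IsSingular ∧ ∃ y, x.IsNext y ∧ y.HasSingularOrbit (k + 1) := by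
  constructor
  · rintro ⟨-, o, rfl, h1, h2⟩
    refine ⟨(h1 0 (by omega)).1, o 1, (h1 0 (by omega)).2, by omega, fun i => o (i + 1), rfl,
      fun i hi => h1 (i + 1) (by omega), h2⟩
  · rintro ⟨hx, y, hxy, -, o, rfl, h1, h2⟩
    refine ⟨by omega, fun i => Nat.casesOn i x o, rfl, fun i hi => ?_, by exact h2⟩
    cases i with
    | zero => exact ⟨hx, hxy⟩
    | succ i => exact h1 i (by omega)

theorem HasSingularOrbit.unique {x : P.PhasePoint} {k l : ℕ} (hk : x.HasSingularOrbit k)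
    (hl : x.HasSingularOrbit l) : k = l := by
  induction k generalizing x l with
  | zero => exact absurd hk.1 (by omega)
  | succ k ih =>
    obtain ⟨l, rfl⟩ : ∃ m, l = m + 1 := ⟨l - 1, by have := hl.1; omega⟩
    rcases k with _ | k <;> rcases l with _ | l
    · rfl
    · exact absurd (hasSingularOrbit_one.1 hk) (hasSingularOrbit_add_two.1 hl).1
    · exact absurd (hasSingularOrbit_one.1 hl) (hasSingularOrbit_add_two.1 hk).1
    · obtain ⟨-, y, hxy, hy⟩ := hasSingularOrbit_add_two.1 hk
      obtain ⟨-, z, hxz, hz⟩ := hasSingularOrbit_add_two.1 hl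
      rw [← next_unique hxy hxz] at hz
      rw [ih hy hz]

theorem isNext_iff {x y : P.PhasePoint} {θ : ℝ} (hx : x.direction = unitVector θ) :
    x.IsNext y ↔ y.source = x.target ∧ ∃ s, x.target ∈ P.openSide s ∧
      y.direction = unitVector (2 * P.sideArg s - θ) := by
  refine and_congr_right fun _ => ?_
  constructor
  · rintro ⟨c, i, h1, h2⟩
    exact ⟨⟨c, i⟩, h1, by rw [h2, hx]; exact P.reflection_side ⟨c, i⟩ θ⟩
  · rintro ⟨⟨c, i⟩, h1, h2⟩
    exact ⟨c, i, h1, by rw [h2, hx]; exact (P.reflection_side ⟨c, i⟩ θ).symm⟩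

end PhasePoint

variable (P)

/-- The phase points in direction `θ` that yield a singular orbit of length exactly `k`. -/
def singularOrbits (k : ℕ) (θ : ℝ) : Set P.PhasePoint := {x | x ∈ P.fiber θ ∧ x.HasSingularOrbit k}

/-- The starting points of the singular orbits of length `k` in direction `θ`. -/
def sources (k : ℕ) (θ : ℝ) : Set Plane := PhasePoint.source '' P.singularOrbits k θ

theorem source_injOn_fiber (θ : ℝ) : Set.InjOn PhasePoint.source (P.fiber θ) :=
  fun _ hx _ hy h => PhasePoint.ext_source h (hx.trans hy.symm)

theorem target_injOn_fiber (θ : ℝ) : Set.InjOn PhasePoint.target (P.fiber θ) :=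
  fun _ hx _ hy h => PhasePoint.ext_target h (hx.trans hy.symm)

theorem singularOrbits_subset_fiber (k : ℕ) (θ : ℝ) : P.singularOrbits k θ ⊆ P.fiber θ :=
  fun _ hx => hx.1

theorem ncard_sources (k : ℕ) (θ : ℝ) : (P.sources k θ).ncard = (P.singularOrbits k θ).ncard :=
  Set.InjOn.ncard_image ((P.source_injOn_fiber θ).mono (P.singularOrbits_subset_fiber k θ))

theorem sources_one (θ : ℝ) : P.sources 1 θ = {a | ∃ b ∈ P.corners, P.IsPhase a b θ} := by
  ext a
  constructor
  · rintro ⟨x, ⟨hx, h⟩, rfl⟩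
    exact ⟨x.target, PhasePoint.hasSingularOrbit_one.1 h, x, rfl, rfl, hx⟩
  · rintro ⟨b, hb, x, rfl, rfl, hx⟩
    exact ⟨x, ⟨hx, PhasePoint.hasSingularOrbit_one.2 hb⟩, rfl⟩

/-- Once the direction is fixed, the end point decides: it determines the side and the reflected
direction, hence the rest of the orbit. Nonsingularity comes for free, as open sides contain no
corner. -/
theorem mem_singularOrbits_add_two {k : ℕ} {θ : ℝ} {x : P.PhasePoint} (hx : x ∈ P.fiber θ) :
    x ∈ P.singularOrbits (k + 2) θ ↔
      x.target ∈ ⋃ s, P.sources (k + 1) (2 * P.sideArg s - θ) ∩ P.openSide s := by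
  rw [Set.mem_iUnion]
  constructor
  · rintro ⟨-, h⟩
    obtain ⟨-, y, hxy, hy⟩ := PhasePoint.hasSingularOrbit_add_two.1 h
    obtain ⟨h1, s, h2, h3⟩ := (PhasePoint.isNext_iff hx).1 hxy
    exact ⟨s, ⟨y, ⟨h3, hy⟩, h1⟩, h2⟩
  · rintro ⟨s, ⟨y, ⟨h3, hy⟩, h1⟩, h2⟩
    exact ⟨hx, PhasePoint.hasSingularOrbit_add_two.2
      ⟨fun h => Set.disjoint_left.1 (P.openSide_disjoint_corners s) h2 h, y,
        (PhasePoint.isNext_iff hx).2 ⟨h1, s, h2, h3⟩, hy⟩⟩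

theorem sources_add_two (k : ℕ) (θ : ℝ) : P.sources (k + 2) θ =
    {a | ∃ b ∈ ⋃ s, P.sources (k + 1) (2 * P.sideArg s - θ) ∩ P.openSide s, P.IsPhase a b θ} := by
  ext a
  constructor
  · rintro ⟨x, hx, rfl⟩
    exact ⟨x.target, (P.mem_singularOrbits_add_two hx.1).1 hx, x, rfl, rfl, hx.1⟩
  · rintro ⟨b, hb, x, rfl, rfl, hx⟩
    exact ⟨x, (P.mem_singularOrbits_add_two hx).2 hb, rfl⟩

/-- That every such point is attained is the invertibility of the billiard map, `exists_previous`.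
-/
theorem target_image_singularOrbits (k : ℕ) (θ : ℝ) :
    PhasePoint.target '' P.singularOrbits (k + 2) θ =
      ⋃ s, P.sources (k + 1) (2 * P.sideArg s - θ) ∩ P.openSide s := by
  ext b
  constructor
  · rintro ⟨x, hx, rfl⟩
    exact (P.mem_singularOrbits_add_two hx.1).1 hx
  · intro h
    obtain ⟨s, ⟨y, ⟨h3, hy⟩, rfl⟩, h2⟩ := Set.mem_iUnion.1 h
    obtain ⟨x, hx1, hx2⟩ := P.exists_previous h2 h3
    exact ⟨x, (P.mem_singularOrbits_add_two hx2).2 (by rwa [hx1]), hx1⟩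

theorem measurableSet_openSide (s : P.Corner) : MeasurableSet (P.openSide s) := by
  have : P.openSide s = segment ℝ (P.cornerPoint s) (P.sideEnd s) \
      {P.cornerPoint s, P.sideEnd s} := by
    ext x
    constructor
    · intro hx
      refine ⟨openSegment_subset_segment ℝ _ _ hx, ?_⟩
      rintro (rfl | rfl)
      · exact P.cornerPoint_ne_sideEnd s (left_mem_openSegment_iff.1 hx)
      · exact P.cornerPoint_ne_sideEnd s (right_mem_openSegment_iff.1 hx)
    · rintro ⟨hx, hne⟩
      rw [Set.mem_insert_iff, Set.mem_singleton_iff, not_or] at hne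
      exact mem_openSegment_of_ne_left_right (Ne.symm hne.1) (Ne.symm hne.2) hx
  rw [this]
  exact (isCompact_segment _ _).isClosed.measurableSet.diff (Set.toFinite _).measurableSet

/-- Lengthening orbits by one reflects the angle, restricts to the Borel set of an open side and
traces one segment backwards; each operation preserves measurable families. -/
theorem isMeasurableFamily_sources (k : ℕ) : IsMeasurableFamily (P.sources (k + 1)) := by
  induction k with
  | zero =>
    rw [funext P.sources_one]
    exact P.isMeasurableFamily_isPhase (IsMeasurableFamily.const P.finite_corners)
  | succ k ih =>
    rw [funext (P.sources_add_two k)]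
    exact P.isMeasurableFamily_isPhase (IsMeasurableFamily.iUnion fun s =>
      (ih.comp (by fun_prop)).inter (P.measurableSet_openSide s))

theorem finite_singularOrbits (k : ℕ) (θ : ℝ) : (P.singularOrbits (k + 1) θ).Finite := by
  obtain ⟨m, hm⟩ := (P.isMeasurableFamily_sources k).exists_forall_ncard_le
  exact (hm θ).1.of_finite_image
    ((P.source_injOn_fiber θ).mono (P.singularOrbits_subset_fiber _ θ))

theorem ncard_iUnion {α κ : Type*} [Fintype κ] {A : κ → Set α} (hf : ∀ c, (A c).Finite)
    (hd : Pairwise fun c d => Disjoint (A c) (A d)) : (⋃ c, A c).ncard = ∑ c, (A c).ncard := by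
  rw [Set.ncard_iUnion_of_finite hf hd, finsum_eq_sum_of_fintype]

theorem ncard_singularOrbits_add_two (k : ℕ) (θ : ℝ) : (P.singularOrbits (k + 2) θ).ncard =
    ∑ s, (P.sources (k + 1) (2 * P.sideArg s - θ) ∩ P.openSide s).ncard := by
  obtain ⟨m, hm⟩ := (P.isMeasurableFamily_sources k).exists_forall_ncard_le
  rw [← ncard_iUnion (fun s => (hm _).1.subset Set.inter_subset_left) fun s t hst =>
    (P.openSide_disjoint hst).mono Set.inter_subset_right Set.inter_subset_right,
    ← target_image_singularOrbits]
  exact (Set.InjOn.ncard_image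
    ((P.target_injOn_fiber θ).mono (P.singularOrbits_subset_fiber _ θ))).symm

/-- The images of the corners under unfolding `k` times. -/
def unfoldedCorners : ℕ → Set Plane
  | 0 => P.corners
  | k + 1 => ⋃ s, (fun z => P.cornerPoint s +
      (ℝ ∙ (P.sideEnd s - P.cornerPoint s)).reflection (z - P.cornerPoint s)) '' unfoldedCorners k

theorem finite_unfoldedCorners (k : ℕ) : (P.unfoldedCorners k).Finite := by
  induction k with
  | zero => exact P.finite_corners
  | succ k ih => exact Set.finite_iUnion fun s => ih.image _

/-- Unfolding: a singular orbit points to the image of a corner. -/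
theorem exists_unfoldedCorner {k : ℕ} {x : P.PhasePoint} (h : x.HasSingularOrbit (k + 1)) :
    ∃ z ∈ P.unfoldedCorners k, ∃ t : ℝ, 0 < t ∧ z - x.source = t • x.direction := by
  induction k generalizing x with
  | zero =>
    refine ⟨x.target, PhasePoint.hasSingularOrbit_one.1 h, x.length, x.length_pos, ?_⟩
    rw [x.target_eq]; abel
  | succ k ih =>
    obtain ⟨-, y, ⟨h1, c, i, h2, h3⟩, hy⟩ := PhasePoint.hasSingularOrbit_add_two.1 h
    obtain ⟨z, hz, t, ht, hzt⟩ := ih hy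
    set s : P.Corner := ⟨c, i⟩
    have h3' : y.direction =
      (ℝ ∙ (P.sideEnd s - P.cornerPoint s)).reflection x.direction := h3
    have h2' : x.target ∈ P.openSide s := h2
    refine ⟨_, Set.mem_iUnion_of_mem s ⟨z, hz, rfl⟩, x.length + t,
      add_pos x.length_pos ht, ?_⟩
    have e : z - P.cornerPoint s = (x.target - P.cornerPoint s) + t • y.direction := by
      rw [← hzt, h1]; abel
    -- The bounce point lies on the mirror and is fixed, so reflecting the rest of the orbit makes
    -- it continue `x` in a straight line.
    have hfix : (ℝ ∙ (P.sideEnd s - P.cornerPoint s)).reflection (x.target - P.cornerPoint s) =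
        x.target - P.cornerPoint s := by
      rw [Submodule.reflection_eq_self_iff, Submodule.mem_span_singleton]
      rw [openSide, openSegment_eq_image'] at h2'
      obtain ⟨a, -, ha⟩ := h2'
      exact ⟨a, by rw [← ha]; simp⟩
    simp only
    rw [e, map_add, hfix, map_smul, h3', Submodule.reflection_reflection, add_smul]
    rw [x.target_eq]
    abel

theorem countable_directions (w : Plane) : {θ : ℝ | ∃ t : ℝ, 0 < t ∧ w = t • unitVector θ}.Countable := by
  by_cases h : ∃ θ₀ t₀ : ℝ, 0 < t₀ ∧ w = t₀ • unitVector θ₀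
  · obtain ⟨θ₀, t₀, ht₀, rfl⟩ := h
    refine (Set.countable_range fun n : ℤ => θ₀ + n * (2 * π)).mono ?_
    rintro θ ⟨t, ht, he⟩
    obtain ⟨n, hn⟩ := smul_unitVector_inj ht ht₀ he.symm
    exact ⟨n, hn.symm⟩
  · push Not at h
    convert Set.countable_empty
    ext θ
    simp only [Set.mem_ofPred_eq, Set.mem_empty_iff_false, iff_false, not_exists, not_and]
    exact fun t ht => h θ t ht

/-- Only for countably many directions a singular orbit of length `k + 1` starts at a corner. -/
theorem countable_sources_corner (k : ℕ) :
    {θ : ℝ | (P.sources (k + 1) θ ∩ P.corners).Nonempty}.Countable := by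
  refine Set.Countable.mono ?_ (P.finite_corners.countable.biUnion fun c _ =>
    (P.finite_unfoldedCorners k).countable.biUnion fun z _ => countable_directions (z - c))
  rintro θ ⟨a, ⟨x, ⟨hx, h⟩, rfl⟩, hc⟩
  obtain ⟨z, hz, t, ht, he⟩ := P.exists_unfoldedCorner h
  refine Set.mem_biUnion hc (Set.mem_biUnion hz ⟨t, ht, ?_⟩)
  rw [he]
  congr 1

theorem ncard_sources_eq_sum {k : ℕ} {θ : ℝ} (h : ¬ (P.sources (k + 1) θ ∩ P.corners).Nonempty) :
    (P.sources (k + 1) θ).ncard = ∑ s, (P.sources (k + 1) θ ∩ P.openSide s).ncard := by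
  obtain ⟨m, hm⟩ := (P.isMeasurableFamily_sources k).exists_forall_ncard_le
  rw [← ncard_iUnion (fun s => (hm _).1.subset Set.inter_subset_left) fun s t hst =>
    (P.openSide_disjoint hst).mono Set.inter_subset_right Set.inter_subset_right]
  congr 1
  ext a
  rw [← Set.inter_iUnion, Set.mem_inter_iff, iff_self_and, Set.mem_iUnion]
  rintro ⟨x, hx, rfl⟩
  exact (P.mem_corners_or_openSide x.source_mem).resolve_left fun hc => h ⟨_, ⟨x, hx, rfl⟩, hc⟩

theorem sources_periodic (k : ℕ) (θ : ℝ) : P.sources k (θ + 2 * π) = P.sources k θ := by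
  rw [sources, sources, singularOrbits, singularOrbits, fiber, fiber, unitVector_add_two_pi]

/-- The longer orbits are counted side by side in reflected directions. Each reflection leaves the
integral over a period unchanged, and for all but countably many directions the sides account for
all starting points. -/
theorem integral_singularOrbits_add_two (k : ℕ) :
    ∫ θ in (0 : ℝ)..(2 * π), ((P.singularOrbits (k + 2) θ).ncard : ℝ) =
      ∫ θ in (0 : ℝ)..(2 * π), ((P.singularOrbits (k + 1) θ).ncard : ℝ) := by
  have hfam : ∀ s, IsMeasurableFamily fun θ => P.sources (k + 1) θ ∩ P.openSide s := fun s =>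
    (P.isMeasurableFamily_sources k).inter (P.measurableSet_openSide s)
  have hrefl : ∀ s, ∫ θ in (0 : ℝ)..(2 * π),
      ((P.sources (k + 1) (2 * P.sideArg s - θ) ∩ P.openSide s).ncard : ℝ) =
      ∫ θ in (0 : ℝ)..(2 * π), ((P.sources (k + 1) θ ∩ P.openSide s).ncard : ℝ) := fun s => by
    have hper : Function.Periodic
        (fun θ => ((P.sources (k + 1) θ ∩ P.openSide s).ncard : ℝ)) (2 * π) := fun θ => by
      simp only [P.sources_periodic]
    -- The substitution turns the domain into `[2 ω - 2π, 2 ω]`, again a full period.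
    rw [intervalIntegral.integral_comp_sub_left
      (fun θ => ((P.sources (k + 1) θ ∩ P.openSide s).ncard : ℝ))]
    have := hper.intervalIntegral_add_eq (2 * P.sideArg s - 2 * π) 0
    rw [sub_zero]
    rwa [sub_add_cancel, zero_add] at this
  simp only [ncard_singularOrbits_add_two, ← ncard_sources]
  push_cast
  rw [intervalIntegral.integral_finsetSum fun s _ =>
    ((hfam s).comp (g := fun θ => 2 * P.sideArg s - θ) (by fun_prop)).intervalIntegrable _ _,
    sum_congr rfl fun s _ => hrefl s,
    ← intervalIntegral.integral_finsetSum fun s _ => (hfam s).intervalIntegrable _ _]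
  refine intervalIntegral.integral_congr_ae ?_
  have hae : ∀ᵐ θ : ℝ, ¬ (P.sources (k + 1) θ ∩ P.corners).Nonempty :=
    (P.countable_sources_corner k).ae_notMem volume
  filter_upwards [hae] with θ hθ _
  rw [P.ncard_sources_eq_sum hθ]
  push_cast
  rfl

/-- The starting points of the phase points in direction `θ` that end in the corner `s`. -/
def cornerSources (s : P.Corner) (θ : ℝ) : Set Plane := {a | ∃ b ∈ ({P.cornerPoint s} : Set Plane), P.IsPhase a b θ}

theorem ncard_singularOrbits_one (θ : ℝ) : (P.singularOrbits 1 θ).ncard =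
    ∑ s, (P.cornerSources s θ).ncard := by
  rw [← ncard_sources, sources_one, corners_eq_range]
  have hfam : ∀ s, IsMeasurableFamily (P.cornerSources s) := fun s =>
    P.isMeasurableFamily_isPhase (IsMeasurableFamily.const (Set.finite_singleton _))
  rw [← ncard_iUnion (fun s => (hfam s).exists_forall_ncard_le.choose_spec θ |>.1) ?_]
  · congr 1
    ext a
    simp [cornerSources]
  · intro s t hst
    rw [Set.disjoint_left]
    rintro a ⟨_, rfl, x, rfl, hx, hxd⟩ ⟨_, rfl, y, hy, hy', hyd⟩
    have : x = y := PhasePoint.ext_source hy.symm (hxd.trans hyd.symm)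
    rw [this, hy'] at hx
    exact hst (P.cornerPoint_injective hx.symm)

/-- Up to the two bounding directions, the number of segments that reach a given corner is the
indicator of its angle rotated by `π`, so it integrates to that angle. -/
theorem integral_singularOrbits_one :
    ∫ θ in (0 : ℝ)..(2 * π), ((P.singularOrbits 1 θ).ncard : ℝ) = π * P.kappa := by
  obtain ⟨a, b, hab, hsum, H⟩ := P.exists_angles
  have hfam : ∀ s, IsMeasurableFamily (P.cornerSources s) := fun s =>
    P.isMeasurableFamily_isPhase (IsMeasurableFamily.const (Set.finite_singleton _))
  have hneg : ∀ (s : P.Corner) (r θ : ℝ), P.cornerPoint s - r • unitVector θ =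
      P.cornerPoint s + r • unitVector (θ + π) := fun s r θ => by
    rw [unitVector_add_pi, smul_neg, sub_eq_add_neg]
  -- The shift by `π` appears because a segment arriving in direction `θ` leaves the corner
  -- backwards in direction `θ + π`.
  have hone : ∀ s, ∀ θ ∈ Set.Ioo (a s - π) (b s - π), ((P.cornerSources s θ).ncard : ℝ) = 1 := by
    intro s θ hθ
    obtain ⟨ρ, hρ, Hs⟩ := H s
    obtain ⟨x, hx, hxd⟩ := P.exists_phasePoint (P.cornerPoint_mem_bdry s) (θ := θ)
      ⟨ρ, hρ, fun r hr hr' => by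
        rw [hneg]
        exact (Hs r hr hr').1 _ ⟨by linarith [hθ.1], by linarith [hθ.2]⟩⟩
    have : P.cornerSources s θ = {x.source} := by
      ext p
      constructor
      · rintro ⟨_, rfl, y, rfl, hy, hyd⟩
        rw [Set.mem_singleton_iff, PhasePoint.ext_target (hy.trans hx.symm) (hyd.trans hxd.symm)]
      · rintro rfl
        exact ⟨_, rfl, x, rfl, hx, hxd⟩
    rw [this, Set.ncard_singleton, Nat.cast_one]
  have hzero : ∀ s, ∀ θ ∈ Set.Ioo (b s - π) (a s + π), ((P.cornerSources s θ).ncard : ℝ) = 0 := by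
    intro s θ hθ
    obtain ⟨ρ, hρ, Hs⟩ := H s
    have : P.cornerSources s θ = ∅ := by
      rw [Set.eq_empty_iff_forall_notMem]
      rintro _ ⟨_, rfl, y, rfl, hy, hyd⟩
      obtain ⟨r, hr, hr'⟩ := exists_between (lt_min hρ y.length_pos)
      rw [lt_min_iff] at hr'
      have h1 := y.mem_region' hr hr'.2
      rw [hy, hyd, hneg] at h1
      exact (Hs r hr hr'.1).2 _ ⟨by linarith [hθ.1], by linarith [hθ.2]⟩ h1
    rw [this, Set.ncard_empty, Nat.cast_zero]
  have hcongr : ∀ {f : ℝ → ℝ} {c d e : ℝ}, c ≤ d → (∀ θ ∈ Set.Ioo c d, f θ = e) →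
      ∫ θ in c..d, f θ = (d - c) * e := by
    intro f c d e hcd h
    rw [intervalIntegral.integral_of_le hcd, integral_Ioc_eq_integral_Ioo,
      setIntegral_congr_fun measurableSet_Ioo h, ← integral_Ioc_eq_integral_Ioo,
      ← intervalIntegral.integral_of_le hcd, intervalIntegral.integral_const, smul_eq_mul]
  have hs : ∀ s, ∫ θ in (0 : ℝ)..(2 * π), ((P.cornerSources s θ).ncard : ℝ) = b s - a s := by
    intro s
    have hper : Function.Periodic (fun θ => ((P.cornerSources s θ).ncard : ℝ)) (2 * π) :=
      fun θ => by simp only [cornerSources, IsPhase, unitVector_add_two_pi]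
    -- The period is moved to start at `a s - π`, where it splits into the interval on which the
    -- count is one and the interval on which it is zero.
    have h1 := hper.intervalIntegral_add_eq 0 (a s - π)
    rw [zero_add, show a s - π + 2 * π = a s + π by ring] at h1
    rw [h1, ← intervalIntegral.integral_add_adjacent_intervals (b := b s - π)
      ((hfam s).intervalIntegrable _ _) ((hfam s).intervalIntegrable _ _),
      hcongr (by linarith [(hab s).1]) (hone s), hcongr (by linarith [(hab s).2]) (hzero s)]
    ring
  simp only [ncard_singularOrbits_one]
  push_cast
  rw [intervalIntegral.integral_finsetSum fun s _ => (hfam s).intervalIntegrable _ _,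
    sum_congr rfl fun s _ => hs s, hsum]

theorem integral_singularOrbits (k : ℕ) :
    ∫ θ in (0 : ℝ)..(2 * π), ((P.singularOrbits (k + 1) θ).ncard : ℝ) = π * P.kappa := by
  induction k with
  | zero => exact P.integral_singularOrbits_one
  | succ k ih => rw [P.integral_singularOrbits_add_two, ih]

theorem singularSet_eq_iUnion (θ : ℝ) (n : ℕ) :
    P.singularSet θ n = ⋃ k : Fin n, P.singularOrbits (k + 1) θ := by
  ext x
  rw [Set.mem_iUnion]
  constructor
  · rintro ⟨hx, k, hk, h⟩
    have hk1 := h.1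
    exact ⟨⟨k - 1, by omega⟩, hx, by simpa [Nat.sub_add_cancel hk1] using h⟩
  · rintro ⟨k, hx, h⟩
    exact ⟨hx, k + 1, k.2, h⟩

theorem gd_eq_sum (θ : ℝ) (n : ℕ) :
    (P.gd θ n : ℝ) = ∑ k : Fin n, ((P.singularOrbits (k + 1) θ).ncard : ℝ) := by
  rw [gd, singularSet_eq_iUnion, ncard_iUnion (fun k : Fin n => P.finite_singularOrbits k θ), Nat.cast_sum]
  intro k l hkl
  rw [Set.disjoint_left]
  rintro x ⟨-, hk⟩ ⟨-, hl⟩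
  have := hk.unique hl
  exact hkl (Fin.ext (by omega))

end EuclideanPolygon

end PolygonalBilliard

theorem mainTheorem10 (P : PolygonalBilliard.EuclideanPolygon) (n : ℕ) :
    (∀ θ : ℝ, (P.singularSet θ n).Finite) ∧
      IntervalIntegrable (fun θ : ℝ => (P.gd θ n : ℝ)) MeasureTheory.volume 0 (2 * π) ∧
      ∫ θ in (0 : ℝ)..(2 * π), (P.gd θ n : ℝ) = π * (P.kappa : ℝ) * (n : ℝ) := by
  have hint : ∀ k : ℕ, IntervalIntegrable
      (fun θ => ((P.singularOrbits (k + 1) θ).ncard : ℝ)) MeasureTheory.volume 0 (2 * π) := by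
    intro k
    simp only [← P.ncard_sources]
    exact (P.isMeasurableFamily_sources k).intervalIntegrable _ _
  refine ⟨fun θ => ?_, ?_, ?_⟩
  · rw [P.singularSet_eq_iUnion]
    exact Set.finite_iUnion fun k => P.finite_singularOrbits k θ
  · simp only [P.gd_eq_sum]
    have e : (fun θ => ∑ k : Fin n, ((P.singularOrbits (k + 1) θ).ncard : ℝ)) =
        ∑ k : Fin n, fun θ => ((P.singularOrbits (k + 1) θ).ncard : ℝ) := by
      funext θ
      rw [Finset.sum_apply]
    rw [e]
    exact IntervalIntegrable.sum _ fun k _ => hint k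
  · simp only [P.gd_eq_sum]
    rw [intervalIntegral.integral_finsetSum fun (k : Fin n) _ => hint k]
    simp only [P.integral_singularOrbits]
    rw [Finset.sum_const, Finset.card_univ, Fintype.card_fin, nsmul_eq_mul]
    ring
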